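/- **Setting.** Fix a mass $\mu>0$ and $\alpha\in(0,1)$, and put $\omega(p)=p^\alpha$. For $\boldsymbol\zeta\in\mathbb{C}^k$ let $p(\boldsymbol\zeta)=\sum_{j}\mu(\cosh\zeta_j,\sinh\zeta_j)$, for $\boldsymbol\theta\in\mathbb{R}^m$ let $E(\boldsymbol\theta)=\sum_j\cosh\theta_j$, and let $M^{\mathrm{odd}}_{k}(\boldsymbol\zeta)=\prod_{i<j}\tanh\frac{\zeta_i-\zeta_j}{2}$. Let $\Lambda^\pm$ be the algebra of symmetric Laurent functions, i.e. the commutative $\mathbb{C}$-algebra freely generated by the power sums $p_k=\sum_j x_j^k$, $k\in\mathbb{Z}\setminus\{0\}$; $P\in\Lambda^\pm$ can be evaluated at any number of nonzero variables. For $y>0$ let $\alpha_y^\pm:\Lambda^\pm\to\Lambda^\pm$ be the homomorphism substituting $x_1\to y$, $x_2\to -y$, $x_{j+2}\to x_j$, that is, $p_k\mapsto y^k+(-y)^k+p_k$, and let $\Lambda^\pm_{\mathrm I}$ be the subalgebra of elements invariant under all $\alpha_y^\pm$ (so $P(y,-y,\boldsymbol x)=P(\boldsymbol x)$). For $g\in\mathcal{C}_c^\infty(\mathbb{R}^2)$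 let $\tilde g(p)=\frac1{2\pi}\int d^2x\,e^{i(p^0x^0-p^1x^1)}g(x)$, $p\in\mathbb{C}^2$. For open $\mathcal{O}\subset\mathbb{R}^2$, $\mathcal{D}_\alpha(\mathcal{O})$ is the set of all complex-valued $g\in\mathcal{C}_c^\infty(\mathcal{O})$ such that $\sup_{p\in\mathbb{R}^2}\big|e^{c\|p\|_\infty^\alpha}\,\partial_{p^0}^{k_0}\partial_{p^1}^{k_1}\tilde g(p)\big|<\infty$ for all $k_0,k_1\in\mathbb{N}_0$ and $c>0$. For $k\in\mathbb{N}_0$ define the meromorphic functions $$F^{[1,P,g]}_{2k+1}(\boldsymbol\zeta)=\frac{1}{(2\pi i)^k}\,\tilde g(p(\boldsymbol\zeta))\,P(e^{\boldsymbol\zeta})\,M^{\mathrm{odd}}_{2k+1}(\boldsymbol\zeta),\qquad F^{[1,P,g]}_{2k}=0 .$$ Let $\mathcal{I}^k_+=\{\boldsymbol\lambda\in\mathbb{R}^k:0<\lambda_1<\dots<\lambda_k<\pi\}$ and $\mathcal{I}^k_-=\{\boldsymbol\lambda\in\mathbb{R}^k:-\pi<\lambda_1<\dots<\lambda_k<0\}$.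 Boundary values $F_{m+n}(\boldsymbol\theta+i\boldsymbol 0,\boldsymbol\eta+i\boldsymbol\pi-i\boldsymbol 0)$ (respectively $F_{m+n}(\boldsymbol\theta-i\boldsymbol\pi+i\boldsymbol 0,\boldsymbol\eta-i\boldsymbol 0)$), $\boldsymbol\theta\in\mathbb{R}^m$, $\boldsymbol\eta\in\mathbb{R}^n$, are distributions in $\mathcal{D}(\mathbb{R}^{m+n})'$, obtained as limits, tested against each test function, of $F_{m+n}((\boldsymbol\theta,\boldsymbol\eta)+i\boldsymbol\lambda)$ as $\boldsymbol\lambda\to(0,\dots,0,\pi,\dots,\pi)$ within $\mathcal{I}_+^{m+n}$ (respectively $\boldsymbol\lambda\to(-\pi,\dots,-\pi,0,\dots,0)$ within $\mathcal{I}_-^{m+n}$). For a distribution $f\in\mathcal{D}(\mathbb{R}^{m+n})'$ let $$\|f\|_{m\times n}=\sup\Big\{\Big|\int f(\boldsymbol\theta,\boldsymbol\eta)\,u(\boldsymbol\theta)\,v(\boldsymbol\eta)\,d^m\theta\,d^n\eta\Big| : u\in\mathcal{D}(\mathbb{R}^m),\ v\in\mathcal{D}(\mathbb{R}^n),\ \|u\|_2\le1,\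 \|v\|_2\le1\Big\},$$ $$\|f\|^\omega_{m\times n}=\tfrac12\big\|e^{-\omega(E(\boldsymbol\theta))}f(\boldsymbol\theta,\boldsymbol\eta)\big\|_{m\times n}+\tfrac12\big\|f(\boldsymbol\theta,\boldsymbol\eta)\,e^{-\omega(E(\boldsymbol\eta))}\big\|_{m\times n}\in[0,\infty].$$ **Proposition.** Let $P\in\Lambda^\pm_{\mathrm I}$ and $g\in\mathcal{D}_\alpha(\mathcal{O})$ for some bounded open $\mathcal{O}\subset\mathbb{R}^2$. Then for all $m,n\in\mathbb{N}_0$ the boundary distribution $f_{mn}(\boldsymbol\theta,\boldsymbol\eta):=F^{[1,P,g]}_{m+n}(\boldsymbol\theta+i\boldsymbol 0,\boldsymbol\eta+i\boldsymbol\pi-i\boldsymbol 0)$ exists, and for every $\epsilon>0$ and $n\in\mathbb{N}_0$ there is a constant $c>0$ such that for all $m\in\mathbb{N}_0$ (with $0^0=1$), $$\|f_{mn}\|^\omega_{m\times n}+\|f_{nm}\|^\omega_{n\times m}\le c^{m+1}m^{\epsilon m}.$$ The same holds for $\hat f_{mn}(\boldsymbol\theta,\boldsymbol\eta):=F^{[1,P,g]}_{m+n}(\boldsymbol\theta-i\boldsymbol\pi+i\boldsymbol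 0,\boldsymbol\eta-i\boldsymbol 0)$. In particular, the functions $F^{[1,P,g]}_k$ satisfy the bounds at nodes: for every $k\in\mathbb{N}_0$ and $j\in\{0,\dots,k\}$, the two boundary values of $F^{[1,P,g]}_k$ with $m=j$, $n=k-j$ have finite norm $\|\cdot\|^\omega_{j\times(k-j)}$. -/

import Mathlib

open MeasureTheory Filter Topology
open scoped Distributions ContDiff ENNReal

namespace OddIsing

noncomputable section

/-! ### Symmetric Laurent functions -/

/-- The algebra `Λ^±` of symmetric Laurent functions (in an unspecified number of variables), i.e.
the commutative complex algebra freely generated by the power sums `p_k`, `k ∈ ℤ \ {0}`. The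
variable `X k` stands for `p_k = ∑ j, x_j ^ k`. -/
abbrev LaurentSymm : Type := MvPolynomial {k : ℤ // k ≠ 0} ℂ

/-- The value `P(x₁, …, x_n)` of a symmetric Laurent function at `n` variables. -/
def LaurentSymm.eval {n : ℕ} (P : LaurentSymm) (x : Fin n → ℂ) : ℂ :=
  MvPolynomial.aeval (fun k : {k : ℤ // k ≠ 0} => ∑ j, x j ^ (k : ℤ)) P

/-- The homomorphism `α_y^±` of `Λ^±` which substitutes `x₁ → y`, `x₂ → -y`, `x_{j+2} → x_j`; it
sends the power sum `p_k` to `y^k + (-y)^k + p_k`. -/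
def substPair (y : ℝ) : LaurentSymm →ₐ[ℂ] LaurentSymm :=
  MvPolynomial.aeval (fun k : {k : ℤ // k ≠ 0} =>
    MvPolynomial.C ((y : ℂ) ^ (k : ℤ) + (-(y : ℂ)) ^ (k : ℤ)) + MvPolynomial.X k)

/-- The subalgebra `Λ_I^±` of those symmetric Laurent functions which are invariant under all
`α_y^±`, `y > 0`, i.e. `P(y, -y, x) = P(x)`. -/
def LambdaI : Subalgebra ℂ LaurentSymm :=
  ⨅ y : {y : ℝ // 0 < y}, AlgHom.equalizer (substPair y) (AlgHom.id ℂ LaurentSymm)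

/-! ### Test functions on Minkowski space -/

/-- The Fourier transform `g̃(p) = (2π)⁻¹ ∫ d²x exp(i p·x) g(x)` with the Minkowski product
`p·x = p⁰x⁰ - p¹x¹`, at complex momentum `p = (p⁰, p¹)`. -/
def fourierMink (g : ℝ × ℝ → ℂ) (p : ℂ × ℂ) : ℂ :=
  (1 / (2 * Real.pi) : ℂ) *
    ∫ x : ℝ × ℝ, Complex.exp (Complex.I * (p.1 * x.1 - p.2 * x.2)) * g x

/-- The decay condition which singles out the elements `g` of `𝓓_α(𝒪)` among those of `𝓓(𝒪)`: for
all `k₀, k₁ ∈ ℕ₀` and all `c > 0`, the function `exp (c ‖p‖_∞^α) |∂₀^{k₀} ∂₁^{k₁} g̃(p)|` is bounded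
on `ℝ²`. (The norm of `ℝ × ℝ` is the maximum norm.) -/
def HasAlphaDecay (α : ℝ) (g : ℝ × ℝ → ℂ) : Prop :=
  ∀ (k₀ k₁ : ℕ) (c : ℝ), 0 < c → ∃ B : ℝ, ∀ p : ℝ × ℝ,
    Real.exp (c * ‖p‖ ^ α) *
      ‖iteratedDeriv k₀ (fun s : ℝ =>
        iteratedDeriv k₁ (fun t : ℝ => fourierMink g ((s : ℂ), (t : ℂ))) p.2) p.1‖ ≤ B

/-! ### The functions `F_j^{[1,P,g]}` -/

/-- The two-momentum `p(ζ) = ∑_k μ (cosh ζ_k, sinh ζ_k)`. -/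
def momentum (μ : ℝ) {k : ℕ} (ζ : Fin k → ℂ) : ℂ × ℂ :=
  (∑ j, (μ : ℂ) * Complex.cosh (ζ j), ∑ j, (μ : ℂ) * Complex.sinh (ζ j))

/-- The meromorphic function `M_k^odd(ζ) = ∏_{i<j} tanh ((ζ_i - ζ_j) / 2)`. -/
def Modd {k : ℕ} (ζ : Fin k → ℂ) : ℂ :=
  ∏ i : Fin k, ∏ j ∈ Finset.Ioi i, Complex.tanh ((ζ i - ζ j) / 2)

/-- The functions `F_j^{[1,P,g]}`: with `j = 2k+1`,
`F_{2k+1}(ζ) = (2πi)^{-k} g̃(p(ζ)) P(e^ζ) M_{2k+1}^odd(ζ)`, while `F_{2k} = 0`. -/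
def F (μ : ℝ) (P : LaurentSymm) (g : ℝ × ℝ → ℂ) (j : ℕ) (ζ : Fin j → ℂ) : ℂ :=
  if Odd j then
    1 / (2 * Real.pi * Complex.I) ^ (j / 2) * fourierMink g (momentum μ ζ) *
      P.eval (fun i => Complex.exp (ζ i)) * Modd ζ
  else 0

/-! ### Distributional boundary values -/

/-- Complex test functions on `ℝ^m`. -/
abbrev Test (m : ℕ) : Type := 𝓓((⊤ : TopologicalSpace.Opens (Fin m → ℝ)), ℂ)

/-- Complex test functions on `ℝ^m × ℝ^n = ℝ^{m+n}`. -/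
abbrev Test₂ (m n : ℕ) : Type :=
  𝓓((⊤ : TopologicalSpace.Opens ((Fin m → ℝ) × (Fin n → ℝ))), ℂ)

/-- Complex distributions in the variables `(θ, η) ∈ ℝ^m × ℝ^n`, i.e. continuous complex-linear
functionals on the test functions with their LF topology. -/
abbrev Distr (m n : ℕ) : Type := Test₂ m n →L[ℂ] ℂ

/-- The region `𝓘_+^k = {λ : 0 < λ₁ < … < λ_k < π}`. -/
def Iplus (k : ℕ) : Set (Fin k → ℝ) :=
  {l | StrictMono l ∧ ∀ j, 0 < l j ∧ l j < Real.pi}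

/-- The region `𝓘_-^k = {λ : -π < λ₁ < … < λ_k < 0}`. -/
def Iminus (k : ℕ) : Set (Fin k → ℝ) :=
  {l | StrictMono l ∧ ∀ j, -Real.pi < l j ∧ l j < 0}

/-- `f` is the distributional boundary value of `G` on `ℝ^{m+n} + i b`, approached from within
`ℝ^{m+n} + i R`: for every test function `φ`, the integral `∫ G((θ,η) + iλ) φ(θ,η) dθ dη` tends to
`f(φ)` as `λ → b` within `R`. -/
def IsBoundaryValue {m n : ℕ} (R : Set (Fin (m + n) → ℝ)) (b : Fin (m + n) → ℝ)
    (G : (Fin (m + n) → ℂ) → ℂ) (f : Distr m n) : Prop :=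
  ∀ φ : Test₂ m n,
    Tendsto (fun l : Fin (m + n) → ℝ =>
        ∫ x : (Fin m → ℝ) × (Fin n → ℝ),
          G (fun j => ((Fin.append x.1 x.2 j : ℝ) : ℂ) + Complex.I * (l j : ℂ)) * φ x)
      (𝓝[R] b) (𝓝 (f φ))

/-- `f(θ,η) = G(θ + i0, η + iπ - i0)`, approached from within `𝓘_+`. -/
def IsUpperBoundaryValue {m n : ℕ} (G : (Fin (m + n) → ℂ) → ℂ) (f : Distr m n) : Prop :=
  IsBoundaryValue (Iplus (m + n)) (Fin.append (fun _ : Fin m => 0) (fun _ : Fin n => Real.pi)) G f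

/-- `f(θ,η) = G(θ - iπ + i0, η - i0)`, approached from within `𝓘_-`. -/
def IsLowerBoundaryValue {m n : ℕ} (G : (Fin (m + n) → ℂ) → ℂ) (f : Distr m n) : Prop :=
  IsBoundaryValue (Iminus (m + n)) (Fin.append (fun _ : Fin m => -Real.pi) (fun _ : Fin n => 0)) G f

/-! ### The cross norms -/

/-- `E(θ) = ∑_k cosh θ_k`. -/
def energy {m : ℕ} (θ : Fin m → ℝ) : ℝ := ∑ j, Real.cosh (θ j)

/-- The indicatrix `ω(p) = p^α`. -/
def omega (α p : ℝ) : ℝ := p ^ α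

theorem contDiff_exp_neg_omega_energy (α : ℝ) (m : ℕ) :
    ContDiff ℝ ∞ (fun θ : Fin m → ℝ => ((Real.exp (-omega α (energy θ)) : ℝ) : ℂ)) := by
  refine Complex.ofRealCLM.contDiff.comp (Real.contDiff_exp.comp (ContDiff.neg ?_))
  rcases Nat.eq_zero_or_pos m with rfl | hm
  · have : (fun θ : Fin 0 → ℝ => omega α (energy θ)) = fun _ => omega α 0 := by
      funext θ; simp [energy]
    rw [this]; exact contDiff_const
  · have : Nonempty (Fin m) := ⟨⟨0, hm⟩⟩
    refine ContDiff.rpow_const_of_ne ?_ ?_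
    · exact ContDiff.sum fun j _ => Real.contDiff_cosh.comp (contDiff_apply ℝ ℝ j)
    · intro θ
      exact (Finset.sum_pos (fun j _ => Real.cosh_pos (θ j)) Finset.univ_nonempty).ne'

/-- The test function `θ ↦ exp (-ω(E(θ))) g(θ)`. -/
def damp (α : ℝ) {m : ℕ} (g : Test m) : Test m where
  toFun θ := ((Real.exp (-omega α (energy θ)) : ℝ) : ℂ) * g θ
  contDiff' := (contDiff_exp_neg_omega_energy α m).mul g.contDiff
  hasCompactSupport' := g.hasCompactSupport.mul_left
  tsupport_subset' := Set.subset_univ _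

/-- The test function `(θ, η) ↦ g(θ) h(η)`. -/
def tensor {m n : ℕ} (g : Test m) (h : Test n) : Test₂ m n where
  toFun x := g x.1 * h x.2
  contDiff' := (g.contDiff.comp contDiff_fst).mul (h.contDiff.comp contDiff_snd)
  hasCompactSupport' := by
    refine HasCompactSupport.intro (g.hasCompactSupport.isCompact.prod
      h.hasCompactSupport.isCompact) fun x hx => ?_
    by_cases h1 : x.1 ∈ tsupport g
    · rw [image_eq_zero_of_notMem_tsupport (f := h) fun h2 => hx ⟨h1, h2⟩, mul_zero]
    · rw [image_eq_zero_of_notMem_tsupport h1, zero_mul]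
  tsupport_subset' := Set.subset_univ _

/-- The supremum of `|B(g, h)|` over all test functions with `‖g‖₂ ≤ 1`, `‖h‖₂ ≤ 1`, as an extended
nonnegative number. For `B(g, h) = f(g ⊗ h)` this is the cross norm `‖f‖_{m×n}`. -/
def crossNorm {m n : ℕ} (B : Test m → Test n → ℂ) : ℝ≥0∞ :=
  ⨆ (g : Test m) (h : Test n) (_ : eLpNorm g 2 volume ≤ 1) (_ : eLpNorm h 2 volume ≤ 1), ‖B g h‖ₑ

/-- The norm `‖f‖^ω_{m×n} = ½ ‖e^{-ω(E(θ))} f(θ,η)‖_{m×n} + ½ ‖f(θ,η) e^{-ω(E(η))}‖_{m×n}` for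
`ω(p) = p^α`; it is `∞` if one of the suprema is infinite. -/
def omegaNorm (α : ℝ) {m n : ℕ} (f : Distr m n) : ℝ≥0∞ :=
  (crossNorm fun g h => f (tensor (damp α g) h)) / 2 +
    (crossNorm fun g h => f (tensor g (damp α h))) / 2

/-- The bounds at nodes for a family of functions `G_k` on `ℂ^k`, with `ω(p) = p^α`: for every `k`
and every splitting `k = m + n`, the two boundary values of `G_k` exist and have finite
`‖·‖^ω_{m×n}`. -/
def BoundsAtNodes (α : ℝ) (G : (k : ℕ) → (Fin k → ℂ) → ℂ) : Prop :=
  ∀ m n : ℕ,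
    (∃ f : Distr m n, IsUpperBoundaryValue (G (m + n)) f ∧ omegaNorm α f < ⊤) ∧
    (∃ f : Distr m n, IsLowerBoundaryValue (G (m + n)) f ∧ omegaNorm α f < ⊤)

end

end OddIsing

/-! At the upper node the shift of `η` by `iπ` turns the total momentum into `p(θ) - p(η)`, the
variables `e^ζ` into `(e^θ, -e^η)`, and `Modd` into `Dker`, which is `Modd θ * Modd η` times the
product of all `coth ((θ_i - η_j)/2)`. The first two factors are bounded by one; the difficulty lies
in the `m n` singular factors, and in the fact that each cross norm damps only one of the two groups
of variables.

The singular kernel. As a function of one right variable `y`, the product of its factors is a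
rational function of `e^y`. Its partial fractions (`prod_sub_div_add_eq_sum`) express `Dker` as a
sum of `m + n + 1` terms, each with at most one `coth` and a smaller `Dker` (`exists_Dker_cons`). A
single `coth` is twice a Cauchy kernel plus a bounded remainder. The Cauchy kernel is bounded on
`L²` uniformly in the distance to the real line, by the Hilbert transform argument, and the
remainder is bounded between `L²` spaces with weights `exp (± δ|x|)`. Iteration over the smaller
group gives the norm `Q^(m+n) (m+n+1)^(min m n)` on the weighted spaces (`exists_bddKer_Dker_min`),
uniformly in the imaginary parts.

The energy. The weights and `P` cost powers of `1 + E` in both groups, about `δ m` and `δ n` besides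
a fixed degree. In the damped group `exp (-E^α)` absorbs them. For the undamped group one multiplies
and divides by `(1 + q⁰/μ)^N`, with `q` the momentum of this group, and expands `1 + q⁰/μ =
-(p-q)⁰/μ + (1 + p⁰/μ)` binomially: powers of `p⁰` go to the damped group, powers of `(p-q)⁰` become
time derivatives of `g`, whose `L¹` norms are controlled by the stretched exponential decay of the
Fourier transform. Writing that transform as an integral of `e^{ip·x} e^{-iq·x}` makes everything a
superposition of products, to which the kernel bound applies (`BddKer.enorm_integral_damp_le`). The
price is a factor of the type `L^(2δL/α)` with `L = m + n`, and `δ = εα/2` makes it `m^(εm)` up to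
an exponential when `n` is fixed (`exists_bound_le_pow_mul`).

Existence of the boundary value is the usual argument for holomorphic functions of polynomial
growth: Taylor expansion in an additional imaginary shift of the left variables moves derivatives to
the test function (`exists_boundary_distribution`). The uniform estimates then pass to the limit.
The lower node follows from the upper one by translation by `iπ`, with `g` and `P` reflected. -/

namespace OddIsing

set_option linter.unusedSectionVars false

/-! ### Expansion of the product of hyperbolic tangents -/

section PartialFractions

open Polynomial

/-- Partial fraction expansion of `∏ (x_i - Y) / (x_i + Y)` in the variable `Y`. -/
theorem prod_sub_div_add_eq {ι : Type*} [Fintype ι] [DecidableEq ι] (x : ι → ℂ)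
    (hx : Function.Injective x) (Y : ℂ) (hY : ∀ i, x i + Y ≠ 0) :
    ∏ i, (x i - Y) / (x i + Y) = (-1) ^ Fintype.card ι +
      ∑ i, (∏ l ∈ Finset.univ.erase i, (x l + x i) / (x l - x i)) * (2 * x i / (x i + Y)) := by
  classical
  set p : ℂ[X] := Lagrange.nodal Finset.univ x with hp
  set q : ℂ[X] := Lagrange.nodal Finset.univ (fun i => -x i) with hq
  have hpm : p.Monic := Lagrange.nodal_monic
  have hqm : q.Monic := Lagrange.nodal_monic
  have hpd : p.degree = (Finset.univ : Finset ι).card := Lagrange.degree_nodal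
  have hqd : q.degree = (Finset.univ : Finset ι).card := Lagrange.degree_nodal
  -- Both nodal polynomials are monic of the same degree, so the difference drops in degree and is
  -- recovered by interpolation at the nodes `-x i` of `q`.
  have hd : (p - q).degree < (Finset.univ : Finset ι).card := by
    rw [← hpd]
    exact degree_sub_lt_left (hpd.trans hqd.symm) hpm.ne_zero (by rw [hpm.leadingCoeff, hqm.leadingCoeff])
  have hinj : Set.InjOn (fun i => -x i) (Finset.univ : Finset ι) := fun i _ j _ h => hx (neg_injective h)
  have key := Lagrange.eq_interpolate_of_eval_eq (s := Finset.univ) (v := fun i => -x i)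
    (r := fun i => (p - q).eval (-x i)) hinj hd (fun i _ => rfl)
  have hev : (p - q).eval Y = q.eval Y * ∑ i, Lagrange.nodalWeight Finset.univ (fun i => -x i) i *
      (Y - -x i)⁻¹ * (p - q).eval (-x i) := by
    conv_lhs => rw [key]
    rw [Lagrange.eval_interpolate_not_at_node]
    intro i _ h
    exact hY i (by rw [h]; ring)
  have hqe : q.eval Y = ∏ i, (x i + Y) := by
    rw [hq, Lagrange.eval_nodal]; exact Finset.prod_congr rfl fun i _ => by ring
  have hpe : ∀ z, p.eval z = (-1) ^ Fintype.card ι * ∏ i, (x i - z) := by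
    intro z
    rw [hp, Lagrange.eval_nodal, ← Finset.card_univ, ← Finset.prod_const, ← Finset.prod_mul_distrib]
    exact Finset.prod_congr rfl fun i _ => by ring
  have hq0 : ∀ i, q.eval (-x i) = 0 := fun i => by
    rw [hq]; exact Lagrange.eval_nodal_at_node (v := fun i => -x i) (Finset.mem_univ i)
  have hqY : q.eval Y ≠ 0 := by rw [hqe]; exact Finset.prod_ne_zero_iff.2 fun i _ => hY i
  have hsgn : ((-1 : ℂ) ^ Fintype.card ι) * (-1) ^ Fintype.card ι = 1 := by
    rw [← mul_pow]; norm_num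
  rw [Finset.prod_div_distrib, ← hqe, div_eq_iff hqY]
  have h1 : ∏ i, (x i - Y) = (-1) ^ Fintype.card ι * p.eval Y := by
    rw [hpe, ← mul_assoc, hsgn, one_mul]
  have h2 : p.eval Y = q.eval Y + (p - q).eval Y := by rw [eval_sub]; ring
  rw [h1, h2, hev, add_mul, mul_add, mul_comm (q.eval Y) (Finset.sum _ _), ← mul_assoc, Finset.mul_sum]
  congr 2
  refine Finset.sum_congr rfl fun i _ => ?_
  rw [eval_sub, hq0, sub_zero, hpe, Lagrange.nodalWeight, ← Finset.mul_prod_erase _ _ (Finset.mem_univ i)]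
  have h3 : ∏ j ∈ Finset.univ.erase i, (-x i - -x j)⁻¹ * (x j - -x i) =
      ∏ l ∈ Finset.univ.erase i, (x l + x i) / (x l - x i) :=
    Finset.prod_congr rfl fun j _ => by rw [div_eq_mul_inv, mul_comm]; congr 2 <;> ring
  rw [← h3, Finset.prod_mul_distrib]
  have : Y - -x i = x i + Y := by ring
  rw [this, div_eq_mul_inv]
  linear_combination (∏ j ∈ Finset.univ.erase i, (-x i - -x j)⁻¹) *
    (∏ j ∈ Finset.univ.erase i, (x j - -x i)) * (2 * x i * (x i + Y)⁻¹) * hsgn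

/-- At `Y = 0` the previous expansion evaluates the sum of its coefficients; with `2x/(x+Y) = 1 +
(x-Y)/(x+Y)` this makes the expansion symmetric. Each summand then carries a factor of the same type
as those on the left, that is, again a `tanh` or a `coth` after substitution of exponentials. -/
theorem prod_sub_div_add_eq_sum {ι : Type*} [Fintype ι] [DecidableEq ι] (x : ι → ℂ)
    (hx : Function.Injective x) (h0 : ∀ i, x i ≠ 0) (Y : ℂ) (hY : ∀ i, x i + Y ≠ 0) :
    ∏ i, (x i - Y) / (x i + Y) = (1 + (-1) ^ Fintype.card ι) / 2 +
      ∑ i, (∏ l ∈ Finset.univ.erase i, (x l + x i) / (x l - x i)) * ((x i - Y) / (x i + Y)) := by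
  have h1 := prod_sub_div_add_eq x hx 0 (by simpa using h0)
  have h2 : ∀ i, (2 * x i / (x i + 0)) = 2 := fun i => by
    rw [add_zero, mul_div_assoc, div_self (h0 i), mul_one]
  have h3 : ∏ i, (x i - 0) / (x i + 0) = 1 :=
    Finset.prod_eq_one fun i _ => by rw [add_zero, sub_zero, div_self (h0 i)]
  simp only [h2, h3, ← Finset.sum_mul] at h1
  rw [prod_sub_div_add_eq x hx Y hY]
  have h4 : ∀ i, 2 * x i / (x i + Y) = 1 + (x i - Y) / (x i + Y) := fun i => by
    field_simp [hY i]; ring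
  simp only [h4, mul_add, mul_one, Finset.sum_add_distrib]
  linear_combination (1 / 2 : ℂ) * (-h1)

end PartialFractions

/-! ### The kernel `Dker` and its expansion in one variable. -/

theorem tanh_half_sub (z w : ℂ) : Complex.tanh ((z - w) / 2) =
    (Complex.exp z - Complex.exp w) / (Complex.exp z + Complex.exp w) := by
  have e1 : Complex.exp z = Complex.exp ((z + w) / 2) * Complex.exp ((z - w) / 2) := by
    rw [← Complex.exp_add]; ring_nf
  have e2 : Complex.exp w = Complex.exp ((z + w) / 2) * Complex.exp (-((z - w) / 2)) := by
    rw [← Complex.exp_add]; ring_nf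
  rw [Complex.tanh_eq_sinh_div_cosh, Complex.sinh, Complex.cosh, div_div_div_cancel_right₀ two_ne_zero,
    e1, e2, ← mul_sub, ← mul_add, mul_div_mul_left _ _ (Complex.exp_ne_zero _)]

/-- The hyperbolic cotangent of half the argument. -/
noncomputable def cothHalf (z : ℂ) : ℂ := (Complex.tanh (z / 2))⁻¹

theorem tanh_half_neg (z w : ℂ) : Complex.tanh ((z - w) / 2) = -Complex.tanh ((w - z) / 2) := by
  rw [← Complex.tanh_neg]; congr 1; ring

theorem cothHalf_sub (z w : ℂ) : cothHalf (z - w) =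
    (Complex.exp z + Complex.exp w) / (Complex.exp z - Complex.exp w) := by
  rw [cothHalf, tanh_half_sub, inv_div]

theorem tanh_half_sub_I_pi (z : ℂ) : Complex.tanh ((z - Complex.I * Real.pi) / 2) = cothHalf z := by
  rw [tanh_half_sub, cothHalf, ← sub_zero z, tanh_half_sub, inv_div, mul_comm Complex.I, Complex.exp_pi_mul_I]
  simp [sub_eq_add_neg]

/-- `Modd` changes by a sign when one variable is moved to the front. -/
theorem exists_Modd_succAbove {n : ℕ} (p : Fin (n + 1)) : ∃ s : ℂ, s * s = 1 ∧ ∀ ζ : Fin (n + 1) → ℂ,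
    Modd ζ = s * (∏ l, Complex.tanh ((ζ p - ζ (p.succAbove l)) / 2)) *
      Modd (fun l => ζ (p.succAbove l)) := by
  classical
  refine ⟨∏ l, if p < p.succAbove l then 1 else -1, ?_, fun ζ => ?_⟩
  · rw [← Finset.prod_mul_distrib]
    exact Finset.prod_eq_one fun l _ => by split_ifs <;> norm_num
  · have key : ∀ {k : ℕ} (ξ : Fin k → ℂ), Modd ξ =
        ∏ i, ∏ j, if i < j then Complex.tanh ((ξ i - ξ j) / 2) else 1 := by
      intro k ξ
      refine Finset.prod_congr rfl fun i _ => ?_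
      rw [← Finset.prod_filter]
      congr 1; ext j; simp
    rw [key, key, Fin.prod_univ_succAbove _ p, Fin.prod_univ_succAbove _ p]
    simp only [Fin.prod_univ_succAbove _ p, lt_irrefl, if_false, one_mul, Finset.prod_mul_distrib,
      Fin.succAbove_lt_succAbove_iff, ← mul_assoc]
    congr 1
    simp only [← Finset.prod_mul_distrib]
    refine Finset.prod_congr rfl fun l _ => ?_
    rcases lt_or_gt_of_ne (Fin.succAbove_ne p l).symm with h | h
    · simp [h, h.not_gt]
    · simp only [h, h.not_gt, if_true, if_false]
      rw [tanh_half_neg]; ring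

/-- The value of `Modd` at `(θ, η + iπ)`. -/
noncomputable def Dker {m n : ℕ} (θ : Fin m → ℂ) (η : Fin n → ℂ) : ℂ :=
  Modd θ * Modd η * ∏ i, ∏ j, cothHalf (θ i - η j)

theorem Modd_append {m n : ℕ} (θ : Fin m → ℂ) (η : Fin n → ℂ) :
    Modd (Fin.append θ (fun j => η j + Complex.I * Real.pi)) = Dker θ η := by
  have key : ∀ {k : ℕ} (ξ : Fin k → ℂ), Modd ξ =
      ∏ i, ∏ j, if i < j then Complex.tanh ((ξ i - ξ j) / 2) else 1 := by
    intro k ξ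
    refine Finset.prod_congr rfl fun i _ => ?_
    rw [← Finset.prod_filter]
    congr 1; ext j; simp
  rw [Dker, key, key, key, Fin.prod_univ_add]
  simp only [Fin.prod_univ_add, Fin.append_left, Fin.append_right, Finset.prod_mul_distrib]
  have h1 : ∀ (i j : Fin m), (Fin.castAdd n i < Fin.castAdd n j) = (i < j) := fun i j => by
    simp only [Fin.lt_def, Fin.val_castAdd]
  have h2 : ∀ (i j : Fin n), (Fin.natAdd m i < Fin.natAdd m j) = (i < j) := fun i j => by
    simp
  have h3 : ∀ (i : Fin m) (j : Fin n), (Fin.castAdd n i < Fin.natAdd m j) = True := fun i j => by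
    simp only [Fin.lt_def, Fin.val_castAdd, Fin.val_natAdd, eq_iff_iff, iff_true]; omega
  have h4 : ∀ (i : Fin m) (j : Fin n), (Fin.natAdd m j < Fin.castAdd n i) = False := fun i j => by
    simp only [Fin.lt_def, Fin.val_castAdd, Fin.val_natAdd, eq_iff_iff, iff_false]; omega
  simp only [h1, h2, h3, h4, if_true, if_false, Finset.prod_const_one, one_mul]
  have h5 : ∀ i j, Complex.tanh ((θ i - (η j + Complex.I * Real.pi)) / 2) = cothHalf (θ i - η j) :=
    fun i j => by rw [← tanh_half_sub_I_pi, sub_add_eq_sub_sub]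
  simp only [h5, add_sub_add_right_eq_sub]
  ring

/-- Deletion of one variable. -/
def del {X : Type*} : {m : ℕ} → Fin m → (Fin m → X) → (Fin (m - 1) → X)
  | _ + 1, i, θ => fun k => θ (i.succAbove k)

/-- No two of the variables `(θ, η)` differ by a zero or a pole of `tanh (z / 2)`. -/
structure Generic {m n : ℕ} (θ : Fin m → ℂ) (η : Fin n → ℂ) : Prop where
  left : ∀ i l, i ≠ l → Complex.tanh ((θ i - θ l) / 2) ≠ 0
  right : ∀ i l, i ≠ l → Complex.tanh ((η i - η l) / 2) ≠ 0
  cross : ∀ i j, Complex.tanh ((θ i - η j) / 2) ≠ 0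

theorem exists_Dker_succAbove_left {m n : ℕ} (p : Fin (m + 1)) :
    ∃ s : ℂ, s * s = 1 ∧ ∀ (θ : Fin (m + 1) → ℂ) (η : Fin n → ℂ), Dker θ η =
      s * (∏ l, Complex.tanh ((θ p - θ (p.succAbove l)) / 2)) * (∏ j, cothHalf (θ p - η j)) *
        Dker (fun l => θ (p.succAbove l)) η := by
  obtain ⟨s, hs, h⟩ := exists_Modd_succAbove p
  refine ⟨s, hs, fun θ η => ?_⟩
  rw [Dker, Dker, h, Fin.prod_univ_succAbove _ p]
  ring

theorem exists_Dker_succAbove_right {m n : ℕ} (p : Fin (n + 1)) :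
    ∃ s : ℂ, s * s = 1 ∧ ∀ (θ : Fin m → ℂ) (η : Fin (n + 1) → ℂ), Dker θ η =
      s * (∏ l, Complex.tanh ((η p - η (p.succAbove l)) / 2)) * (∏ i, cothHalf (θ i - η p)) *
        Dker θ (fun l => η (p.succAbove l)) := by
  obtain ⟨s, hs, h⟩ := exists_Modd_succAbove p
  refine ⟨s, hs, fun θ η => ?_⟩
  rw [Dker, Dker, h]
  simp only [Fin.prod_univ_succAbove _ p, Finset.prod_mul_distrib]
  ring

theorem prod_erase_eq_ite {ι : Type*} [Fintype ι] [DecidableEq ι] (a : ι) (f : ι → ℂ) :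
    ∏ l ∈ Finset.univ.erase a, f l = ∏ l, if l = a then 1 else f l := by
  rw [← Finset.prod_erase Finset.univ (a := a) (f := fun l => if l = a then 1 else f l) (by simp)]
  exact Finset.prod_congr rfl fun l hl => by rw [if_neg (Finset.ne_of_mem_erase hl)]

theorem mul_rearrange {a b c d e f x y : ℂ} (h1 : b * e = x) (h2 : c * f = y) :
    a * b * c * d * (e * f) = a * (x * y) * d := by
  rw [← h1, ← h2]; ring

theorem exp_add_ne_of_tanh {z w : ℂ} (h : Complex.tanh ((z - w) / 2) ≠ 0) :
    Complex.exp z + Complex.exp w ≠ 0 := fun h0 => h (by rw [tanh_half_sub, h0, div_zero])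

theorem exp_sub_ne_of_tanh {z w : ℂ} (h : Complex.tanh ((z - w) / 2) ≠ 0) :
    Complex.exp z - Complex.exp w ≠ 0 := fun h0 => h (by rw [tanh_half_sub, h0, zero_div])

/-- The factor of the expansion which belongs to a variable `θ_i` removes this variable. -/
theorem exists_Dker_mul_prod_left {m n : ℕ} (i : Fin m) : ∃ s : ℂ, s * s = 1 ∧
    ∀ (θ : Fin m → ℂ) (η : Fin n → ℂ), Generic θ η →
      Dker θ η * (∏ l ∈ Finset.univ.erase (Sum.inl i),
        (Sum.elim (fun k => Complex.exp (θ k)) (fun k => -Complex.exp (η k)) l + Complex.exp (θ i)) /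
        (Sum.elim (fun k => Complex.exp (θ k)) (fun k => -Complex.exp (η k)) l - Complex.exp (θ i))) =
        s * Dker (del i θ) η := by
  cases m with
  | zero => exact i.elim0
  | succ m =>
    obtain ⟨s, hs, h⟩ := exists_Dker_succAbove_left (n := n) i
    refine ⟨s * (-1) ^ (m + n), ?_, fun θ η hg => ?_⟩
    · rw [mul_mul_mul_comm, hs, ← mul_pow]; norm_num
    · rw [h θ η, prod_erase_eq_ite, Fintype.prod_sum_type, Fin.prod_univ_succAbove _ i]
      simp only [Sum.elim_inl, Sum.elim_inr, if_true, Sum.inl.injEq, Fin.succAbove_ne, if_false, one_mul,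
        reduceCtorEq]
      have h1 : (∏ l, Complex.tanh ((θ i - θ (i.succAbove l)) / 2)) *
          ∏ l, (Complex.exp (θ (i.succAbove l)) + Complex.exp (θ i)) /
            (Complex.exp (θ (i.succAbove l)) - Complex.exp (θ i)) = (-1) ^ m := by
        rw [← Finset.prod_mul_distrib]
        rw [← Fin.prod_const]
        refine Finset.prod_congr rfl fun l _ => ?_
        have := hg.left i (i.succAbove l) (Fin.succAbove_ne i l).symm
        rw [← cothHalf_sub, cothHalf, tanh_half_neg (θ (i.succAbove l)), inv_neg, mul_neg,
          mul_inv_cancel₀ this]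
      have h2 : (∏ j, cothHalf (θ i - η j)) *
          ∏ j, (-Complex.exp (η j) + Complex.exp (θ i)) /
            (-Complex.exp (η j) - Complex.exp (θ i)) = (-1) ^ n := by
        rw [← Finset.prod_mul_distrib]
        rw [← Fin.prod_const]
        refine Finset.prod_congr rfl fun l _ => ?_
        have := hg.cross i l
        have e : (-Complex.exp (η l) + Complex.exp (θ i)) / (-Complex.exp (η l) - Complex.exp (θ i)) =
            -Complex.tanh ((θ i - η l) / 2) := by
          rw [tanh_half_sub, ← div_neg]; congr 1 <;> ring
        rw [e, cothHalf, mul_neg, inv_mul_cancel₀ this]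
      rw [pow_add]
      exact mul_rearrange h1 h2

/-- The factor of the expansion which belongs to a variable `η_l` removes this variable. -/
theorem exists_Dker_mul_prod_right {m n : ℕ} (i : Fin n) : ∃ s : ℂ, s * s = 1 ∧
    ∀ (θ : Fin m → ℂ) (η : Fin n → ℂ), Generic θ η →
      Dker θ η * (∏ l ∈ Finset.univ.erase (Sum.inr i),
        (Sum.elim (fun k => Complex.exp (θ k)) (fun k => -Complex.exp (η k)) l + -Complex.exp (η i)) /
        (Sum.elim (fun k => Complex.exp (θ k)) (fun k => -Complex.exp (η k)) l - -Complex.exp (η i))) =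
        s * Dker θ (del i η) := by
  cases n with
  | zero => exact i.elim0
  | succ n =>
    obtain ⟨s, hs, h⟩ := exists_Dker_succAbove_right (m := m) i
    refine ⟨s * (-1) ^ n, ?_, fun θ η hg => ?_⟩
    · rw [mul_mul_mul_comm, hs, ← mul_pow]; norm_num
    · rw [h θ η, prod_erase_eq_ite, Fintype.prod_sum_type, Fin.prod_univ_succAbove _ i]
      simp only [Sum.elim_inl, Sum.elim_inr, if_true, Sum.inr.injEq, Fin.succAbove_ne, if_false, one_mul,
        reduceCtorEq]
      have h1 : (∏ l, Complex.tanh ((η i - η (i.succAbove l)) / 2)) *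
          ∏ l, (-Complex.exp (η (i.succAbove l)) + -Complex.exp (η i)) /
            (-Complex.exp (η (i.succAbove l)) - -Complex.exp (η i)) = (-1) ^ n := by
        rw [← Finset.prod_mul_distrib]
        rw [← Fin.prod_const]
        refine Finset.prod_congr rfl fun l _ => ?_
        have := hg.right i (i.succAbove l) (Fin.succAbove_ne i l).symm
        have e : (-Complex.exp (η (i.succAbove l)) + -Complex.exp (η i)) /
            (-Complex.exp (η (i.succAbove l)) - -Complex.exp (η i)) =
            -(Complex.tanh ((η i - η (i.succAbove l)) / 2))⁻¹ := by
          rw [tanh_half_sub, inv_div, ← neg_div]; congr 1 <;> ring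
        rw [e, mul_neg, mul_inv_cancel₀ this]
      have h2 : (∏ j, cothHalf (θ j - η i)) *
          ∏ j, (Complex.exp (θ j) + -Complex.exp (η i)) /
            (Complex.exp (θ j) - -Complex.exp (η i)) = 1 := by
        rw [← Finset.prod_mul_distrib]
        refine Finset.prod_eq_one fun l _ => ?_
        have := hg.cross l i
        have e : (Complex.exp (θ l) + -Complex.exp (η i)) / (Complex.exp (θ l) - -Complex.exp (η i)) =
            Complex.tanh ((θ l - η i) / 2) := by
          rw [tanh_half_sub, sub_neg_eq_add, sub_eq_add_neg]
        rw [e, cothHalf, inv_mul_cancel₀ this]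
      rw [← mul_one ((-1 : ℂ) ^ n), mul_comm (∏ i, _ / _)]
      exact mul_rearrange h1 h2

theorem norm_eq_one_of_mul_self {s : ℂ} (h : s * s = 1) : ‖s‖ = 1 := by
  have : ‖s‖ * ‖s‖ = 1 := by rw [← norm_mul, h, norm_one]
  nlinarith [norm_nonneg s]

theorem Generic.of_cons {m n : ℕ} {θ : Fin m → ℂ} {y : ℂ} {η : Fin n → ℂ}
    (h : Generic θ (Fin.cons y η : Fin (n + 1) → ℂ)) : Generic θ η where
  left := h.left
  right i l hil := by simpa using h.right i.succ l.succ (by simpa using hil)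
  cross i j := by simpa using h.cross i j.succ

/-- The expansion of the product `Dker` with respect to its first variable on the right. -/
theorem exists_Dker_cons (m n : ℕ) : ∃ (s₀ : ℂ) (s : Fin m → ℂ) (t : Fin n → ℂ),
    ‖s₀‖ ≤ 1 ∧ (∀ i, ‖s i‖ ≤ 1) ∧ (∀ l, ‖t l‖ ≤ 1) ∧
    ∀ (θ : Fin m → ℂ) (y : ℂ) (η : Fin n → ℂ), Generic θ (Fin.cons y η : Fin (n + 1) → ℂ) →
      Dker θ (Fin.cons y η : Fin (n + 1) → ℂ) = s₀ * Dker θ η +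
        ∑ i, s i * (cothHalf (θ i - y) * Dker (del i θ) η) +
        ∑ l, t l * (Complex.tanh ((y - η l) / 2) * Dker θ (del l η)) := by
  obtain ⟨s, hs, h⟩ := exists_Dker_succAbove_right (m := m) (0 : Fin (n + 1))
  choose σ hσ hl using fun i : Fin m => exists_Dker_mul_prod_left (n := n) i
  choose τ hτ hr using fun i : Fin n => exists_Dker_mul_prod_right (m := m) i
  have n1 : ‖(-1 : ℂ) ^ n‖ = 1 := by simp
  refine ⟨s * (-1) ^ n * ((1 + (-1) ^ (m + n)) / 2), fun i => s * (-1) ^ n * σ i,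
    fun l => -(s * (-1) ^ n * τ l), ?_, fun i => ?_, fun l => ?_, fun θ y η hg => ?_⟩
  -- The factor `(1 + (-1)^(m+n)) / 2` is zero or one.
  · rw [norm_mul, norm_mul, norm_eq_one_of_mul_self hs, n1, one_mul, one_mul]
    rcases neg_one_pow_eq_or ℂ (m + n) with h | h <;> rw [h] <;> norm_num
  · rw [norm_mul, norm_mul, norm_eq_one_of_mul_self hs, n1, norm_eq_one_of_mul_self (hσ i)]; norm_num
  · rw [norm_neg, norm_mul, norm_mul, norm_eq_one_of_mul_self hs, n1, norm_eq_one_of_mul_self (hτ l)]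
    norm_num
  · have hg' := hg.of_cons
    -- The right variables enter with a minus sign because they are shifted by `iπ`. With `Y = -e^y`
    -- the quotient `(x - Y)/(x + Y)` is then a `coth` at the left nodes and a `-tanh` at the right
    -- nodes.
    set x : Fin m ⊕ Fin n → ℂ :=
      Sum.elim (fun k => Complex.exp (θ k)) (fun k => -Complex.exp (η k)) with hx
    have c1 : ∀ k, (x (Sum.inl k) - -Complex.exp y) / (x (Sum.inl k) + -Complex.exp y) =
        cothHalf (θ k - y) := fun k => by
      rw [cothHalf_sub, hx, Sum.elim_inl, sub_neg_eq_add, ← sub_eq_add_neg]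
    have c2 : ∀ k, (x (Sum.inr k) - -Complex.exp y) / (x (Sum.inr k) + -Complex.exp y) =
        -Complex.tanh ((y - η k) / 2) := fun k => by
      rw [← tanh_half_neg, tanh_half_sub, hx, Sum.elim_inr, ← neg_div_neg_eq]; congr 1 <;> ring
    have hinj : Function.Injective x := by
      rintro (i | i) (j | j) hij <;> simp only [hx, Sum.elim_inl, Sum.elim_inr] at hij
      · by_contra hne
        exact exp_sub_ne_of_tanh (hg'.left i j fun e => hne (by rw [e])) (sub_eq_zero.2 hij)
      · exact absurd (by rw [hij]; ring) (exp_add_ne_of_tanh (hg'.cross i j))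
      · exact absurd (by rw [← hij]; ring) (exp_add_ne_of_tanh (hg'.cross j i))
      · by_contra hne
        exact exp_sub_ne_of_tanh (hg'.right i j fun e => hne (by rw [e]))
          (sub_eq_zero.2 (neg_injective hij))
    have hx0 : ∀ i, x i ≠ 0 := by
      rintro (i | i) <;> simp [hx]
    have hxY : ∀ i, x i + -Complex.exp y ≠ 0 := by
      rintro (i | i) h0
      · refine exp_sub_ne_of_tanh (by simpa using hg.cross i 0) (z := θ i) (w := y) ?_
        rw [← h0, hx, Sum.elim_inl]; ring
      · refine exp_add_ne_of_tanh (by simpa using hg.right i.succ 0 (Fin.succ_ne_zero i))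
          (z := η i) (w := y) ?_
        rw [← neg_eq_zero, ← h0, hx, Sum.elim_inr]; ring
    have key := prod_sub_div_add_eq_sum x hinj hx0 _ hxY
    rw [Fintype.prod_sum_type, Fintype.sum_sum_type] at key
    simp only [c1, c2, Fintype.card_sum, Fintype.card_fin] at key
    have hneg : ∏ k, -Complex.tanh ((y - η k) / 2) = (-1) ^ n * ∏ k, Complex.tanh ((y - η k) / 2) := by
      rw [← Fin.prod_const, ← Finset.prod_mul_distrib]
      exact Finset.prod_congr rfl fun k _ => (neg_one_mul _).symm
    have hneg' : ∏ k, Complex.tanh ((y - η k) / 2) = (-1) ^ n * ∏ k, -Complex.tanh ((y - η k) / 2) := by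
      rw [hneg, ← mul_assoc, ← mul_pow]; norm_num
    rw [h]
    simp only [Fin.cons_zero, Fin.zero_succAbove, Fin.cons_succ]
    rw [hneg']
    have hL : ∀ i, Dker (del i θ) η = σ i * (Dker θ η * ∏ l ∈ Finset.univ.erase (Sum.inl i),
        (x l + x (Sum.inl i)) / (x l - x (Sum.inl i))) := fun i => by
      rw [show x (Sum.inl i) = Complex.exp (θ i) from rfl, hl i θ η hg', ← mul_assoc, hσ, one_mul]
    have hR : ∀ i, Dker θ (del i η) = τ i * (Dker θ η * ∏ l ∈ Finset.univ.erase (Sum.inr i),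
        (x l + x (Sum.inr i)) / (x l - x (Sum.inr i))) := fun i => by
      rw [show x (Sum.inr i) = -Complex.exp (η i) from rfl, hr i θ η hg', ← mul_assoc, hτ, one_mul]
    calc _ = s * (-1) ^ n * Dker θ η *
        ((∏ i, cothHalf (θ i - y)) * ∏ k, -Complex.tanh ((y - η k) / 2)) := by ring
      _ = _ := by
        rw [key, mul_add, mul_add, Finset.mul_sum, Finset.mul_sum, ← add_assoc]
        refine congrArg₂ (· + ·) (congrArg₂ (· + ·) (by ring) ?_) ?_
        · refine Finset.sum_congr rfl fun i _ => ?_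
          rw [hL, mul_assoc (s * (-1) ^ n) (σ i), mul_left_comm (cothHalf _), ← mul_assoc (σ i),
            hσ]; ring
        · refine Finset.sum_congr rfl fun i _ => ?_
          rw [hR]
          linear_combination (s * (-1) ^ n * Dker θ η * (∏ l ∈ Finset.univ.erase (Sum.inr i),
            (x l + x (Sum.inr i)) / (x l - x (Sum.inr i))) * Complex.tanh ((y - η i) / 2)) * hτ i

/-! ### The Cauchy kernel and the hyperbolic cotangent as integral operators -/

theorem lintegral_le_sqrt_mul_sqrt {X : Type*} [MeasurableSpace X] {ν : Measure X}
    {F a b : X → ℝ≥0∞} (ha : AEMeasurable a ν) (hb : AEMeasurable b ν)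
    (h : ∀ᵐ y ∂ν, F y ≤ a y ^ (1 / 2 : ℝ) * b y ^ (1 / 2 : ℝ)) :
    ∫⁻ y, F y ∂ν ≤ (∫⁻ y, a y ∂ν) ^ (1 / 2 : ℝ) * (∫⁻ y, b y ∂ν) ^ (1 / 2 : ℝ) := by
  have hpq : (2 : ℝ).HolderConjugate 2 := Real.HolderConjugate.two_two
  have e : ∀ c : ℝ≥0∞, (c ^ (1 / 2 : ℝ)) ^ (2 : ℝ) = c := fun c => by
    rw [← ENNReal.rpow_mul]; norm_num
  refine (lintegral_mono_ae h).trans ?_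
  have := ENNReal.lintegral_mul_le_Lp_mul_Lq ν hpq (ha.pow_const (1 / 2 : ℝ)) (hb.pow_const (1 / 2 : ℝ))
  simpa only [e, Pi.mul_apply] using this

theorem ennreal_sqrt_sq (c : ℝ≥0∞) : (c ^ (1 / 2 : ℝ)) ^ 2 = c := by
  rw [← ENNReal.rpow_natCast, ← ENNReal.rpow_mul]; norm_num

theorem ennreal_sq_sqrt (c : ℝ≥0∞) : (c ^ 2) ^ (1 / 2 : ℝ) = c := by
  rw [← ENNReal.rpow_natCast, ← ENNReal.rpow_mul]; norm_num

/-- The Cauchy–Schwarz inequality with respect to the measure of density `g`. -/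
theorem lintegral_mul_sq_le {X : Type*} [MeasurableSpace X] {ν : Measure X}
    {f g : X → ℝ≥0∞} (hf : AEMeasurable f ν) (hg : AEMeasurable g ν) :
    (∫⁻ y, f y * g y ∂ν) ^ 2 ≤ (∫⁻ y, g y ∂ν) * ∫⁻ y, f y ^ 2 * g y ∂ν := by
  have := lintegral_le_sqrt_mul_sqrt (F := fun y => f y * g y) hg ((hf.pow_const 2).mul hg)
    (Eventually.of_forall fun y => by
      rw [← ENNReal.mul_rpow_of_nonneg _ _ (by norm_num), ← ennreal_sq_sqrt (f y * g y)]
      refine le_of_eq ?_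
      congr 1; simp only [Pi.mul_apply]; ring)
  calc _ ≤ _ := pow_le_pow_left' this 2
    _ = _ := by rw [mul_pow, ennreal_sqrt_sq, ennreal_sqrt_sq]; rfl

/-- In this strip `e^z` has nonnegative real part, hence is at least as far from `-1` as from `1`.
-/
theorem norm_tanh_half_le_one {z : ℂ} (hz : |z.im| ≤ Real.pi / 2) : ‖Complex.tanh (z / 2)‖ ≤ 1 := by
  have h := tanh_half_sub z 0
  rw [sub_zero, Complex.exp_zero] at h
  rw [h, norm_div]
  refine div_le_one_of_le₀ ?_ (norm_nonneg _)
  have hre : 0 ≤ (Complex.exp z).re := by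
    rw [Complex.exp_re]
    exact mul_nonneg (Real.exp_pos _).le (Real.cos_nonneg_of_mem_Icc ⟨(abs_le.1 hz).1 |>.trans' (by linarith), (abs_le.1 hz).2⟩)
  rw [← sq_le_sq₀ (norm_nonneg _) (norm_nonneg _), ← Complex.normSq_eq_norm_sq, ← Complex.normSq_eq_norm_sq,
    Complex.normSq_apply, Complex.normSq_apply]
  simp only [Complex.sub_re, Complex.add_re, Complex.sub_im, Complex.add_im, Complex.one_re, Complex.one_im]
  nlinarith

theorem cothHalf_eq (z : ℂ) (hz : Complex.exp z - 1 ≠ 0) : cothHalf z = 1 + 2 / (Complex.exp z - 1) := by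
  have h := cothHalf_sub z 0
  rw [sub_zero, Complex.exp_zero] at h
  rw [h]; field_simp; ring

/-- The pole at the origin is removed and the next ones are out of reach. For `‖z‖ ≤ 1/2` the second
order Taylor bound of the exponential is used. Otherwise `|e^z - 1| ≥ 1/10`, by its modulus if `|Re
z| ≥ 1/4` and by its imaginary part if not, and `25 = 1 + 20 + 4`. -/
theorem norm_cothHalf_sub_le {z : ℂ} (h0 : z ≠ 0) (hz : |z.im| ≤ Real.pi / 2) :
    ‖cothHalf z - 2 / z‖ ≤ 25 := by
  have hz0 : 0 < ‖z‖ := norm_pos_iff.2 h0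
  rcases le_or_gt ‖z‖ (1 / 2) with hs | hs
  · have h1 := Complex.norm_exp_sub_one_sub_id_le (x := z) (by linarith)
    have h2 : ‖z‖ / 2 ≤ ‖Complex.exp z - 1‖ := by
      have := norm_sub_norm_le z (-(Complex.exp z - 1 - z))
      rw [norm_neg, show z - -(Complex.exp z - 1 - z) = Complex.exp z - 1 by ring] at this
      nlinarith
    have h3 : Complex.exp z - 1 ≠ 0 := norm_pos_iff.1 (by linarith)
    rw [cothHalf_eq z h3, show 1 + 2 / (Complex.exp z - 1) - 2 / z =
      1 + -(2 * (Complex.exp z - 1 - z) / ((Complex.exp z - 1) * z)) by field_simp; ring]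
    refine (norm_add_le _ _).trans ?_
    rw [norm_neg, norm_div, norm_mul, norm_mul, norm_one, Complex.norm_two]
    have : 2 * ‖Complex.exp z - 1 - z‖ / (‖Complex.exp z - 1‖ * ‖z‖) ≤ 4 := by
      rw [div_le_iff₀ (by positivity)]
      nlinarith
    linarith
  · have h2 : 1 / 10 ≤ ‖Complex.exp z - 1‖ := by
      rcases le_or_gt (1 / 4) |z.re| with hx | hx
      · have h4 : |Real.exp z.re - 1| ≤ ‖Complex.exp z - 1‖ := by
          have := abs_norm_sub_norm_le (Complex.exp z) 1
          rwa [Complex.norm_exp, norm_one] at this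
        refine le_trans ?_ h4
        rcases le_abs.1 hx with h | h
        · rw [le_abs]; left
          have := Real.add_one_le_exp z.re
          linarith
        · rw [le_abs]; right
          have h5 := Real.add_one_le_exp (-z.re)
          have h6 : Real.exp z.re * Real.exp (-z.re) = 1 := by rw [← Real.exp_add]; simp
          have := Real.exp_pos z.re
          nlinarith
      · have hy : 1 / 4 ≤ |z.im| := by
          have := Complex.norm_le_abs_re_add_abs_im z
          linarith
        have h4 : |(Complex.exp z - 1).im| ≤ ‖Complex.exp z - 1‖ := Complex.abs_im_le_norm _
        refine le_trans ?_ h4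
        rw [Complex.sub_im, Complex.one_im, sub_zero, Complex.exp_im, abs_mul, abs_of_pos (Real.exp_pos _)]
        have h5 : 3 / 4 ≤ Real.exp z.re := by
          have := Real.add_one_le_exp z.re
          have := neg_abs_le z.re
          linarith
        have h6 := Real.mul_abs_le_abs_sin hz
        have h7 : 3 / 5 ≤ 2 / Real.pi := by
          rw [div_le_div_iff₀ (by norm_num) Real.pi_pos]
          linarith [Real.pi_lt_d2]
        have h8 : 3 / 20 ≤ |Real.sin z.im| := by nlinarith
        nlinarith
    have h3 : Complex.exp z - 1 ≠ 0 := norm_pos_iff.1 (by linarith)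
    rw [cothHalf_eq z h3]
    refine (norm_sub_le _ _).trans ?_
    have h4 := norm_add_le (1 : ℂ) (2 / (Complex.exp z - 1))
    rw [norm_one, norm_div, Complex.norm_two] at h4
    have h5 : 2 / ‖Complex.exp z - 1‖ ≤ 20 := by
      rw [div_le_iff₀ (by linarith)]; linarith
    have h6 : ‖2 / z‖ ≤ 4 := by
      rw [norm_div, Complex.norm_two, div_le_iff₀ hz0]; linarith
    linarith

/-! ### Uniform `L²` boundedness of the Cauchy kernel. -/

/-- The Cauchy kernel `1 / (t + iε)`. -/
noncomputable def cauchyK (ε t : ℝ) : ℂ := ((t : ℂ) + Complex.I * ε)⁻¹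

section Cauchy

variable {ε : ℝ}

theorem cauchy_den_ne (hε : ε ≠ 0) (t : ℝ) : (t : ℂ) + Complex.I * ε ≠ 0 := fun h => hε (by
  simpa using congrArg Complex.im h)

theorem continuous_cauchyK (hε : ε ≠ 0) : Continuous (cauchyK ε) :=
  Continuous.inv₀ (by fun_prop) (cauchy_den_ne hε)

theorem norm_cauchyK_sq (t : ℝ) : ‖cauchyK ε t‖ ^ 2 = (t ^ 2 + ε ^ 2)⁻¹ := by
  rw [cauchyK, norm_inv, inv_pow, ← Complex.normSq_eq_norm_sq, Complex.normSq_apply]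
  congr 1; simp; ring

theorem norm_cauchyK_le (hε : ε ≠ 0) (t : ℝ) : ‖cauchyK ε t‖ ≤ |ε|⁻¹ := by
  refine le_of_sq_le_sq ?_ (by positivity)
  rw [norm_cauchyK_sq, inv_pow, sq_abs]
  have : 0 < ε ^ 2 := by positivity
  gcongr; nlinarith [sq_nonneg t]

theorem norm_cauchyK_le_inv {t : ℝ} (ht : t ≠ 0) : ‖cauchyK ε t‖ ≤ |t|⁻¹ := by
  refine le_of_sq_le_sq ?_ (by positivity)
  rw [norm_cauchyK_sq, inv_pow, sq_abs]
  have : 0 < t ^ 2 := by positivity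
  gcongr; nlinarith [sq_nonneg ε]

theorem cauchyK_im (t : ℝ) : (cauchyK ε t).im = -(ε * (t ^ 2 + ε ^ 2)⁻¹) := by
  rw [cauchyK, Complex.inv_im, Complex.normSq_apply]
  simp; ring

theorem integrable_poisson (hε : ε ≠ 0) : Integrable fun t : ℝ => (t ^ 2 + ε ^ 2)⁻¹ := by
  have h := (integrable_inv_one_add_sq.comp_div hε).const_mul (ε ^ 2)⁻¹
  refine h.congr (Eventually.of_forall fun t => ?_)
  simp only
  rw [← mul_inv, div_pow, mul_add, mul_one, mul_div_cancel₀ _ (pow_ne_zero 2 hε), add_comm]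

theorem integral_poisson (hε : ε ≠ 0) : ∫ t : ℝ, (t ^ 2 + ε ^ 2)⁻¹ = Real.pi / |ε| := by
  have h : ∀ t : ℝ, (t ^ 2 + ε ^ 2)⁻¹ = (ε ^ 2)⁻¹ * (1 + (t / ε) ^ 2)⁻¹ := fun t => by
    rw [← mul_inv, div_pow, mul_add, mul_one, mul_div_cancel₀ _ (pow_ne_zero 2 hε), add_comm]
  simp only [h]
  rw [integral_const_mul, Measure.integral_comp_div (fun t => (1 + t ^ 2)⁻¹), integral_univ_inv_one_add_sq,
    smul_eq_mul, ← sq_abs]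
  have : |ε| ≠ 0 := abs_ne_zero.2 hε
  field_simp

theorem integrable_cauchyK_sq (hε : ε ≠ 0) : Integrable fun t : ℝ => ‖cauchyK ε t‖ ^ 2 := by
  simpa only [norm_cauchyK_sq] using integrable_poisson hε

theorem integrable_cauchyK_mul (hε : ε ≠ 0) (h : ℝ) :
    Integrable fun t : ℝ => cauchyK ε t * cauchyK ε (t + h) := by
  refine (((integrable_cauchyK_sq hε).add ((integrable_cauchyK_sq hε).comp_add_right h))).mono'
    ((continuous_cauchyK hε).mul ((continuous_cauchyK hε).comp (by fun_prop))).aestronglyMeasurable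
    (Eventually.of_forall fun t => ?_)
  rw [norm_mul, Pi.add_apply]
  nlinarith [sq_nonneg (‖cauchyK ε t‖ - ‖cauchyK ε (t + h)‖), sq_nonneg ‖cauchyK ε t‖,
    sq_nonneg ‖cauchyK ε (t + h)‖]

/-- Both poles lie in the same half plane. In place of a contour, partial fractions write the
integrand as a difference of translates. -/
theorem integral_cauchyK_mul (hε : ε ≠ 0) {h : ℝ} (hh : h ≠ 0) :
    ∫ t : ℝ, cauchyK ε t * cauchyK ε (t + h) = 0 := by
  have hc := continuous_cauchyK hε
  have hch : Continuous fun t => cauchyK ε (t + h) := hc.comp (by fun_prop)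
  have hpf : ∀ t, cauchyK ε t * cauchyK ε (t + h) = (h : ℂ)⁻¹ * (cauchyK ε t - cauchyK ε (t + h)) := by
    intro t
    have h1 := cauchy_den_ne hε t
    have h2 := cauchy_den_ne hε (t + h)
    have h3 : (h : ℂ) ≠ 0 := by exact_mod_cast hh
    simp only [cauchyK]
    field_simp
    push_cast; ring
  have hlim := intervalIntegral_tendsto_integral (integrable_cauchyK_mul hε h)
    tendsto_neg_atTop_atBot tendsto_id
  refine tendsto_nhds_unique hlim ?_
  have hb : ∀ᶠ R : ℝ in atTop, ‖∫ t in (-R)..(id R), cauchyK ε t * cauchyK ε (t + h)‖ ≤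
      2 * (R - |h|)⁻¹ := by
    filter_upwards [eventually_gt_atTop |h|] with R hR
    have hRh : 0 < R - |h| := by linarith
    have hI : ∀ a b, IntervalIntegrable (cauchyK ε) volume a b := fun a b => hc.intervalIntegrable a b
    simp only [hpf, id]
    rw [intervalIntegral.integral_const_mul, intervalIntegral.integral_sub (hI _ _) (hch.intervalIntegrable _ _),
      intervalIntegral.integral_comp_add_right,
      intervalIntegral.integral_interval_sub_interval_comm (hI _ _) (hI _ _) (hI _ _)]
    -- In the difference of translates only two intervals of length `|h|` at the ends `±R` survive,
    -- where the kernel is of order `1/R`.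
    have hbd : ∀ s : ℝ, |s| = R → ‖∫ t in s..(s + h), cauchyK ε t‖ ≤ (R - |h|)⁻¹ * |h| := by
      intro s hs
      have := intervalIntegral.norm_integral_le_of_norm_le_const (a := s) (b := s + h) (f := cauchyK ε)
        (C := (R - |h|)⁻¹) (fun t ht => ?_)
      · simpa using this
      · have h1 : |t - s| ≤ |h| := by
          have := Set.abs_sub_left_of_mem_uIcc (Set.uIoc_subset_uIcc ht)
          simpa using this
        have h2 : R - |h| ≤ |t| := by
          have := abs_sub_abs_le_abs_sub s t
          rw [abs_sub_comm] at this
          linarith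
        have h3 : t ≠ 0 := fun h0 => by rw [h0, abs_zero] at h2; linarith
        exact (norm_cauchyK_le_inv h3).trans (by gcongr)
    have h0 : 0 < R := (abs_nonneg h).trans_lt hR
    have e1 := hbd (-R) (by rw [abs_neg, abs_of_pos h0])
    have e2 := hbd R (abs_of_pos h0)
    rw [norm_mul, norm_inv, Complex.norm_real, Real.norm_eq_abs]
    have hh' : 0 < |h| := abs_pos.2 hh
    calc _ ≤ |h|⁻¹ * ((R - |h|)⁻¹ * |h| + (R - |h|)⁻¹ * |h|) := by
          gcongr
          exact (norm_sub_le _ _).trans (add_le_add e1 e2)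
      _ = _ := by field_simp; ring
  refine squeeze_zero_norm' hb ?_
  have : Tendsto (fun R : ℝ => (R - |h|)⁻¹) atTop (𝓝 0) :=
    tendsto_inv_atTop_zero.comp (tendsto_atTop_add_const_right _ _ tendsto_id)
  simpa using this.const_mul 2

end Cauchy

section Cauchy

variable {ε : ℝ}

/-- The integral operator with the Cauchy kernel. -/
noncomputable def cauchyInt (ε : ℝ) (u : ℝ → ℂ) (y : ℝ) : ℂ := ∫ x, u x * cauchyK ε (x - y)

theorem integrable_mul_cauchyK_sq (hε : ε ≠ 0) {u : ℝ → ℝ} (hu : Integrable u) :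
    Integrable (fun p : ℝ × ℝ => u p.2 * ‖cauchyK ε (p.2 - p.1)‖ ^ 2) (volume.prod volume) := by
  have := hu.convolution_integrand (ContinuousLinearMap.mul ℝ ℝ) (integrable_cauchyK_sq hε).comp_neg
  refine this.congr (Eventually.of_forall fun p => ?_)
  simp

theorem integrable_mul_cauchyK (hε : ε ≠ 0) {u : ℝ → ℂ} (hu : Integrable u) (y : ℝ) :
    Integrable fun x => u x * cauchyK ε (x - y) :=
  hu.mul_bdd (c := |ε|⁻¹) ((continuous_cauchyK hε).comp (by fun_prop)).aestronglyMeasurable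
    (Eventually.of_forall fun x => norm_cauchyK_le hε _)

theorem stronglyMeasurable_cauchyInt (hε : ε ≠ 0) {u : ℝ → ℂ} (hm : Measurable u) :
    StronglyMeasurable (cauchyInt ε u) := by
  refine StronglyMeasurable.integral_prod_right' (f := fun p : ℝ × ℝ => u p.2 * cauchyK ε (p.2 - p.1)) ?_
  exact ((hm.comp measurable_snd).mul
    ((continuous_cauchyK hε).measurable.comp (by fun_prop))).stronglyMeasurable

/-- Cauchy–Schwarz with respect to the measure `|u| dx`. The resulting bound depends on `ε`; it only
serves to justify the interchanges of integrals. -/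
theorem norm_sq_cauchyInt_le (hε : ε ≠ 0) {u : ℝ → ℂ} (hu : Integrable u) (hm : Measurable u) (y : ℝ) :
    ‖cauchyInt ε u y‖ ^ 2 ≤ (∫ x, ‖u x‖) * ∫ x, ‖u x‖ * ‖cauchyK ε (x - y)‖ ^ 2 := by
  have hk : Continuous fun x => ‖cauchyK ε (x - y)‖ := ((continuous_cauchyK hε).comp (by fun_prop)).norm
  have hi : Integrable fun x => ‖u x‖ * ‖cauchyK ε (x - y)‖ ^ 2 :=
    hu.norm.mul_bdd (c := (|ε|⁻¹) ^ 2) (hk.pow 2).aestronglyMeasurable (Eventually.of_forall fun x => by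
      rw [norm_pow, norm_norm]; exact pow_le_pow_left₀ (norm_nonneg _) (norm_cauchyK_le hε _) 2)
  have h1 := lintegral_mul_sq_le (ν := volume) (f := fun x => ‖cauchyK ε (x - y)‖ₑ) (g := fun x => ‖u x‖ₑ)
    ((continuous_cauchyK hε).comp (by fun_prop)).measurable.enorm.aemeasurable hm.enorm.aemeasurable
  have h2 : ‖cauchyInt ε u y‖ₑ ≤ ∫⁻ x, ‖cauchyK ε (x - y)‖ₑ * ‖u x‖ₑ := by
    refine (enorm_integral_le_lintegral_enorm _).trans (le_of_eq ?_)
    exact lintegral_congr fun x => by rw [enorm_mul, mul_comm]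
  have h3 := (pow_le_pow_left' h2 2).trans h1
  rw [← ofReal_integral_norm_eq_lintegral_enorm hu] at h3
  have h4 : ∫⁻ x, ‖cauchyK ε (x - y)‖ₑ ^ 2 * ‖u x‖ₑ =
      ENNReal.ofReal (∫ x, ‖u x‖ * ‖cauchyK ε (x - y)‖ ^ 2) := by
    rw [ofReal_integral_eq_lintegral_ofReal hi (Eventually.of_forall fun x => by positivity)]
    refine lintegral_congr fun x => ?_
    rw [ENNReal.ofReal_mul (norm_nonneg _), ENNReal.ofReal_pow (norm_nonneg _), ofReal_norm, ofReal_norm,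
      mul_comm]
  rw [h4, ← ENNReal.ofReal_mul (by positivity), ← ofReal_norm, ← ENNReal.ofReal_pow (norm_nonneg _)] at h3
  exact (ENNReal.ofReal_le_ofReal_iff (mul_nonneg (integral_nonneg fun _ => norm_nonneg _)
    (integral_nonneg fun _ => by positivity))).1 h3

theorem integrable_cauchyInt_sq (hε : ε ≠ 0) {u : ℝ → ℂ} (hu : Integrable u) (hm : Measurable u) :
    Integrable fun y => ‖cauchyInt ε u y‖ ^ 2 := by
  have h := ((integrable_mul_cauchyK_sq hε hu.norm).integral_prod_left).const_mul (∫ x, ‖u x‖)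
  refine h.mono' ((stronglyMeasurable_cauchyInt hε hm).norm.pow 2).aestronglyMeasurable
    (Eventually.of_forall fun y => ?_)
  rw [norm_pow, norm_norm]
  exact norm_sq_cauchyInt_le hε hu hm y

/-- The function is the trace of an element of a Hardy space, so its square has vanishing integral.
By Fubini this reduces to the vanishing of the integral of two Cauchy kernels with distinct centres;
equal centres form a null set. -/
theorem integral_cauchyInt_sq (hε : ε ≠ 0) {u : ℝ → ℂ} (hu : Integrable u) (hm : Measurable u) :
    ∫ y, cauchyInt ε u y * cauchyInt ε u y = 0 := by
  have hkm : Measurable (cauchyK ε) := (continuous_cauchyK hε).measurable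
  have hWm := (stronglyMeasurable_cauchyInt hε hm).measurable
  have hin : ∀ x, ∫ y, cauchyK ε (x - y) * cauchyInt ε u y = 0 := by
    intro x
    have hI : Integrable (Function.uncurry fun y x' => cauchyK ε (x - y) * (u x' * cauchyK ε (x' - y)))
        (volume.prod volume) := by
      have hA := ((integrable_cauchyK_sq hε).comp_sub_left x).mul_prod hu.norm
      have hB := integrable_mul_cauchyK_sq hε hu.norm
      refine (hA.add hB).mono' ?_ (Eventually.of_forall fun p => ?_)
      · exact ((hkm.comp (by fun_prop)).mul ((hm.comp measurable_snd).mul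
          (hkm.comp (by fun_prop)))).aestronglyMeasurable
      · simp only [Function.uncurry, norm_mul, Pi.add_apply]
        have := norm_nonneg (u p.2)
        nlinarith [mul_nonneg this (sq_nonneg (‖cauchyK ε (x - p.1)‖ - ‖cauchyK ε (p.2 - p.1)‖)),
          mul_nonneg this (sq_nonneg (‖cauchyK ε (x - p.1)‖)),
          mul_nonneg this (sq_nonneg (‖cauchyK ε (p.2 - p.1)‖))]
    simp only [cauchyInt, ← integral_const_mul]
    rw [integral_integral_swap hI]
    refine integral_eq_zero_of_ae ?_
    filter_upwards [(Set.countable_singleton x).ae_notMem volume] with x' hx'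
    have hne : x' - x ≠ 0 := sub_ne_zero.2 (by simpa using hx')
    have := integral_cauchyK_mul hε hne
    rw [← integral_sub_left_eq_self _ volume x] at this
    have e : ∀ y, cauchyK ε (x - y) * (u x' * cauchyK ε (x' - y)) =
        u x' * (cauchyK ε (x - y) * cauchyK ε (x - y + (x' - x))) := fun y => by
      rw [show x - y + (x' - x) = x' - y by ring]; ring
    simp only [e, integral_const_mul, this, mul_zero, Pi.zero_apply]
  have hI : Integrable (Function.uncurry fun y x => (u x * cauchyK ε (x - y)) * cauchyInt ε u y)
      (volume.prod volume) := by
    have hA := (integrable_cauchyInt_sq hε hu hm).mul_prod hu.norm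
    have hB := integrable_mul_cauchyK_sq hε hu.norm
    refine (hA.add hB).mono' ?_ (Eventually.of_forall fun p => ?_)
    · exact (((hm.comp measurable_snd).mul
          (hkm.comp (by fun_prop))).mul (hWm.comp measurable_fst)).aestronglyMeasurable
    · simp only [Function.uncurry, norm_mul, Pi.add_apply]
      have := norm_nonneg (u p.2)
      nlinarith [mul_nonneg this (sq_nonneg (‖cauchyInt ε u p.1‖ - ‖cauchyK ε (p.2 - p.1)‖)),
        mul_nonneg this (sq_nonneg (‖cauchyInt ε u p.1‖)),
        mul_nonneg this (sq_nonneg (‖cauchyK ε (p.2 - p.1)‖))]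
  have e : ∀ y, cauchyInt ε u y * cauchyInt ε u y =
      ∫ x, (u x * cauchyK ε (x - y)) * cauchyInt ε u y := fun y => by
    rw [integral_mul_const]; rfl
  simp only [e]
  rw [integral_integral_swap hI]
  simp only [mul_assoc, integral_const_mul, hin, mul_zero, integral_zero]

/-- The Cauchy kernel is bounded on `L²(ℝ)`, uniformly in the distance to the real line: real case. -/
theorem integral_cauchyInt_ofReal_le (hε : ε ≠ 0) {u : ℝ → ℝ} (hu : Integrable u) (hm : Measurable u)
    (hu2 : Integrable fun x => u x ^ 2) :
    ∫ y, ‖cauchyInt ε (fun x => (u x : ℂ)) y‖ ^ 2 ≤ 2 * Real.pi ^ 2 * ∫ x, u x ^ 2 := by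
  set W := cauchyInt ε (fun x => (u x : ℂ)) with hW
  have huc : Integrable fun x => (u x : ℂ) := hu.ofReal
  have hmc : Measurable fun x => (u x : ℂ) := Complex.measurable_ofReal.comp hm
  have hWm : StronglyMeasurable W := stronglyMeasurable_cauchyInt hε hmc
  have hsq := integrable_cauchyInt_sq hε huc hmc
  have hre : Integrable fun y => (W y).re ^ 2 := hsq.mono'
    ((Complex.measurable_re.comp hWm.measurable).pow_const 2).aestronglyMeasurable
    (Eventually.of_forall fun y => by
      rw [norm_pow, Real.norm_eq_abs]; exact pow_le_pow_left₀ (abs_nonneg _) (Complex.abs_re_le_norm _) 2)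
  have him : Integrable fun y => (W y).im ^ 2 := hsq.mono'
    ((Complex.measurable_im.comp hWm.measurable).pow_const 2).aestronglyMeasurable
    (Eventually.of_forall fun y => by
      rw [norm_pow, Real.norm_eq_abs]; exact pow_le_pow_left₀ (abs_nonneg _) (Complex.abs_im_le_norm _) 2)
  have hWW : Integrable fun y => W y * W y := hsq.mono' (hWm.mul hWm).aestronglyMeasurable
    (Eventually.of_forall fun y => by rw [norm_mul, sq])
  -- This is the real part of `∫ W² = 0`: the conjugate function has the same `L²` norm, so it
  -- suffices to estimate the imaginary part.
  have h0 : ∫ y, (W y).re ^ 2 = ∫ y, (W y).im ^ 2 := by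
    have h1 := congrArg Complex.re (integral_cauchyInt_sq hε huc hmc)
    have h2 := Complex.reCLM.integral_comp_comm hWW
    simp only [Complex.reCLM_apply] at h2
    rw [← h2, Complex.zero_re] at h1
    rw [← sub_eq_zero, ← integral_sub hre him, ← h1]
    refine integral_congr_ae (Eventually.of_forall fun y => ?_)
    simp only [Complex.mul_re]; ring
  have h1 : ∫ y, ‖W y‖ ^ 2 = 2 * ∫ y, (W y).im ^ 2 := by
    rw [two_mul]; nth_rewrite 1 [← h0]
    rw [← integral_add hre him]
    refine integral_congr_ae (Eventually.of_forall fun y => ?_)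
    simp only
    rw [← Complex.normSq_eq_norm_sq, Complex.normSq_apply]; ring
  rw [h1, mul_assoc]
  refine mul_le_mul_of_nonneg_left ?_ zero_le_two
  -- the imaginary part is a Poisson integral
  set Q : ℝ → ℝ := fun t => |ε| * (t ^ 2 + ε ^ 2)⁻¹ with hQ
  have hQi : Integrable Q := (integrable_poisson hε).const_mul _
  have hQ0 : ∀ t, 0 ≤ Q t := fun t => by positivity
  have hQint : ∫ t, Q t = Real.pi := by
    rw [hQ, integral_const_mul, integral_poisson hε, mul_div_cancel₀ _ (abs_ne_zero.2 hε)]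
  have hQm : Measurable Q := by fun_prop
  have hQl : ∀ y, ∫⁻ x, ENNReal.ofReal (Q (x - y)) = ENNReal.ofReal Real.pi := fun y => by
    rw [lintegral_sub_right_eq_self (fun x => ENNReal.ofReal (Q x)), ← hQint,
      ofReal_integral_eq_lintegral_ofReal hQi (Eventually.of_forall hQ0)]
  have hQl' : ∀ x, ∫⁻ y, ENNReal.ofReal (Q (x - y)) = ENNReal.ofReal Real.pi := fun x => by
    rw [lintegral_sub_left_eq_self (fun x => ENNReal.ofReal (Q x)), ← hQint,
      ofReal_integral_eq_lintegral_ofReal hQi (Eventually.of_forall hQ0)]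
  -- As `u` is real, the imaginary part is the convolution of `u` with the Poisson kernel up to
  -- sign. Its mass is `π` for every `ε`: one factor `π` comes from Cauchy–Schwarz here, the other
  -- from the integration over `y` below.
  have hpt : ∀ y, ENNReal.ofReal ((W y).im ^ 2) ≤
      ENNReal.ofReal Real.pi * ∫⁻ x, ‖u x‖ₑ ^ 2 * ENNReal.ofReal (Q (x - y)) := by
    intro y
    have h2 := lintegral_mul_sq_le (ν := volume) (f := fun x => ‖u x‖ₑ)
      (g := fun x => ENNReal.ofReal (Q (x - y))) hm.enorm.aemeasurable
      (hQm.comp (by fun_prop)).ennreal_ofReal.aemeasurable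
    rw [hQl] at h2
    refine le_trans ?_ h2
    rw [← sq_abs, ENNReal.ofReal_pow (abs_nonneg _), ← Real.norm_eq_abs, ofReal_norm]
    refine pow_le_pow_left' ?_ 2
    have h3 := Complex.imCLM.integral_comp_comm (integrable_mul_cauchyK hε huc y)
    simp only [Complex.imCLM_apply] at h3
    rw [hW, cauchyInt, ← h3]
    refine (enorm_integral_le_lintegral_enorm _).trans (lintegral_mono fun x => le_of_eq ?_)
    rw [Complex.im_ofReal_mul, enorm_mul, cauchyK_im, enorm_neg]
    congr 1
    rw [← ofReal_norm, Real.norm_eq_abs, abs_mul, abs_of_nonneg (by positivity : (0 : ℝ) ≤ ((x - y) ^ 2 + ε ^ 2)⁻¹)]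
  have hfin : ENNReal.ofReal (∫ y, (W y).im ^ 2) ≤ ENNReal.ofReal (Real.pi ^ 2 * ∫ x, u x ^ 2) := by
    rw [ofReal_integral_eq_lintegral_ofReal him (Eventually.of_forall fun y => sq_nonneg _)]
    refine (lintegral_mono hpt).trans ?_
    rw [lintegral_const_mul' _ _ ENNReal.ofReal_ne_top, lintegral_lintegral_swap]
    · have : ∀ x, ∫⁻ y, ‖u x‖ₑ ^ 2 * ENNReal.ofReal (Q (x - y)) = ‖u x‖ₑ ^ 2 * ENNReal.ofReal Real.pi :=
        fun x => by rw [lintegral_const_mul' _ _ (by simp), hQl']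
      simp only [this]
      rw [lintegral_mul_const' _ _ ENNReal.ofReal_ne_top, mul_left_comm, ← ENNReal.ofReal_mul Real.pi_pos.le, ← sq,
        ENNReal.ofReal_mul (sq_nonneg _), mul_comm,
        ofReal_integral_eq_lintegral_ofReal hu2 (Eventually.of_forall fun y => sq_nonneg _)]
      refine le_of_eq ?_
      congr 1
      refine lintegral_congr fun x => ?_
      rw [← sq_abs, ENNReal.ofReal_pow (abs_nonneg _), ← Real.norm_eq_abs, ofReal_norm]
    · exact (((hm.comp measurable_snd).enorm.pow_const 2).mul
        (hQm.comp (by fun_prop)).ennreal_ofReal).aemeasurable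
  exact (ENNReal.ofReal_le_ofReal_iff (by positivity)).1 hfin

end Cauchy

theorem ennreal_add_sq_le (a b : ℝ≥0∞) : (a + b) ^ 2 ≤ 4 * (a ^ 2 + b ^ 2) := by
  have h : ∀ a b : ℝ≥0∞, a ≤ b → (a + b) ^ 2 ≤ 4 * (a ^ 2 + b ^ 2) := fun a b hab => by
    calc (a + b) ^ 2 ≤ (b + b) ^ 2 := by gcongr
      _ = 4 * b ^ 2 := by ring
      _ ≤ _ := by gcongr; exact le_add_self
  rcases le_total a b with hab | hab
  · exact h a b hab
  · rw [add_comm a, add_comm (a ^ 2)]; exact h b a hab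

/-- The Cauchy kernel is bounded on `L²(ℝ)`, uniformly in the distance to the real line. -/
theorem lintegral_cauchyInt_le {ε : ℝ} (hε : ε ≠ 0) {u : ℝ → ℂ} (hu : Integrable u) (hm : Measurable u)
    (hu2 : ∫⁻ x, ‖u x‖ₑ ^ 2 ≠ ⊤) :
    ∫⁻ y, ‖cauchyInt ε u y‖ₑ ^ 2 ≤ ENNReal.ofReal (16 * Real.pi ^ 2) * ∫⁻ x, ‖u x‖ₑ ^ 2 := by
  -- To be applied to the real and imaginary parts of `u`; the final constant is `4 * (2π² + 2π²)`.
  have hreal : ∀ v : ℝ → ℝ, Measurable v → (∀ x, |v x| ≤ ‖u x‖) →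
      Measurable (fun x => (v x : ℂ)) ∧ Integrable (fun x => (v x : ℂ)) ∧
      ∫⁻ y, ‖cauchyInt ε (fun x => (v x : ℂ)) y‖ₑ ^ 2 ≤
        ENNReal.ofReal (2 * Real.pi ^ 2) * ∫⁻ x, ‖u x‖ₑ ^ 2 := by
    intro v hv hvu
    have hvi : Integrable v := hu.norm.mono' hv.aestronglyMeasurable (Eventually.of_forall hvu)
    have hle : ∫⁻ x, ENNReal.ofReal (v x ^ 2) ≤ ∫⁻ x, ‖u x‖ₑ ^ 2 := lintegral_mono fun x => by
      rw [← sq_abs, ENNReal.ofReal_pow (abs_nonneg _), ← ofReal_norm]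
      exact pow_le_pow_left' (ENNReal.ofReal_le_ofReal (hvu x)) 2
    have hv2 : Integrable fun x => v x ^ 2 := by
      refine ⟨(hv.pow_const 2).aestronglyMeasurable, ?_⟩
      rw [hasFiniteIntegral_iff_ofReal (Eventually.of_forall fun x => sq_nonneg _)]
      exact hle.trans_lt hu2.lt_top
    have hvm : Measurable (fun x => (v x : ℂ)) := Complex.measurable_ofReal.comp hv
    have hvc : Integrable fun x => (v x : ℂ) := hvi.ofReal
    refine ⟨hvm, hvc, ?_⟩
    have h := integral_cauchyInt_ofReal_le hε hvi hv hv2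
    have h' := ENNReal.ofReal_le_ofReal h
    rw [ENNReal.ofReal_mul (by positivity),
      ofReal_integral_eq_lintegral_ofReal hv2 (Eventually.of_forall fun y => sq_nonneg _),
      ofReal_integral_eq_lintegral_ofReal (integrable_cauchyInt_sq hε hvc hvm)
        (Eventually.of_forall fun y => sq_nonneg _)] at h'
    simp only [ENNReal.ofReal_pow (norm_nonneg _), ofReal_norm] at h'
    exact h'.trans (by gcongr)
  obtain ⟨m1, i1, h1⟩ := hreal (fun x => (u x).re) (Complex.measurable_re.comp hm)
    (fun x => Complex.abs_re_le_norm _)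
  obtain ⟨m2, i2, h2⟩ := hreal (fun x => (u x).im) (Complex.measurable_im.comp hm)
    (fun x => Complex.abs_im_le_norm _)
  have hsplit : ∀ y, cauchyInt ε u y = cauchyInt ε (fun x => ((u x).re : ℂ)) y +
      Complex.I * cauchyInt ε (fun x => ((u x).im : ℂ)) y := by
    intro y
    rw [cauchyInt, cauchyInt, cauchyInt, ← integral_const_mul,
      ← integral_add (integrable_mul_cauchyK hε i1 y) ((integrable_mul_cauchyK hε i2 y).const_mul _)]
    refine integral_congr_ae (Eventually.of_forall fun x => ?_)
    simp only
    nth_rewrite 1 [← Complex.re_add_im (u x)]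
    ring
  calc _ ≤ ∫⁻ y, 4 * (‖cauchyInt ε (fun x => ((u x).re : ℂ)) y‖ₑ ^ 2 +
        ‖cauchyInt ε (fun x => ((u x).im : ℂ)) y‖ₑ ^ 2) := lintegral_mono fun y => by
        rw [hsplit]
        refine (pow_le_pow_left' (enorm_add_le _ _) 2).trans ?_
        rw [enorm_mul, show ‖Complex.I‖ₑ = 1 by rw [← ofReal_norm, Complex.norm_I, ENNReal.ofReal_one], one_mul]
        exact ennreal_add_sq_le _ _
    _ ≤ 4 * (ENNReal.ofReal (2 * Real.pi ^ 2) * (∫⁻ x, ‖u x‖ₑ ^ 2) +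
        ENNReal.ofReal (2 * Real.pi ^ 2) * ∫⁻ x, ‖u x‖ₑ ^ 2) := by
        rw [lintegral_const_mul' _ _ (by simp),
          lintegral_add_left ((stronglyMeasurable_cauchyInt hε m1).measurable.enorm.pow_const 2)]
        gcongr
    _ = _ := by
        rw [← two_mul, ← mul_assoc, ← mul_assoc]
        congr 1
        rw [show (4 : ℝ≥0∞) * 2 = ENNReal.ofReal 8 by norm_num, ← ENNReal.ofReal_mul (by norm_num)]
        congr 1; ring

/-! ### Exponential weights and the hyperbolic cotangent. -/

/-- The weight `exp (δ |x|)`. -/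
noncomputable def wt (δ x : ℝ) : ℝ≥0∞ := ENNReal.ofReal (Real.exp (δ * |x|))

/-- The integral of the inverse weight. -/
noncomputable def wtInt (δ : ℝ) : ℝ≥0∞ := ∫⁻ x, wt (-δ) x

theorem measurable_wt (δ : ℝ) : Measurable (wt δ) := by unfold wt; fun_prop

theorem wt_mul_wt_neg (δ x : ℝ) : wt δ x * wt (-δ) x = 1 := by
  rw [wt, wt, ← ENNReal.ofReal_mul (Real.exp_pos _).le, ← Real.exp_add]; simp

theorem one_le_wt {δ : ℝ} (hδ : 0 < δ) (x : ℝ) : 1 ≤ wt δ x := by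
  rw [wt, ENNReal.one_le_ofReal, Real.one_le_exp_iff]; positivity

theorem wt_neg_le_one {δ : ℝ} (hδ : 0 < δ) (x : ℝ) : wt (-δ) x ≤ 1 := by
  rw [wt, ENNReal.ofReal_le_one, Real.exp_le_one_iff]
  nlinarith [abs_nonneg x]

theorem wt_ne_top (δ x : ℝ) : wt δ x ≠ ⊤ := ENNReal.ofReal_ne_top

theorem wtInt_ne_top {δ : ℝ} (hδ : 0 < δ) : wtInt δ ≠ ⊤ := by
  have h : Integrable fun x : ℝ => Real.exp (-δ * |x|) := by
    rw [← integrableOn_univ, ← Set.Iic_union_Ioi (a := (0 : ℝ)), integrableOn_union]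
    refine ⟨(integrableOn_exp_mul_Iic hδ 0).congr_fun (fun x hx => ?_) measurableSet_Iic,
      (integrableOn_exp_mul_Ioi (neg_neg_of_pos hδ) 0).congr_fun (fun x hx => ?_) measurableSet_Ioi⟩
    · simp only [abs_of_nonpos (Set.mem_Iic.1 hx), neg_mul_neg]
    · simp only [abs_of_pos (Set.mem_Ioi.1 hx)]
  exact ((hasFiniteIntegral_iff_ofReal (Eventually.of_forall fun x => (Real.exp_pos _).le)).1 h.2).ne

/-- Cauchy–Schwarz against the integrable inverse weight. The weights exist for this purpose: a
kernel that is merely bounded on the line needs control of the `L¹` norm. -/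
theorem lintegral_enorm_sq_le {δ : ℝ} {u : ℝ → ℂ} (hm : Measurable u) :
    (∫⁻ x, ‖u x‖ₑ) ^ 2 ≤ wtInt δ * ∫⁻ x, ‖u x‖ₑ ^ 2 * wt δ x := by
  have h := lintegral_mul_sq_le (ν := volume) (f := fun x => ‖u x‖ₑ * wt δ x) (g := wt (-δ))
    (hm.enorm.mul (measurable_wt δ)).aemeasurable (measurable_wt _).aemeasurable
  have e1 : ∀ x, ‖u x‖ₑ * wt δ x * wt (-δ) x = ‖u x‖ₑ := fun x => by
    rw [mul_assoc, wt_mul_wt_neg, mul_one]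
  have e2 : ∀ x, (‖u x‖ₑ * wt δ x) ^ 2 * wt (-δ) x = ‖u x‖ₑ ^ 2 * wt δ x := fun x => by
    rw [mul_pow, sq (wt δ x), mul_assoc, mul_assoc (wt δ x), wt_mul_wt_neg, mul_one]
  simp only [e1, e2] at h
  exact h

theorem continuous_cothHalf {ε : ℝ} (h0 : ε ≠ 0) (h : |ε| ≤ Real.pi / 2) :
    Continuous fun t : ℝ => cothHalf ((t : ℂ) + Complex.I * ε) := by
  have hne : ∀ t : ℝ, Complex.exp ((t : ℂ) + Complex.I * ε) - 1 ≠ 0 := by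
    intro t ht
    rw [sub_eq_zero, Complex.exp_eq_one_iff] at ht
    obtain ⟨n, hn⟩ := ht
    have := congrArg Complex.im hn
    simp at this
    have hn1 : |ε| = |(n : ℝ)| * (2 * Real.pi) := by
      rw [this, abs_mul, abs_of_pos (by positivity : 0 < 2 * Real.pi)]
    have hn0 : n ≠ 0 := fun h => h0 (by rw [this, h]; simp)
    have : (1 : ℝ) ≤ |(n : ℝ)| := by exact_mod_cast Int.one_le_abs hn0
    nlinarith [Real.pi_pos]
  have : ∀ t : ℝ, cothHalf ((t : ℂ) + Complex.I * ε) =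
      1 + 2 / (Complex.exp ((t : ℂ) + Complex.I * ε) - 1) := fun t => cothHalf_eq _ (hne t)
  simp only [this]
  exact continuous_const.add (continuous_const.div (by fun_prop) hne)

theorem norm_cothHalf_le {ε : ℝ} (h0 : ε ≠ 0) (h : |ε| ≤ Real.pi / 2) (t : ℝ) :
    ‖cothHalf ((t : ℂ) + Complex.I * ε)‖ ≤ 2 * ‖cauchyK ε t‖ + 25 := by
  have h1 := norm_cothHalf_sub_le (cauchy_den_ne h0 t) (by simpa using h)
  have h2 := norm_sub_norm_le (cothHalf ((t : ℂ) + Complex.I * ε)) (2 / ((t : ℂ) + Complex.I * ε))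
  rw [norm_div, Complex.norm_two, div_eq_mul_inv, ← norm_inv] at h2
  simp only [cauchyK]; linarith

/-- The integral operator with kernel `coth ((x - y + iε) / 2)`. -/
noncomputable def cothInt (ε : ℝ) (u : ℝ → ℂ) (y : ℝ) : ℂ :=
  ∫ x, u x * cothHalf (((x - y : ℝ) : ℂ) + Complex.I * ε)

theorem enorm_cothInt_le {ε : ℝ} (h0 : ε ≠ 0) (h : |ε| ≤ Real.pi / 2) {u : ℝ → ℂ} (hu : Integrable u)
    (y : ℝ) : ‖cothInt ε u y‖ₑ ≤ 2 * ‖cauchyInt ε u y‖ₑ + 25 * ∫⁻ x, ‖u x‖ₑ := by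
  have hcc := (continuous_cothHalf h0 h).comp (continuous_id.sub continuous_const : Continuous fun x => x - y)
  have hi : Integrable fun x => u x * cothHalf (((x - y : ℝ) : ℂ) + Complex.I * ε) :=
    hu.mul_bdd (c := 2 * |ε|⁻¹ + 25) hcc.aestronglyMeasurable (Eventually.of_forall fun x =>
      (norm_cothHalf_le h0 h _).trans (by gcongr; exact norm_cauchyK_le h0 _))
  have hk := (integrable_mul_cauchyK h0 hu y).const_mul 2
  have e : cothInt ε u y = 2 * cauchyInt ε u y + ∫ x, u x * (cothHalf (((x - y : ℝ) : ℂ) + Complex.I * ε) -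
      2 * cauchyK ε (x - y)) := by
    rw [cothInt, cauchyInt, ← integral_const_mul, ← sub_eq_iff_eq_add', ← integral_sub hi hk]
    refine integral_congr_ae (Eventually.of_forall fun x => ?_)
    simp only; ring
  rw [e]
  refine (enorm_add_le _ _).trans (add_le_add (by rw [enorm_mul]; gcongr; simp [enorm]) ?_)
  refine (enorm_integral_le_lintegral_enorm _).trans ?_
  rw [← lintegral_const_mul' _ _ (by simp)]
  refine lintegral_mono fun x => ?_
  rw [enorm_mul, mul_comm]
  gcongr
  rw [← ofReal_norm, show (25 : ℝ≥0∞) = ENNReal.ofReal 25 by simp]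
  refine ENNReal.ofReal_le_ofReal ?_
  have := norm_cothHalf_sub_le (cauchy_den_ne h0 (x - y)) (by simpa using h)
  rwa [div_eq_mul_inv] at this

/-- The Cauchy part is bounded without weights, the remainder sends `L¹` to constants, and constants
are square integrable against the inverse weight. Hence the operator goes from the weight `δ` to the
weight `-δ`, which is dual to it. The constants are `16 = 4 * 2²` and `2500 = 4 * 25²`. -/
theorem exists_lintegral_cothInt_le {δ : ℝ} (hδ : 0 < δ) : ∃ H : ℝ≥0∞, H ≠ ⊤ ∧ ∀ ε : ℝ, ε ≠ 0 →
    |ε| ≤ Real.pi / 2 → ∀ u : ℝ → ℂ, Measurable u → ∫⁻ x, ‖u x‖ₑ ^ 2 * wt δ x ≠ ⊤ →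
      ∫⁻ y, ‖cothInt ε u y‖ₑ ^ 2 * wt (-δ) y ≤ H * ∫⁻ x, ‖u x‖ₑ ^ 2 * wt δ x := by
  refine ⟨16 * ENNReal.ofReal (16 * Real.pi ^ 2) + 2500 * wtInt δ * wtInt δ, ?_, ?_⟩
  · have := wtInt_ne_top hδ
    exact ENNReal.add_ne_top.2 ⟨ENNReal.mul_ne_top (by simp) ENNReal.ofReal_ne_top,
      ENNReal.mul_ne_top (ENNReal.mul_ne_top (by simp) this) this⟩
  intro ε h0 h u hm hfin
  set N := ∫⁻ x, ‖u x‖ₑ ^ 2 * wt δ x with hN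
  have hsq := lintegral_enorm_sq_le (δ := δ) hm
  rw [← hN] at hsq
  have hu : Integrable u := by
    refine ⟨hm.aestronglyMeasurable, ?_⟩
    have : (∫⁻ x, ‖u x‖ₑ) ^ 2 < ⊤ := hsq.trans_lt (ENNReal.mul_lt_top (wtInt_ne_top hδ).lt_top hfin.lt_top)
    exact (ENNReal.pow_lt_top_iff.1 this).resolve_right (by norm_num)
  have hle : ∫⁻ x, ‖u x‖ₑ ^ 2 ≤ N := lintegral_mono fun x => le_mul_of_one_le_right' (one_le_wt hδ x)
  have hC := lintegral_cauchyInt_le h0 hu hm (hle.trans_lt hfin.lt_top).ne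
  calc _ ≤ ∫⁻ y, (16 * ‖cauchyInt ε u y‖ₑ ^ 2 + 2500 * (wtInt δ * N) * wt (-δ) y) := by
        refine lintegral_mono fun y => ?_
        have h1 := (pow_le_pow_left' (enorm_cothInt_le h0 h hu y) 2).trans (ennreal_add_sq_le _ _)
        rw [mul_pow, mul_pow] at h1
        calc _ ≤ 4 * (2 ^ 2 * ‖cauchyInt ε u y‖ₑ ^ 2 + 25 ^ 2 * (∫⁻ x, ‖u x‖ₑ) ^ 2) * wt (-δ) y := by gcongr
          _ = 16 * ‖cauchyInt ε u y‖ₑ ^ 2 * wt (-δ) y + 2500 * (∫⁻ x, ‖u x‖ₑ) ^ 2 * wt (-δ) y := by ring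
          _ ≤ _ := by
            refine add_le_add ?_ (by gcongr)
            exact mul_le_of_le_one_right zero_le (wt_neg_le_one hδ y)
    _ = 16 * (∫⁻ y, ‖cauchyInt ε u y‖ₑ ^ 2) + 2500 * (wtInt δ * N) * wtInt δ := by
        rw [lintegral_add_left (((stronglyMeasurable_cauchyInt h0 hm).measurable.enorm.pow_const 2).const_mul _),
          lintegral_const_mul' _ _ (by simp), lintegral_const_mul _ (measurable_wt _)]
        rfl
    _ ≤ 16 * (ENNReal.ofReal (16 * Real.pi ^ 2) * N) + 2500 * (wtInt δ * N) * wtInt δ := by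
        gcongr; exact hC.trans (by gcongr)
    _ = _ := by ring

/-! ### Kernels bounded on weighted `L²` spaces -/

section InsertNth

variable {m n : ℕ}

theorem measurePreserving_insertNth (i : Fin (m + 1)) :
    MeasurePreserving (fun p : ℝ × (Fin m → ℝ) => (i.insertNth p.1 p.2 : Fin (m + 1) → ℝ)) :=
  (volume_preserving_piFinSuccAbove (fun _ : Fin (m + 1) => ℝ) i).symm _

theorem measurePreserving_insertNth_left (i : Fin (m + 1)) :
    MeasurePreserving (fun p : ℝ × ((Fin m → ℝ) × (Fin n → ℝ)) =>
      ((i.insertNth p.1 p.2.1 : Fin (m + 1) → ℝ), p.2.2)) := by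
  have h1 : MeasurePreserving (MeasurableEquiv.prodAssoc.symm :
      ℝ × ((Fin m → ℝ) × (Fin n → ℝ)) → (ℝ × (Fin m → ℝ)) × (Fin n → ℝ)) :=
    (measurePreserving_prodAssoc volume volume volume).symm _
  exact ((measurePreserving_insertNth i).prod (MeasurePreserving.id volume)).comp h1

theorem measurePreserving_insertNth_right (j : Fin (n + 1)) :
    MeasurePreserving (fun p : ℝ × ((Fin m → ℝ) × (Fin n → ℝ)) =>
      (p.2.1, (j.insertNth p.1 p.2.2 : Fin (n + 1) → ℝ))) := by
  have h2 : MeasurePreserving (Prod.swap : (Fin m → ℝ) × (Fin n → ℝ) → _) :=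
    Measure.measurePreserving_swap
  exact (Measure.measurePreserving_swap.comp (measurePreserving_insertNth_left (n := m) j)).comp
    ((MeasurePreserving.id volume).prod h2)

theorem measurePreserving_insertNth_both (i : Fin (m + 1)) (j : Fin (n + 1)) :
    MeasurePreserving (fun p : (ℝ × ((Fin m → ℝ) × (Fin n → ℝ))) × ℝ =>
      ((i.insertNth p.2 p.1.2.1 : Fin (m + 1) → ℝ), (j.insertNth p.1.1 p.1.2.2 : Fin (n + 1) → ℝ))) := by
  have h1 : MeasurePreserving (Prod.swap : (ℝ × ((Fin m → ℝ) × (Fin n → ℝ))) × ℝ → _) :=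
    Measure.measurePreserving_swap
  exact (measurePreserving_insertNth_left i).comp
    (((MeasurePreserving.id volume).prod (measurePreserving_insertNth_right j)).comp h1)

theorem integral_comp_of_measurePreserving {X Y : Type*} [MeasurableSpace X] [MeasurableSpace Y]
    {μ : Measure X} {ν : Measure Y} {f : X → Y} (hf : MeasurePreserving f μ ν) {g : Y → ℂ}
    (hg : AEStronglyMeasurable g ν) : ∫ y, g y ∂ν = ∫ x, g (f x) ∂μ := by
  rw [← hf.map_eq] at hg ⊢
  exact integral_map hf.aemeasurable hg

theorem lintegral_insertNth (i : Fin (m + 1)) {g : (Fin (m + 1) → ℝ) → ℝ≥0∞} (hg : Measurable g) :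
    ∫⁻ θ, g θ = ∫⁻ x, ∫⁻ θ', g (i.insertNth x θ') := by
  rw [← (measurePreserving_insertNth i).lintegral_comp hg]
  exact lintegral_prod _ (hg.comp (measurePreserving_insertNth i).measurable).aemeasurable

theorem measurable_insertNth_right (j : Fin (n + 1)) :
    Measurable fun p : ℝ × (Fin n → ℝ) => (j.insertNth p.1 p.2 : Fin (n + 1) → ℝ) :=
  (measurePreserving_insertNth j).measurable

end InsertNth

/-- The product weight. -/
noncomputable def wtPi (δ : ℝ) {m : ℕ} (θ : Fin m → ℝ) : ℝ≥0∞ := ∏ j, wt δ (θ j)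

theorem measurable_wtPi (δ : ℝ) {m : ℕ} : Measurable (wtPi δ : (Fin m → ℝ) → ℝ≥0∞) :=
  Finset.measurable_fun_prod _ fun j _ => (measurable_wt δ).comp (measurable_pi_apply j)

theorem wtPi_insertNth (δ : ℝ) {m : ℕ} (i : Fin (m + 1)) (x : ℝ) (θ : Fin m → ℝ) :
    wtPi δ (i.insertNth x θ : Fin (m + 1) → ℝ) = wt δ x * wtPi δ θ := by
  simp [wtPi, Fin.prod_univ_succAbove _ i]

theorem wtPi_mul_wtPi_neg (δ : ℝ) {m : ℕ} (θ : Fin m → ℝ) : wtPi δ θ * wtPi (-δ) θ = 1 := by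
  rw [wtPi, wtPi, ← Finset.prod_mul_distrib]
  exact Finset.prod_eq_one fun j _ => wt_mul_wt_neg δ _

theorem wtPi_ne_top (δ : ℝ) {m : ℕ} (θ : Fin m → ℝ) : wtPi δ θ ≠ ⊤ :=
  ENNReal.prod_ne_top fun _ _ => wt_ne_top δ _

/-- The square of the weighted `L²` norm. -/
noncomputable def nsq (δ : ℝ) {m : ℕ} (u : (Fin m → ℝ) → ℂ) : ℝ≥0∞ := ∫⁻ θ, ‖u θ‖ₑ ^ 2 * wtPi δ θ

theorem nsq_insertNth {δ : ℝ} {m : ℕ} (i : Fin (m + 1)) {u : (Fin (m + 1) → ℝ) → ℂ} (hu : Measurable u) :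
    nsq δ u = ∫⁻ x, nsq δ (fun θ => u (i.insertNth x θ)) * wt δ x := by
  refine (lintegral_insertNth i (g := fun θ => ‖u θ‖ₑ ^ 2 * wtPi δ θ)
    ((hu.enorm.pow_const 2).mul (measurable_wtPi δ))).trans ?_
  refine lintegral_congr fun x => ?_
  rw [nsq, ← lintegral_mul_const' _ _ (wt_ne_top δ x)]
  refine lintegral_congr fun θ => ?_
  rw [wtPi_insertNth]; ring

theorem lintegral_wtPi_neg (δ : ℝ) : ∀ m : ℕ, ∫⁻ θ : Fin m → ℝ, wtPi (-δ) θ = wtInt δ ^ m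
  | 0 => by
    simp only [wtPi, Finset.univ_eq_empty, Finset.prod_empty, lintegral_one, pow_zero]
    rw [volume_pi, Measure.pi_univ]; simp
  | m + 1 => by
    rw [lintegral_insertNth 0 (measurable_wtPi _)]
    simp only [wtPi_insertNth]
    simp only [lintegral_const_mul' _ _ (wt_ne_top _ _), lintegral_wtPi_neg δ m]
    rw [lintegral_mul_const _ (measurable_wt _), pow_succ', wtInt]

theorem lintegral_enorm_le_nsq {δ : ℝ} {m : ℕ} {u : (Fin m → ℝ) → ℂ} (hm : Measurable u) :
    ∫⁻ θ, ‖u θ‖ₑ ≤ (wtInt δ ^ m) ^ (1 / 2 : ℝ) * nsq δ u ^ (1 / 2 : ℝ) := by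
  rw [← lintegral_wtPi_neg, nsq]
  refine lintegral_le_sqrt_mul_sqrt (measurable_wtPi _).aemeasurable
    ((hm.enorm.pow_const 2).mul (measurable_wtPi _)).aemeasurable (Eventually.of_forall fun θ => le_of_eq ?_)
  rw [← ENNReal.mul_rpow_of_nonneg _ _ (by norm_num), mul_left_comm, mul_comm (wtPi (-δ) θ),
    wtPi_mul_wtPi_neg, mul_one]
  exact (ennreal_sq_sqrt _).symm

theorem integrable_of_nsq {δ : ℝ} (hδ : 0 < δ) {m : ℕ} {u : (Fin m → ℝ) → ℂ} (hm : Measurable u)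
    (h : nsq δ u ≠ ⊤) : Integrable u := by
  refine ⟨hm.aestronglyMeasurable, (lintegral_enorm_le_nsq (δ := δ) hm).trans_lt ?_⟩
  exact ENNReal.mul_lt_top (ENNReal.rpow_lt_top_of_nonneg (by norm_num) (ENNReal.pow_ne_top (wtInt_ne_top hδ)))
    (ENNReal.rpow_lt_top_of_nonneg (by norm_num) h)

/-- The kernel `k` is measurable, bounded, and defines a bilinear form on the weighted `L²` spaces
with norm at most `C`. -/
structure BddKer (δ : ℝ) {m n : ℕ} (C : ℝ≥0∞) (k : (Fin m → ℝ) → (Fin n → ℝ) → ℂ) : Prop where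
  meas : Measurable (Function.uncurry k)
  bdd : ∃ B, ∀ θ η, ‖k θ η‖ ≤ B
  bound : ∀ u v, Measurable u → Measurable v → nsq δ u ≠ ⊤ → nsq δ v ≠ ⊤ →
    ‖∫ z : (Fin m → ℝ) × (Fin n → ℝ), u z.1 * v z.2 * k z.1 z.2‖ₑ ≤
      C * nsq δ u ^ (1 / 2 : ℝ) * nsq δ v ^ (1 / 2 : ℝ)

theorem integrable_ker {δ : ℝ} (hδ : 0 < δ) {m n : ℕ} {k : (Fin m → ℝ) → (Fin n → ℝ) → ℂ}
    (hk : Measurable (Function.uncurry k)) (hb : ∃ B, ∀ θ η, ‖k θ η‖ ≤ B)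
    {u : (Fin m → ℝ) → ℂ} {v : (Fin n → ℝ) → ℂ} (hu : Measurable u) (hv : Measurable v)
    (hu2 : nsq δ u ≠ ⊤) (hv2 : nsq δ v ≠ ⊤) :
    Integrable fun z : (Fin m → ℝ) × (Fin n → ℝ) => u z.1 * v z.2 * k z.1 z.2 := by
  obtain ⟨B, hB⟩ := hb
  exact ((integrable_of_nsq hδ hu hu2).mul_prod (integrable_of_nsq hδ hv hv2)).mul_bdd (c := B)
    hk.aestronglyMeasurable (Eventually.of_forall fun z => hB _ _)

/-- The form is dominated by the product of the `L¹` norms, each of which costs half a power of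
`wtInt δ` per variable. This starts the induction over the right variables. -/
theorem bddKer_of_norm_le_one {δ : ℝ} {m n : ℕ} {k : (Fin m → ℝ) → (Fin n → ℝ) → ℂ}
    (hk : Measurable (Function.uncurry k)) (hb : ∀ θ η, ‖k θ η‖ ≤ 1) :
    BddKer δ ((wtInt δ ^ m) ^ (1 / 2 : ℝ) * (wtInt δ ^ n) ^ (1 / 2 : ℝ)) k where
  meas := hk
  bdd := ⟨1, hb⟩
  bound u v hu hv _ _ := by
    refine (enorm_integral_le_lintegral_enorm _).trans ?_
    calc _ ≤ ∫⁻ z : (Fin m → ℝ) × (Fin n → ℝ), ‖u z.1‖ₑ * ‖v z.2‖ₑ := lintegral_mono fun z => by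
          rw [enorm_mul, enorm_mul]
          refine mul_le_of_le_one_right zero_le ?_
          rw [← ofReal_norm, ENNReal.ofReal_le_one]; exact hb _ _
      _ = (∫⁻ θ, ‖u θ‖ₑ) * ∫⁻ η, ‖v η‖ₑ := lintegral_prod_mul hu.enorm.aemeasurable hv.enorm.aemeasurable
      _ ≤ ((wtInt δ ^ m) ^ (1 / 2 : ℝ) * nsq δ u ^ (1 / 2 : ℝ)) *
          ((wtInt δ ^ n) ^ (1 / 2 : ℝ) * nsq δ v ^ (1 / 2 : ℝ)) :=
          mul_le_mul' (lintegral_enorm_le_nsq hu) (lintegral_enorm_le_nsq hv)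
      _ = _ := by ring

namespace BddKer

variable {δ : ℝ} {m n : ℕ} {C C' : ℝ≥0∞} {k k' : (Fin m → ℝ) → (Fin n → ℝ) → ℂ}

theorem mono (h : BddKer δ C k) (hC : C ≤ C') : BddKer δ C' k where
  meas := h.meas
  bdd := h.bdd
  bound u v hu hv hu2 hv2 := (h.bound u v hu hv hu2 hv2).trans (by gcongr)

theorem add (hδ : 0 < δ) (h : BddKer δ C k) (h' : BddKer δ C' k') :
    BddKer δ (C + C') (fun θ η => k θ η + k' θ η) where
  meas := h.meas.add h'.meas
  bdd := by
    obtain ⟨B, hB⟩ := h.bdd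
    obtain ⟨B', hB'⟩ := h'.bdd
    exact ⟨B + B', fun θ η => (norm_add_le _ _).trans (add_le_add (hB _ _) (hB' _ _))⟩
  bound u v hu hv hu2 hv2 := by
    simp only [mul_add]
    rw [integral_add (integrable_ker hδ h.meas h.bdd hu hv hu2 hv2)
      (integrable_ker hδ h'.meas h'.bdd hu hv hu2 hv2), add_mul, add_mul]
    exact (enorm_add_le _ _).trans (add_le_add (h.bound u v hu hv hu2 hv2) (h'.bound u v hu hv hu2 hv2))

theorem const_mul (h : BddKer δ C k) {s : ℂ} (hs : ‖s‖ ≤ 1) : BddKer δ C (fun θ η => s * k θ η) where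
  meas := h.meas.const_mul s
  bdd := by
    obtain ⟨B, hB⟩ := h.bdd
    exact ⟨B, fun θ η => by
      rw [norm_mul]; exact (mul_le_of_le_one_left (norm_nonneg _) hs).trans (hB _ _)⟩
  bound u v hu hv hu2 hv2 := by
    simp only [mul_left_comm _ s]
    rw [integral_const_mul, enorm_mul]
    refine (mul_le_of_le_one_left zero_le ?_).trans (h.bound u v hu hv hu2 hv2)
    rwa [← ofReal_norm, ENNReal.ofReal_le_one]

theorem sum (hδ : 0 < δ) {ι : Type*} (t : Finset ι) {C : ι → ℝ≥0∞}
    {k : ι → (Fin m → ℝ) → (Fin n → ℝ) → ℂ} (h : ∀ i ∈ t, BddKer δ (C i) (k i)) :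
    BddKer δ (∑ i ∈ t, C i) (fun θ η => ∑ i ∈ t, k i θ η) := by
  classical
  induction t using Finset.induction_on with
  | empty =>
    simp only [Finset.sum_empty]
    exact ⟨measurable_const, ⟨0, fun _ _ => by simp⟩, fun u v _ _ _ _ => by simp⟩
  | insert a t ha ih =>
    simp only [Finset.sum_insert ha]
    exact (h a (Finset.mem_insert_self a t)).add hδ (ih fun i hi => h i (Finset.mem_insert_of_mem hi))

theorem congr (h : BddKer δ C k) (e : ∀ θ η, k' θ η = k θ η) : BddKer δ C k' := by
  have : k' = k := funext fun θ => funext fun η => e θ η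
  rwa [this]

/-- A kernel which is bounded for every value of one of the right variables. -/
theorem param_right (hδ : 0 < δ) (j : Fin (n + 1)) {K : (Fin m → ℝ) → (Fin (n + 1) → ℝ) → ℂ}
    (hK : Measurable (Function.uncurry K)) (hb : ∃ B, ∀ θ η, ‖K θ η‖ ≤ B)
    (h : ∀ y, BddKer δ C (fun θ η => K θ (j.insertNth y η))) :
    BddKer δ (C * wtInt δ ^ (1 / 2 : ℝ)) K where
  meas := hK
  bdd := hb
  bound u v hu hv hu2 hv2 := by
    have hint := integrable_ker hδ hK hb hu hv hu2 hv2
    have hmp := measurePreserving_insertNth_right (m := m) j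
    rw [integral_comp_of_measurePreserving hmp hint.aestronglyMeasurable]
    have hint' := (hmp.integrable_comp hint.aestronglyMeasurable).2 hint
    have hpr := integral_prod _ hint'
    refine (le_of_eq (congrArg (fun z : ℂ => ‖z‖ₑ) hpr)).trans ?_
    refine (enorm_integral_le_lintegral_enorm _).trans ?_
    have hvm : Measurable fun p : ℝ × (Fin n → ℝ) => v (j.insertNth p.1 p.2) :=
      hv.comp (measurable_insertNth_right j)
    have hbm : Measurable fun y => nsq δ (fun η => v (j.insertNth y η)) :=
      Measurable.lintegral_prod_right' (f := fun p : ℝ × (Fin n → ℝ) =>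
        ‖v (j.insertNth p.1 p.2)‖ₑ ^ 2 * wtPi δ p.2)
        ((hvm.enorm.pow_const 2).mul ((measurable_wtPi δ).comp measurable_snd))
    have hv2' := hv2
    rw [nsq_insertNth j hv] at hv2'
    have hae := ae_lt_top (hbm.mul (measurable_wt δ)) hv2'
    -- Insert `wt δ y * wt (-δ) y = 1`: the inverse weight is integrated over `y`, the weight
    -- restores the full norm of `v`.
    have hcs := lintegral_le_sqrt_mul_sqrt (ν := volume)
      (F := fun y => ‖∫ z : (Fin m → ℝ) × (Fin n → ℝ), u z.1 * v (j.insertNth y z.2) *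
        K z.1 (j.insertNth y z.2)‖ₑ)
      (a := fun y => C ^ 2 * nsq δ u * wt (-δ) y)
      (b := fun y => nsq δ (fun η => v (j.insertNth y η)) * wt δ y)
      ((measurable_wt _).const_mul _).aemeasurable (hbm.mul (measurable_wt δ)).aemeasurable ?_
    · refine hcs.trans (le_of_eq ?_)
      rw [← nsq_insertNth j hv, lintegral_const_mul _ (measurable_wt _),
        ENNReal.mul_rpow_of_nonneg _ _ (by norm_num), ENNReal.mul_rpow_of_nonneg _ _ (by norm_num),
        ennreal_sq_sqrt, wtInt]
      ring
    · filter_upwards [hae] with y hy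
      have hy' : nsq δ (fun η => v (j.insertNth y η)) ≠ ⊤ := fun h0 => by
        rw [Pi.mul_apply, h0, ENNReal.top_mul] at hy
        · exact lt_irrefl _ hy
        · exact (zero_lt_one.trans_le (one_le_wt hδ y)).ne'
      refine ((h y).bound u _ hu (hvm.comp (measurable_const.prodMk measurable_id)) hu2 hy').trans
        (le_of_eq ?_)
      rw [← ENNReal.mul_rpow_of_nonneg _ _ (by norm_num),
        show C ^ 2 * nsq δ u * wt (-δ) y * (nsq δ (fun η => v (j.insertNth y η)) * wt δ y) =
          C ^ 2 * nsq δ u * nsq δ (fun η => v (j.insertNth y η)) * (wt δ y * wt (-δ) y) by ring,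
        wt_mul_wt_neg, mul_one, ENNReal.mul_rpow_of_nonneg _ _ (by norm_num),
        ENNReal.mul_rpow_of_nonneg _ _ (by norm_num), ennreal_sq_sqrt]
      rfl

end BddKer

theorem measurable_cothHalf : Measurable cothHalf := by
  have : Measurable Complex.tanh := by
    simp only [funext fun z => Complex.tanh_eq_sinh_div_cosh z]
    exact Complex.measurable_sinh.div Complex.measurable_cosh
  exact (this.comp (by fun_prop : Measurable fun z : ℂ => z / 2)).inv

/-- First integrate over the `i`-th left variable, which replaces `u` by its image `U` under the
one-variable operator, the `j`-th right variable `y` being its argument. For fixed `y` the kernel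
`k` is applied to the remaining variables. Cauchy–Schwarz in `y` pairs the weight `-δ` carried by
`U` with the weight `δ` carried by `v`. -/
theorem BddKer.coth {δ : ℝ} (hδ : 0 < δ) {m n : ℕ} {C H : ℝ≥0∞} {k : (Fin m → ℝ) → (Fin n → ℝ) → ℂ}
    (h : BddKer δ C k) (i : Fin (m + 1)) (j : Fin (n + 1)) {ε : ℝ} (h0 : ε ≠ 0) (hε : |ε| ≤ Real.pi / 2)
    (hH : H ≠ ⊤) (hcoth : ∀ u : ℝ → ℂ, Measurable u → ∫⁻ x, ‖u x‖ₑ ^ 2 * wt δ x ≠ ⊤ →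
      ∫⁻ y, ‖cothInt ε u y‖ₑ ^ 2 * wt (-δ) y ≤ H * ∫⁻ x, ‖u x‖ₑ ^ 2 * wt δ x) :
    BddKer δ (C * H ^ (1 / 2 : ℝ)) (fun (θ : Fin (m + 1) → ℝ) (η : Fin (n + 1) → ℝ) =>
      cothHalf (((θ i - η j : ℝ) : ℂ) + Complex.I * ε) * k (i.removeNth θ) (j.removeNth η)) := by
  have hKm : Measurable (Function.uncurry fun (θ : Fin (m + 1) → ℝ) (η : Fin (n + 1) → ℝ) =>
      cothHalf (((θ i - η j : ℝ) : ℂ) + Complex.I * ε) * k (i.removeNth θ) (j.removeNth η)) := by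
    refine (measurable_cothHalf.comp ?_).mul (h.meas.comp (Measurable.prodMk ?_ ?_))
    · fun_prop
    · exact measurable_pi_lambda _ fun l => (measurable_pi_apply _).comp measurable_fst
    · exact measurable_pi_lambda _ fun l => (measurable_pi_apply _).comp measurable_snd
  have hKb : ∃ B, ∀ (θ : Fin (m + 1) → ℝ) (η : Fin (n + 1) → ℝ),
      ‖cothHalf (((θ i - η j : ℝ) : ℂ) + Complex.I * ε) * k (i.removeNth θ) (j.removeNth η)‖ ≤ B := by
    obtain ⟨B, hB⟩ := h.bdd
    refine ⟨(2 * |ε|⁻¹ + 25) * B, fun θ η => ?_⟩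
    rw [norm_mul]
    exact mul_le_mul ((norm_cothHalf_le h0 hε _).trans (by gcongr; exact norm_cauchyK_le h0 _))
      (hB _ _) (norm_nonneg _) (by positivity)
  refine ⟨hKm, hKb, fun u v hu hv hu2 hv2 => ?_⟩
  have hint := integrable_ker hδ hKm hKb hu hv hu2 hv2
  have hmp := measurePreserving_insertNth_both i j
  rw [integral_comp_of_measurePreserving hmp hint.aestronglyMeasurable]
  have hint' := (hmp.integrable_comp hint.aestronglyMeasurable).2 hint
  have hpr := integral_prod _ hint'
  have hint'' := hint'.integral_prod_left
  have hum : Measurable fun p : ℝ × (Fin m → ℝ) => u (i.insertNth p.1 p.2) :=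
    hu.comp (measurable_insertNth_right i)
  have hvm : Measurable fun p : ℝ × (Fin n → ℝ) => v (j.insertNth p.1 p.2) :=
    hv.comp (measurable_insertNth_right j)
  -- the transformed function
  set U : ℝ → (Fin m → ℝ) → ℂ := fun y θ => cothInt ε (fun x => u (i.insertNth x θ)) y with hU
  have hUm : Measurable (Function.uncurry U) := by
    refine (StronglyMeasurable.integral_prod_right' (f := fun q : (ℝ × (Fin m → ℝ)) × ℝ =>
      u (i.insertNth q.2 q.1.2) * cothHalf (((q.2 - q.1.1 : ℝ) : ℂ) + Complex.I * ε)) ?_).measurable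
    refine Measurable.stronglyMeasurable (Measurable.mul ?_ ?_)
    · exact hum.comp (by fun_prop : Measurable fun q : (ℝ × (Fin m → ℝ)) × ℝ => (q.2, q.1.2))
    · exact measurable_cothHalf.comp (by fun_prop)
  have hinner : ∀ p : ℝ × ((Fin m → ℝ) × (Fin n → ℝ)),
      (∫ x, ((fun z : (Fin (m + 1) → ℝ) × (Fin (n + 1) → ℝ) => u z.1 * v z.2 *
        (cothHalf (((z.1 i - z.2 j : ℝ) : ℂ) + Complex.I * ε) * k (i.removeNth z.1) (j.removeNth z.2))) ∘
        fun p : (ℝ × ((Fin m → ℝ) × (Fin n → ℝ))) × ℝ =>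
          ((i.insertNth p.2 p.1.2.1 : Fin (m + 1) → ℝ), (j.insertNth p.1.1 p.1.2.2 : Fin (n + 1) → ℝ))) (p, x)) =
      U p.1 p.2.1 * v (j.insertNth p.1 p.2.2) * k p.2.1 p.2.2 := by
    intro p
    change _ = (∫ x, u (i.insertNth x p.2.1) * cothHalf (((x - p.1 : ℝ) : ℂ) + Complex.I * ε)) * _ * _
    rw [mul_assoc, ← integral_mul_const]
    refine integral_congr_ae (Eventually.of_forall fun x => ?_)
    simp only [Function.comp_apply, Fin.insertNth_apply_same, Fin.removeNth_insertNth]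
    ring
  simp only [hinner] at hpr hint''
  have hpr2 := integral_prod _ hint''
  refine (le_of_eq (congrArg (fun z : ℂ => ‖z‖ₑ) (hpr.trans hpr2))).trans ?_
  refine (enorm_integral_le_lintegral_enorm _).trans ?_
  have hbm : Measurable fun y => nsq δ (fun η => v (j.insertNth y η)) :=
    Measurable.lintegral_prod_right' (f := fun p : ℝ × (Fin n → ℝ) =>
      ‖v (j.insertNth p.1 p.2)‖ₑ ^ 2 * wtPi δ p.2)
      ((hvm.enorm.pow_const 2).mul ((measurable_wtPi δ).comp measurable_snd))
  have hau : Measurable fun y => nsq δ (U y) :=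
    Measurable.lintegral_prod_right' (f := fun p : ℝ × (Fin m → ℝ) => ‖U p.1 p.2‖ₑ ^ 2 * wtPi δ p.2)
      ((hUm.enorm.pow_const 2).mul ((measurable_wtPi δ).comp measurable_snd))
  have hUle : ∫⁻ y, nsq δ (U y) * wt (-δ) y ≤ H * nsq δ u := by
    have e1 : ∀ y, nsq δ (U y) * wt (-δ) y = ∫⁻ θ, ‖U y θ‖ₑ ^ 2 * wtPi δ θ * wt (-δ) y := fun y => by
      rw [nsq, lintegral_mul_const' _ _ (wt_ne_top _ _)]
    simp only [e1]
    rw [lintegral_lintegral_swap]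
    swap
    · exact (((hUm.enorm.pow_const 2).mul ((measurable_wtPi δ).comp measurable_snd)).mul
        ((measurable_wt _).comp measurable_fst)).aemeasurable
    have e2 : nsq δ u = ∫⁻ θ : Fin m → ℝ, (∫⁻ x, ‖u (i.insertNth x θ)‖ₑ ^ 2 * wt δ x) * wtPi δ θ := by
      rw [nsq_insertNth i hu]
      have e3 : ∀ x, nsq δ (fun θ => u (i.insertNth x θ)) * wt δ x =
          ∫⁻ θ, ‖u (i.insertNth x θ)‖ₑ ^ 2 * wtPi δ θ * wt δ x := fun x => by
        rw [nsq, lintegral_mul_const' _ _ (wt_ne_top _ _)]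
      simp only [e3]
      rw [lintegral_lintegral_swap]
      · refine lintegral_congr fun θ => ?_
        rw [← lintegral_mul_const' _ _ (wtPi_ne_top δ θ)]
        exact lintegral_congr fun x => by ring
      · exact (((hum.enorm.pow_const 2).mul ((measurable_wtPi δ).comp measurable_snd)).mul
          ((measurable_wt _).comp measurable_fst)).aemeasurable
    -- The one-variable bound is available only for slices of finite norm, which is the case for
    -- almost every value of the other variables.
    have hae : ∀ᵐ θ : Fin m → ℝ, ∫⁻ x, ‖u (i.insertNth x θ)‖ₑ ^ 2 * wt δ x ≠ ⊤ := by
      have h1 := hu2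
      rw [e2] at h1
      have hmm : Measurable fun θ : Fin m → ℝ => ∫⁻ x, ‖u (i.insertNth x θ)‖ₑ ^ 2 * wt δ x :=
        Measurable.lintegral_prod_left' (f := fun p : ℝ × (Fin m → ℝ) =>
          ‖u (i.insertNth p.1 p.2)‖ₑ ^ 2 * wt δ p.1)
          ((hum.enorm.pow_const 2).mul ((measurable_wt δ).comp measurable_fst))
      filter_upwards [ae_lt_top (hmm.mul (measurable_wtPi δ)) h1] with θ hθ h2
      rw [Pi.mul_apply, h2, ENNReal.top_mul] at hθ
      · exact lt_irrefl _ hθ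
      · intro h3
        have := wtPi_mul_wtPi_neg δ θ
        rw [h3, zero_mul] at this
        exact zero_ne_one this
    rw [e2, ← lintegral_const_mul' _ _ hH]
    refine lintegral_mono_ae ?_
    filter_upwards [hae] with θ hθ
    have e4 : ∫⁻ y, ‖U y θ‖ₑ ^ 2 * wtPi δ θ * wt (-δ) y =
        (∫⁻ y, ‖U y θ‖ₑ ^ 2 * wt (-δ) y) * wtPi δ θ := by
      rw [← lintegral_mul_const' _ _ (wtPi_ne_top δ θ)]
      exact lintegral_congr fun y => by ring
    rw [e4, ← mul_assoc]
    gcongr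
    exact hcoth _ (hum.comp (measurable_id.prodMk measurable_const)) hθ
  have haw : Measurable fun y => nsq δ (U y) * wt (-δ) y := hau.mul (measurable_wt _)
  have hv2' := hv2
  rw [nsq_insertNth j hv] at hv2'
  have hae := ae_lt_top (hbm.mul (measurable_wt δ)) hv2'
  have hae' := ae_lt_top (hau.mul (measurable_wt (-δ)))
    (hUle.trans_lt (ENNReal.mul_lt_top hH.lt_top hu2.lt_top)).ne
  have hcs := lintegral_le_sqrt_mul_sqrt (ν := volume)
    (F := fun y => ‖∫ z : (Fin m → ℝ) × (Fin n → ℝ), U y z.1 * v (j.insertNth y z.2) * k z.1 z.2‖ₑ)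
    (a := fun y => C ^ 2 * (nsq δ (U y) * wt (-δ) y))
    (b := fun y => nsq δ (fun η => v (j.insertNth y η)) * wt δ y)
    (haw.const_mul _).aemeasurable (hbm.mul (measurable_wt δ)).aemeasurable ?_
  · refine hcs.trans ?_
    rw [← nsq_insertNth j hv, lintegral_const_mul _ haw,
      ENNReal.mul_rpow_of_nonneg _ _ (by norm_num), ennreal_sq_sqrt,
      mul_assoc C (H ^ (1 / 2 : ℝ)), ← ENNReal.mul_rpow_of_nonneg H _ (by norm_num)]
    gcongr
  · filter_upwards [hae, hae'] with y hy hy2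
    have hy' : nsq δ (fun η => v (j.insertNth y η)) ≠ ⊤ := fun h0 => by
      rw [Pi.mul_apply, h0, ENNReal.top_mul] at hy
      · exact lt_irrefl _ hy
      · exact (zero_lt_one.trans_le (one_le_wt hδ y)).ne'
    have hy2' : nsq δ (U y) ≠ ⊤ := fun h0 => by
      rw [Pi.mul_apply, h0, ENNReal.top_mul] at hy2
      · exact lt_irrefl _ hy2
      · intro h3
        have := wt_mul_wt_neg δ y
        rw [h3, mul_zero] at this
        exact zero_ne_one this
    refine (h.bound _ _ (hUm.comp (measurable_const.prodMk measurable_id))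
      (hvm.comp (measurable_const.prodMk measurable_id)) hy2' hy').trans (le_of_eq ?_)
    rw [← ENNReal.mul_rpow_of_nonneg _ _ (by norm_num),
      show C ^ 2 * (nsq δ (U y) * wt (-δ) y) * (nsq δ (fun η => v (j.insertNth y η)) * wt δ y) =
        C ^ 2 * nsq δ (U y) * nsq δ (fun η => v (j.insertNth y η)) * (wt δ y * wt (-δ) y) by ring,
      wt_mul_wt_neg, mul_one, ENNReal.mul_rpow_of_nonneg _ _ (by norm_num),
      ENNReal.mul_rpow_of_nonneg _ _ (by norm_num), ennreal_sq_sqrt]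
    rfl

/-! ### The weighted norm of the boundary values of `Modd` -/

theorem exp_im_ne_zero {ε : ℝ} (h0 : ε ≠ 0) (h : |ε| ≤ Real.pi / 2) (x : ℝ) :
    (Complex.exp ((x : ℂ) + Complex.I * ε)).im ≠ 0 := by
  rw [Complex.exp_im]
  simp only [Complex.add_re, Complex.ofReal_re, Complex.mul_re, Complex.I_re, Complex.I_im,
    Complex.ofReal_im, Complex.add_im, Complex.mul_im, zero_mul, one_mul, mul_zero, sub_zero, zero_add,
    add_zero]
  refine mul_ne_zero (Real.exp_pos _).ne' ?_
  intro hs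
  rcases Real.sin_eq_zero_iff_of_lt_of_lt (x := ε) (by linarith [(abs_le.1 h).1, Real.pi_pos])
    (by linarith [(abs_le.1 h).2, Real.pi_pos]) with h1
  exact h0 (h1.1 hs)

/-- The exponential is not real here, so it is different from `1` and `-1`. -/
theorem tanh_half_ne_zero {ε : ℝ} (h0 : ε ≠ 0) (h : |ε| ≤ Real.pi / 2) (x : ℝ) :
    Complex.tanh (((x : ℂ) + Complex.I * ε) / 2) ≠ 0 := by
  have h1 := tanh_half_sub ((x : ℂ) + Complex.I * ε) 0
  rw [sub_zero, Complex.exp_zero] at h1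
  rw [h1]
  have him := exp_im_ne_zero h0 h x
  refine div_ne_zero (fun h2 => him ?_) (fun h2 => him ?_)
  · have := congrArg Complex.im h2
    simpa using this
  · have := congrArg Complex.im h2
    simpa using this

/-- Real variables shifted into the complex domain. -/
noncomputable def cshift {m : ℕ} (a θ : Fin m → ℝ) : Fin m → ℂ := fun j => (θ j : ℂ) + Complex.I * (a j : ℂ)

/-- Small imaginary parts, pairwise distinct. -/
structure SmallShift {m n : ℕ} (a : Fin m → ℝ) (b : Fin n → ℝ) : Prop where
  left : ∀ i l, i ≠ l → a i ≠ a l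
  right : ∀ i l, i ≠ l → b i ≠ b l
  cross : ∀ i j, a i ≠ b j
  left_le : ∀ i, |a i| ≤ Real.pi / 4
  right_le : ∀ i, |b i| ≤ Real.pi / 4

theorem abs_sub_le_half_pi {s t : ℝ} (hs : |s| ≤ Real.pi / 4) (ht : |t| ≤ Real.pi / 4) :
    |s - t| ≤ Real.pi / 2 := (abs_sub _ _).trans (by linarith)

theorem cshift_sub {m n : ℕ} (a θ : Fin m → ℝ) (b η : Fin n → ℝ) (i : Fin m) (j : Fin n) :
    cshift a θ i - cshift b η j = ((θ i - η j : ℝ) : ℂ) + Complex.I * ((a i - b j : ℝ) : ℂ) := by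
  simp only [cshift]; push_cast; ring

theorem SmallShift.generic {m n : ℕ} {a : Fin m → ℝ} {b : Fin n → ℝ} (h : SmallShift a b)
    (θ : Fin m → ℝ) (η : Fin n → ℝ) : Generic (cshift a θ) (cshift b η) where
  left i l hil := by
    rw [cshift_sub]
    exact tanh_half_ne_zero (sub_ne_zero.2 (h.left i l hil)) (abs_sub_le_half_pi (h.left_le _) (h.left_le _)) _
  right i l hil := by
    rw [cshift_sub]
    exact tanh_half_ne_zero (sub_ne_zero.2 (h.right i l hil)) (abs_sub_le_half_pi (h.right_le _) (h.right_le _)) _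
  cross i j := by
    rw [cshift_sub]
    exact tanh_half_ne_zero (sub_ne_zero.2 (h.cross i j)) (abs_sub_le_half_pi (h.left_le _) (h.right_le _)) _

theorem norm_Modd_cshift_le {m : ℕ} {a : Fin m → ℝ} (h : ∀ i, |a i| ≤ Real.pi / 4) (θ : Fin m → ℝ) :
    ‖Modd (cshift a θ)‖ ≤ 1 := by
  rw [Modd, norm_prod]
  refine Finset.prod_le_one (fun _ _ => norm_nonneg _) fun i _ => ?_
  rw [norm_prod]
  refine Finset.prod_le_one (fun _ _ => norm_nonneg _) fun j _ => ?_
  rw [cshift_sub]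
  exact norm_tanh_half_le_one (by simpa using abs_sub_le_half_pi (h i) (h j))

/-- A crude pointwise bound which degenerates at the boundary. It provides the polynomial growth
required for the existence of boundary values and does not enter the norm estimates. -/
theorem norm_Dker_cshift_le {m n : ℕ} {a : Fin m → ℝ} {b : Fin n → ℝ} (ha : ∀ i, |a i| ≤ Real.pi / 4)
    (hb : ∀ i, |b i| ≤ Real.pi / 4) {s : ℝ} (hs : 0 < s) (hab : ∀ i j, s ≤ |a i - b j|)
    (θ : Fin m → ℝ) (η : Fin n → ℝ) : ‖Dker (cshift a θ) (cshift b η)‖ ≤ (2 * s⁻¹ + 25) ^ (m * n) := by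
  rw [Dker, norm_mul, norm_mul, norm_prod]
  have h1 : ∏ i, ‖∏ j, cothHalf (cshift a θ i - cshift b η j)‖ ≤ ∏ _i : Fin m, (2 * s⁻¹ + 25) ^ n := by
    refine Finset.prod_le_prod (fun _ _ => norm_nonneg _) fun i _ => ?_
    rw [norm_prod, ← Fin.prod_const]
    refine Finset.prod_le_prod (fun _ _ => norm_nonneg _) fun j _ => ?_
    rw [cshift_sub]
    have h0 : a i - b j ≠ 0 := fun h0 => by
      have := hab i j
      rw [h0, abs_zero] at this; linarith
    refine (norm_cothHalf_le h0 (abs_sub_le_half_pi (ha i) (hb j)) _).trans ?_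
    gcongr
    exact (norm_cauchyK_le h0 _).trans (by gcongr; exact hab i j)
  calc _ ≤ 1 * 1 * ∏ _i : Fin m, (2 * s⁻¹ + 25) ^ n := by
        gcongr
        · exact norm_Modd_cshift_le ha θ
        · exact norm_Modd_cshift_le hb η
    _ = _ := by rw [Fin.prod_const, ← pow_mul, mul_comm n]; ring

theorem measurable_Dker_cshift {m n : ℕ} (a : Fin m → ℝ) (b : Fin n → ℝ) :
    Measurable (Function.uncurry fun θ η => Dker (cshift a θ) (cshift b η)) := by
  have ht : Measurable Complex.tanh := by
    simp only [funext fun z => Complex.tanh_eq_sinh_div_cosh z]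
    exact Complex.measurable_sinh.div Complex.measurable_cosh
  unfold Dker Modd Function.uncurry
  refine ((Finset.measurable_fun_prod _ fun i _ => Finset.measurable_fun_prod _ fun j _ => ht.comp ?_).mul
    (Finset.measurable_fun_prod _ fun i _ => Finset.measurable_fun_prod _ fun j _ => ht.comp ?_)).mul
    (Finset.measurable_fun_prod _ fun i _ => Finset.measurable_fun_prod _ fun j _ =>
      measurable_cothHalf.comp ?_) <;> simp only [cshift] <;> fun_prop

theorem SmallShift.del_left {m n : ℕ} {a : Fin (m + 1) → ℝ} {b : Fin n → ℝ} (h : SmallShift a b)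
    (i : Fin (m + 1)) : SmallShift (i.removeNth a) b where
  left _ _ hkl := h.left _ _ (fun e => hkl (Fin.succAbove_right_injective e))
  right := h.right
  cross _ _ := h.cross _ _
  left_le _ := h.left_le _
  right_le := h.right_le

theorem SmallShift.del_right {m n : ℕ} {a : Fin m → ℝ} {b : Fin (n + 1) → ℝ} (h : SmallShift a b)
    (i : Fin (n + 1)) : SmallShift a (i.removeNth b) where
  left := h.left
  right _ _ hkl := h.right _ _ (fun e => hkl (Fin.succAbove_right_injective e))
  cross _ _ := h.cross _ _
  left_le := h.left_le
  right_le _ := h.right_le _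

theorem measurable_tanh : Measurable Complex.tanh := by
  simp only [funext fun z => Complex.tanh_eq_sinh_div_cosh z]
  exact Complex.measurable_sinh.div Complex.measurable_cosh

theorem BddKer.ignore_right {δ : ℝ} (hδ : 0 < δ) {m n : ℕ} {C : ℝ≥0∞}
    {k : (Fin m → ℝ) → (Fin n → ℝ) → ℂ} (h : BddKer δ C k) (j : Fin (n + 1)) :
    BddKer δ (C * wtInt δ ^ (1 / 2 : ℝ)) (fun θ (η : Fin (n + 1) → ℝ) => k θ (j.removeNth η)) := by
  obtain ⟨B, hB⟩ := h.bdd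
  refine BddKer.param_right hδ j ?_ ⟨B, fun θ η => hB _ _⟩ fun y => h.congr fun θ η => ?_
  · exact h.meas.comp (measurable_fst.prodMk (measurable_pi_lambda _ fun l =>
      (measurable_pi_apply _).comp measurable_snd))
  · rw [Fin.removeNth_insertNth]

theorem BddKer.mul_single {δ : ℝ} (hδ : 0 < δ) {m n : ℕ} {C : ℝ≥0∞} {k : (Fin m → ℝ) → (Fin n → ℝ) → ℂ}
    (h : BddKer δ C k) (j : Fin (n + 1)) {f : ℝ → ℂ} (hf : Measurable f) (h1 : ∀ x, ‖f x‖ ≤ 1) :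
    BddKer δ (C * wtInt δ ^ (1 / 2 : ℝ)) (fun θ (η : Fin (n + 1) → ℝ) => f (η j) * k θ (j.removeNth η)) := by
  obtain ⟨B, hB⟩ := h.bdd
  refine BddKer.param_right hδ j ?_ ⟨B, fun θ η => ?_⟩ fun y => (h.const_mul (h1 y)).congr fun θ η => ?_
  · exact (hf.comp ((measurable_pi_apply j).comp measurable_snd)).mul (h.meas.comp (measurable_fst.prodMk
      (measurable_pi_lambda _ fun l => (measurable_pi_apply _).comp measurable_snd)))
  · rw [norm_mul]; exact (mul_le_of_le_one_left (norm_nonneg _) (h1 _)).trans (hB _ _)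
  · rw [Fin.removeNth_insertNth, Fin.insertNth_apply_same]

/-- Once the two additional variables are frozen, the factor is a constant of modulus at most one;
freezing each of them costs `wtInt δ ^ (1/2)`. -/
theorem BddKer.mul_pair {δ : ℝ} (hδ : 0 < δ) {m n : ℕ} {C : ℝ≥0∞} {k : (Fin m → ℝ) → (Fin n → ℝ) → ℂ}
    (h : BddKer δ C k) (i : Fin (n + 2)) (j : Fin (n + 1)) {f : ℝ → ℝ → ℂ}
    (hf : Measurable (Function.uncurry f)) (h1 : ∀ x y, ‖f x y‖ ≤ 1) :
    BddKer δ (C * wtInt δ ^ (1 / 2 : ℝ) * wtInt δ ^ (1 / 2 : ℝ)) (fun θ (η : Fin (n + 2) → ℝ) =>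
      f (η i) (i.removeNth η j) * k θ (j.removeNth (i.removeNth η))) := by
  obtain ⟨B, hB⟩ := h.bdd
  refine BddKer.param_right hδ i ?_ ⟨B, fun θ η => ?_⟩ fun y =>
    (h.mul_single hδ j (f := f y) (hf.comp (measurable_const.prodMk measurable_id)) (h1 y)).congr fun θ η => ?_
  · refine (hf.comp (f := fun p : (Fin m → ℝ) × (Fin (n + 2) → ℝ) => (p.2 i, i.removeNth p.2 j))
      (((measurable_pi_apply i).comp measurable_snd).prodMk
        ((measurable_pi_apply (i.succAbove j)).comp measurable_snd))).mul (h.meas.comp (measurable_fst.prodMk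
      (measurable_pi_lambda _ fun l => (measurable_pi_apply _).comp measurable_snd)))
  · rw [norm_mul]; exact (mul_le_of_le_one_left (norm_nonneg _) (h1 _ _)).trans (hB _ _)
  · rw [Fin.removeNth_insertNth, Fin.insertNth_apply_same]

theorem BddKer.tanh {δ : ℝ} (hδ : 0 < δ) {m n : ℕ} {C : ℝ≥0∞} {k : (Fin m → ℝ) → (Fin n → ℝ) → ℂ}
    (hb : BddKer δ C k) (l : Fin (n + 1)) {b : Fin (n + 2) → ℝ} (h : ∀ j, |b j| ≤ Real.pi / 4) :
    BddKer δ (C * wtInt δ ^ (1 / 2 : ℝ) * wtInt δ ^ (1 / 2 : ℝ)) (fun θ (η : Fin (n + 2) → ℝ) =>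
      Complex.tanh ((cshift b η 0 - cshift b η l.succ) / 2) *
        k θ (l.removeNth ((0 : Fin (n + 2)).removeNth η))) := by
  have := hb.mul_pair hδ 0 l (f := fun x y => Complex.tanh ((((x - y : ℝ) : ℂ) +
    Complex.I * ((b 0 - b l.succ : ℝ) : ℂ)) / 2)) (measurable_tanh.comp (by fun_prop))
    fun x y => norm_tanh_half_le_one (by simpa using abs_sub_le_half_pi (h _) (h _))
  refine this.congr fun θ η => ?_
  rw [cshift_sub, Fin.removeNth_apply (0 : Fin (n + 2)) η l, Fin.zero_succAbove]

/-- The weighted norm of `Dker` near the real points, with a constant which is explicit in the numbers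
of variables. -/
theorem exists_bddKer_Dker {δ : ℝ} (hδ : 0 < δ) : ∃ Q : ℝ≥0∞, Q ≠ ⊤ ∧ ∀ (n m : ℕ) (a : Fin m → ℝ)
    (b : Fin n → ℝ), SmallShift a b →
      BddKer δ (Q ^ (m + n) * (m + n + 1 : ℕ) ^ n) (fun θ η => Dker (cshift a θ) (cshift b η)) := by
  obtain ⟨H, hH, hcoth⟩ := exists_lintegral_cothInt_le hδ
  set Q : ℝ≥0∞ := 1 + wtInt δ ^ (1 / 2 : ℝ) + H ^ (1 / 2 : ℝ) with hQ
  have hw : wtInt δ ^ (1 / 2 : ℝ) ≤ Q := by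
    rw [hQ, add_assoc, add_left_comm]; exact le_self_add
  have hH' : H ^ (1 / 2 : ℝ) ≤ Q := le_add_self
  have h1 : 1 ≤ Q := by rw [hQ, add_assoc]; exact le_self_add
  refine ⟨Q, ?_, ?_⟩
  · exact ENNReal.add_ne_top.2 ⟨ENNReal.add_ne_top.2 ⟨ENNReal.one_ne_top,
      (ENNReal.rpow_lt_top_of_nonneg (by norm_num) (wtInt_ne_top hδ)).ne⟩,
      (ENNReal.rpow_lt_top_of_nonneg (by norm_num) hH).ne⟩
  intro n
  -- Strong induction, because the terms with a `tanh` lose two right variables at once.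
  induction n using Nat.strong_induction_on with
  | _ n ih =>
  cases n with
  | zero =>
    intro m a b h
    refine (bddKer_of_norm_le_one (measurable_Dker_cshift a b) fun θ η => ?_).mono ?_
    · have := norm_Modd_cshift_le h.left_le θ
      simpa [Dker, Modd] using this
    · rw [pow_zero, ENNReal.one_rpow, pow_zero, mul_one, mul_one, add_zero, ← ENNReal.rpow_natCast,
        ← ENNReal.rpow_mul, mul_comm, ENNReal.rpow_mul, ENNReal.rpow_natCast]
      exact pow_le_pow_left' hw m
  | succ n =>
    intro m a b h
    have h' : SmallShift a ((0 : Fin (n + 1)).removeNth b) := h.del_right 0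
    set b' := (0 : Fin (n + 1)).removeNth b with hb'
    obtain ⟨s₀, s, t, hs₀, hs, ht, hexp⟩ := exists_Dker_cons m n
    -- the constant term
    have hA : BddKer δ (Q ^ (m + (n + 1)) * (m + n + 1 : ℕ) ^ n)
        (fun θ (η : Fin (n + 1) → ℝ) => Dker (cshift a θ) (cshift b' ((0 : Fin (n + 1)).removeNth η))) := by
      have hb := ih n (Nat.lt_succ_self n) m a b' h'
      refine (hb.ignore_right hδ 0).mono ?_
      rw [← add_assoc m n 1, pow_succ Q, mul_right_comm]; gcongr
    -- the terms with a hyperbolic cotangent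
    have hB : ∀ i : Fin m, BddKer δ (Q ^ (m + (n + 1)) * (m + n + 1 : ℕ) ^ n)
        (fun θ (η : Fin (n + 1) → ℝ) => cothHalf (cshift a θ i - cshift b η 0) *
          Dker (del i (cshift a θ)) (cshift b' ((0 : Fin (n + 1)).removeNth η))) := by
      intro i
      cases m with
      | zero => exact i.elim0
      | succ m =>
        have hb := ih n (Nat.lt_succ_self n) m (i.removeNth a) b' (h'.del_left i)
        have hε : a i - b 0 ≠ 0 := sub_ne_zero.2 (h.cross i 0)
        have hε' := abs_sub_le_half_pi (h.left_le i) (h.right_le 0)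
        refine ((hb.coth hδ i 0 hε hε' hH (hcoth _ hε hε')).congr fun θ η => ?_).mono ?_
        · rw [cshift_sub]; rfl
        · calc _ ≤ Q ^ (m + n) * ((m + n + 1 : ℕ) : ℝ≥0∞) ^ n * Q := by gcongr
            _ = Q ^ (m + n + 1) * ((m + n + 1 : ℕ) : ℝ≥0∞) ^ n := by ring
            _ ≤ _ := mul_le_mul' (pow_le_pow_right₀ h1 (by omega))
              (pow_le_pow_left' (by exact_mod_cast (by omega : m + n + 1 ≤ m + 1 + n + 1)) n)
    -- the terms with a hyperbolic tangent
    have hC : ∀ l : Fin n, BddKer δ (Q ^ (m + (n + 1)) * (m + n + 1 : ℕ) ^ n)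
        (fun θ (η : Fin (n + 1) → ℝ) => Complex.tanh ((cshift b η 0 - cshift b η l.succ) / 2) *
          Dker (cshift a θ) (del l (cshift b' ((0 : Fin (n + 1)).removeNth η)))) := by
      intro l
      cases n with
      | zero => exact l.elim0
      | succ n =>
        have hb := ih n (by omega) m a (l.removeNth b') (h'.del_right l)
        refine (hb.tanh hδ l h.right_le).mono ?_
        calc _ ≤ Q ^ (m + n) * ((m + n + 1 : ℕ) : ℝ≥0∞) ^ n * Q * Q := by gcongr
          _ = Q ^ (m + (n + 1 + 1)) * (((m + n + 1 : ℕ) : ℝ≥0∞) ^ n * 1) := by ring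
          _ ≤ _ := by
            rw [pow_succ ((m + (n + 1) + 1 : ℕ) : ℝ≥0∞)]
            gcongr
            · omega
            · exact_mod_cast Nat.le_add_left 1 (m + (n + 1))
    have hsum := ((hA.const_mul hs₀).add hδ (BddKer.sum hδ Finset.univ fun i _ => (hB i).const_mul (hs i))).add hδ
      (BddKer.sum hδ Finset.univ fun l _ => (hC l).const_mul (ht l))
    refine (hsum.congr fun θ η => ?_).mono ?_
    · have hc : cshift b η = Fin.cons (cshift b η 0) (cshift b' ((0 : Fin (n + 1)).removeNth η)) := by
        rw [← Fin.cons_self_tail (cshift b η)]; rfl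
      have := h.generic θ η
      rw [hc] at this
      nth_rewrite 1 [hc]
      rw [hexp _ _ _ this]
      rfl
    -- There are `1 + m + n` terms with a common bound, which raises the exponent of `m + n + 1` by
    -- one.
    · simp only [Finset.sum_const, Finset.card_univ, Fintype.card_fin, nsmul_eq_mul]
      calc _ = Q ^ (m + (n + 1)) * (((m + n + 1 : ℕ) : ℝ≥0∞) ^ n * ((m + n + 1 : ℕ) : ℝ≥0∞)) := by
            push_cast; ring
        _ ≤ _ := by
            rw [← pow_succ]
            gcongr
            omega

/-! ### Boundary values of functions with at most polynomial growth -/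

section BoundaryValue

variable {E : Type*} [NormedAddCommGroup E] [NormedSpace ℝ E] [FiniteDimensional ℝ E]
  [MeasurableSpace E] [BorelSpace E] {ν : Measure E} [ν.IsAddHaarMeasure]

/-- A family of functions whose derivative in the parameter is `i` times the derivative in the
direction `w`. -/
structure ShiftFamily (w : E) (δ : ℝ) (g g' : ℝ → E → ℂ) : Prop where
  cont : ContinuousOn (Function.uncurry g) (Set.Icc 0 δ ×ˢ Set.univ)
  cont' : ContinuousOn (Function.uncurry g') (Set.Ioo 0 δ ×ˢ Set.univ)
  deriv : ∀ s ∈ Set.Ioo 0 δ, ∀ x, HasDerivAt (fun s => g s x) (Complex.I * g' s x) s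
  line : ∀ s ∈ Set.Ioo 0 δ, ∀ x, HasLineDerivAt ℝ (g s) (g' s x) x w

namespace ShiftFamily

variable {w : E} {δ : ℝ} {g g' : ℝ → E → ℂ}

theorem continuous_left (h : ShiftFamily w δ g g') {s : ℝ} (hs : s ∈ Set.Icc 0 δ) : Continuous (g s) := by
  have := h.cont.comp_continuous (f := fun x : E => (s, x)) (by fun_prop) fun x => ⟨hs, trivial⟩
  exact this

theorem continuous_left' (h : ShiftFamily w δ g g') {s : ℝ} (hs : s ∈ Set.Ioo 0 δ) :
    Continuous (g' s) := by
  have := h.cont'.comp_continuous (f := fun x : E => (s, x)) (by fun_prop) fun x => ⟨hs, trivial⟩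
  exact this

theorem continuousOn_integral (h : ShiftFamily w δ g g') {φ : E → ℂ} (hφ : Continuous φ)
    (hc : HasCompactSupport φ) : ContinuousOn (fun s => ∫ x, g s x * φ x ∂ν) (Set.Icc 0 δ) := by
  refine continuousOn_integral_of_compact_support hc.isCompact (h.cont.mul
    (hφ.comp continuous_snd).continuousOn) fun p x _ hx => ?_
  rw [image_eq_zero_of_notMem_tsupport hx, mul_zero]

/-- Differentiate under the integral sign; the derivative in the parameter is `i` times a real
directional derivative, which integration by parts moves to `φ`. -/
theorem hasDerivAt_integral (h : ShiftFamily w δ g g') {φ φ' : E → ℂ} (hφ : Continuous φ)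
    (hφ' : Continuous φ') (hc : HasCompactSupport φ) (hc' : HasCompactSupport φ')
    (hd : ∀ x, HasLineDerivAt ℝ φ (φ' x) x w) {s : ℝ} (hs : s ∈ Set.Ioo 0 δ) :
    HasDerivAt (fun s => ∫ x, g s x * φ x ∂ν) (-Complex.I * ∫ x, g s x * φ' x ∂ν) s := by
  have hi {f ψ : E → ℂ} (hf : Continuous f) (hψ : Continuous ψ) (hcψ : HasCompactSupport ψ) :
      Integrable (fun x => f x * ψ x) ν :=
    (hf.mul hψ).integrable_of_hasCompactSupport hcψ.mul_left
  obtain ⟨r, hr, hrs⟩ := Metric.nhds_basis_closedBall.mem_iff.1 (Ioo_mem_nhds hs.1 hs.2)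
  have hK : IsCompact (Metric.closedBall s r ×ˢ tsupport φ) :=
    (isCompact_closedBall s r).prod hc.isCompact
  obtain ⟨B, hB⟩ := hK.exists_bound_of_continuousOn (h.cont'.mono (Set.prod_mono hrs (Set.subset_univ _)))
  have key := hasDerivAt_integral_of_dominated_loc_of_deriv_le (μ := ν) (𝕜 := ℝ)
    (F := fun s x => g s x * φ x) (F' := fun s x => Complex.I * g' s x * φ x) (x₀ := s)
    (bound := fun x => B * ‖φ x‖)
    (Metric.closedBall_mem_nhds s hr)
    (by
      filter_upwards [Ioo_mem_nhds hs.1 hs.2] with t ht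
      exact (hi (h.continuous_left (Set.Ioo_subset_Icc_self ht)) hφ hc).aestronglyMeasurable)
    (hi (h.continuous_left (Set.Ioo_subset_Icc_self hs)) hφ hc)
    ((hi ((h.continuous_left' hs).const_mul _) hφ hc).aestronglyMeasurable)
    (Eventually.of_forall fun x t ht => by
      by_cases hx : x ∈ tsupport φ
      · have := hB (t, x) ⟨ht, hx⟩
        rw [norm_mul, norm_mul, Complex.norm_I, one_mul]
        exact mul_le_mul_of_nonneg_right this (norm_nonneg _)
      · rw [image_eq_zero_of_notMem_tsupport hx]; simp)
    ((hφ.norm.const_mul B).integrable_of_hasCompactSupport hc.norm.mul_left)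
    (Eventually.of_forall fun x t ht => (h.deriv t (hrs ht) x).mul_const (φ x))
  refine key.2.congr_deriv ?_
  have ibp := integral_bilinear_hasLineDerivAt_right_eq_neg_left_of_integrable (μ := ν)
    (B := ContinuousLinearMap.mul ℝ ℂ) (v := w) (f := g s) (f' := g' s) (g := φ) (g' := φ')
    (hi (h.continuous_left' hs) hφ hc) (hi (h.continuous_left (Set.Ioo_subset_Icc_self hs)) hφ' hc')
    (hi (h.continuous_left (Set.Ioo_subset_Icc_self hs)) hφ hc)
    (fun x _ => h.line s hs x) (fun x _ => hd x)
  simp only [ContinuousLinearMap.mul_apply'] at ibp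
  rw [ibp]
  simp only [mul_assoc]
  rw [integral_const_mul]
  ring

/-- Expansion of the integral at the boundary in terms of integrals in the interior. -/
theorem integral_zero_eq (h : ShiftFamily w δ g g') (hδ : 0 < δ) {φ : ℕ → E → ℂ}
    (hφ : ∀ k, Continuous (φ k)) (hc : ∀ k, HasCompactSupport (φ k))
    (hd : ∀ k x, HasLineDerivAt ℝ (φ k) (φ (k + 1) x) x w) (r : ℕ) :
    ∫ x, g 0 x * φ 0 x ∂ν =
      ∑ k ∈ Finset.range (r + 1), (Complex.I * δ) ^ k / (k.factorial : ℂ) * ∫ x, g δ x * φ k x ∂ν +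
      Complex.I * ∫ s in (0 : ℝ)..δ, (Complex.I * s) ^ r / (r.factorial : ℂ) *
        ∫ x, g s x * φ (r + 1) x ∂ν := by
  -- The Taylor polynomial based at `s`, evaluated at the boundary. Its derivative telescopes to the
  -- single term `ψ'`, so integrating from `0` to `δ` gives the expansion.
  set ψ : ℝ → ℂ := fun s => ∑ k ∈ Finset.range (r + 1), (Complex.I * s) ^ k / (k.factorial : ℂ) *
    ∫ x, g s x * φ k x ∂ν with hψ
  set ψ' : ℝ → ℂ := fun s => -Complex.I * ((Complex.I * s) ^ r / (r.factorial : ℂ) *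
        ∫ x, g s x * φ (r + 1) x ∂ν) with hψ'
  have hI (k : ℕ) := h.continuousOn_integral (ν := ν) (hφ k) (hc k)
  have hcont : ContinuousOn ψ (Set.Icc 0 δ) := by
    refine continuousOn_finsetSum _ fun k _ => ContinuousOn.mul ?_ (hI k)
    exact Continuous.continuousOn (by fun_prop)
  have hcont' : ContinuousOn ψ' (Set.Icc 0 δ) := by
    refine ContinuousOn.mul continuousOn_const (ContinuousOn.mul ?_ (hI _))
    exact Continuous.continuousOn (by fun_prop)
  have hder : ∀ s ∈ Set.Ioo 0 δ, HasDerivAt ψ (ψ' s) s := by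
    intro s hs
    have hD (k : ℕ) := h.hasDerivAt_integral (ν := ν) (hφ k) (hφ (k + 1)) (hc k) (hc (k + 1)) (hd k) hs
    have hp (k : ℕ) : HasDerivAt (fun s : ℝ => (Complex.I * s) ^ k / (k.factorial : ℂ))
        (k * (Complex.I * s) ^ (k - 1) * (Complex.I * 1) / (k.factorial : ℂ)) s := by
      have h1 : HasDerivAt (fun s : ℝ => Complex.I * (s : ℂ)) (Complex.I * 1) s :=
        (Complex.ofRealCLM.hasDerivAt (x := s)).const_mul _
      exact (h1.pow k).div_const _
    have hsum := HasDerivAt.fun_sum (u := Finset.range (r + 1)) fun k _ => (hp k).mul (hD k)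
    refine hsum.congr_deriv ?_
    clear_value ψ ψ'
    subst hψ'
    clear hsum hp hD hψ hcont hcont' hI
    simp only
    -- What remains is an algebraic identity for an arbitrary sequence `J`, proved by induction on
    -- `r`.
    generalize hJ : (fun k => ∫ x, g s x * φ k x ∂ν) = J
    have hJ' (k : ℕ) : ∫ x, g s x * φ k x ∂ν = J k := congrFun hJ k
    simp only [hJ']
    clear hJ hJ'
    induction r with
    | zero => simp
    | succ r ih =>
      rw [Finset.sum_range_succ, ih]
      have h1 : ((r + 1).factorial : ℂ) ≠ 0 := by exact_mod_cast (r + 1).factorial_ne_zero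
      have h2 : (r.factorial : ℂ) ≠ 0 := by exact_mod_cast r.factorial_ne_zero
      have h3 : ((r + 1).factorial : ℂ) = (r + 1) * r.factorial := by
        rw [Nat.factorial_succ]; push_cast; ring
      have h4 : (r + 1 : ℂ) ≠ 0 := by exact_mod_cast r.succ_ne_zero
      simp only [h3, Nat.add_sub_cancel]
      push_cast
      field_simp
      ring
  have hftc := intervalIntegral.integral_eq_sub_of_hasDerivAt_of_le hδ.le hcont hder
    (hcont'.intervalIntegrable_of_Icc hδ.le)
  have h0 : ψ 0 = ∫ x, g 0 x * φ 0 x ∂ν := by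
    rw [hψ]
    simp only [Finset.sum_range_succ']
    simp
  rw [hψ', intervalIntegral.integral_const_mul, eq_sub_iff_add_eq] at hftc
  rw [← h0]
  change _ = ψ δ + _
  rw [← hftc]
  ring

end ShiftFamily

end BoundaryValue

section BoundaryValue

variable {E : Type*} [NormedAddCommGroup E] [NormedSpace ℝ E] [FiniteDimensional ℝ E]
  [MeasurableSpace E] [BorelSpace E]

/-- The iterated derivatives of a test function in the direction `w`. -/
noncomputable def iterLine (w : E) (k : ℕ) :
    𝓓((⊤ : TopologicalSpace.Opens E), ℂ) →L[ℂ] 𝓓((⊤ : TopologicalSpace.Opens E), ℂ) :=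
  (TestFunction.lineDerivCLM ℂ w) ^ k

theorem iterLine_zero (w : E) (φ : 𝓓((⊤ : TopologicalSpace.Opens E), ℂ)) : iterLine w 0 φ = φ := rfl

theorem iterLine_succ_apply (w : E) (k : ℕ) (φ : 𝓓((⊤ : TopologicalSpace.Opens E), ℂ)) (x : E) :
    iterLine w (k + 1) φ x = lineDeriv ℝ (iterLine w k φ) x w := by
  rw [iterLine, pow_succ']
  exact TestFunction.lineDerivCLM_apply_of_le (by simp)

theorem hasLineDerivAt_iterLine (w : E) (k : ℕ) (φ : 𝓓((⊤ : TopologicalSpace.Opens E), ℂ)) (x : E) :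
    HasLineDerivAt ℝ (iterLine w k φ) (iterLine w (k + 1) φ x) x w := by
  rw [iterLine_succ_apply]
  exact (((iterLine w k φ).contDiff.differentiable (by simp)) x).lineDifferentiableAt.hasLineDerivAt

theorem tsupport_iterLine_subset (w : E) (k : ℕ) (φ : 𝓓((⊤ : TopologicalSpace.Opens E), ℂ)) :
    tsupport (iterLine w k φ) ⊆ tsupport φ := by
  induction k with
  | zero => exact subset_rfl
  | succ k ih =>
    refine (closure_minimal ?_ (isClosed_tsupport _)).trans ih
    intro x hx
    by_contra hx'
    apply hx
    rw [iterLine_succ_apply, ((iterLine w k φ).contDiff.differentiable (by simp) x).lineDeriv_eq_fderiv]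
    have : x ∉ Function.support (fderiv ℝ (iterLine w k φ)) := fun h => hx' (support_fderiv_subset ℝ h)
    rw [Function.notMem_support.1 this]; rfl

variable {ν : Measure E} [ν.IsAddHaarMeasure]

theorem norm_integral_mul_le_of_support {K : Set E} (hK : IsCompact K) {f φ : E → ℂ} {A M : ℝ}
    (hf : ∀ x ∈ K, ‖f x‖ ≤ A) (hφ : ∀ x, ‖φ x‖ ≤ M) (hs : ∀ x ∉ K, φ x = 0) :
    ‖∫ x, f x * φ x ∂ν‖ ≤ A * M * ν.real K := by
  rw [← setIntegral_eq_integral_of_forall_compl_eq_zero (s := K) fun x hx => by rw [hs x hx, mul_zero]]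
  refine norm_setIntegral_le_of_norm_le_const hK.measure_lt_top fun x hx => ?_
  rw [norm_mul]
  exact mul_le_mul (hf x hx) (hφ x) (norm_nonneg _) ((norm_nonneg _).trans (hf x hx))

/-- A priori bound of the integral at the boundary by derivatives of the test function. -/
theorem ShiftFamily.norm_integral_zero_le {w : E} {δ : ℝ} {g g' : ℝ → E → ℂ} (h : ShiftFamily w δ g g')
    (hδ : 0 < δ) {K : Set E} (hK : IsCompact K) {r : ℕ} {C : ℝ}
    (hC : ∀ s ∈ Set.Ioc 0 δ, ∀ x ∈ K, ‖g s x‖ * s ^ r ≤ C)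
    (φ : 𝓓((⊤ : TopologicalSpace.Opens E), ℂ)) (hφ : tsupport φ ⊆ K) {M : ℝ}
    (hM : ∀ k < r + 2, ∀ x, ‖iterLine w k φ x‖ ≤ M) :
    ‖∫ x, g 0 x * φ x ∂ν‖ ≤
      ((∑ k ∈ Finset.range (r + 1), δ ^ k / (δ ^ r)) + δ) * (C * ν.real K) * M := by
  rw [← iterLine_zero w φ, h.integral_zero_eq hδ (φ := fun k => iterLine w k φ)
    (fun k => (iterLine w k φ).continuous) (fun k => (iterLine w k φ).hasCompactSupport)
    (fun k x => hasLineDerivAt_iterLine w k φ x) r]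
  have hfac (k : ℕ) : ‖(k.factorial : ℂ)‖⁻¹ ≤ 1 := by
    rw [Complex.norm_natCast]
    exact inv_le_one_of_one_le₀ (by exact_mod_cast k.factorial_pos)
  have hb (s : ℝ) (hs : s ∈ Set.Ioc 0 δ) (k : ℕ) (hk : k < r + 2) :
      ‖∫ x, g s x * iterLine w k φ x ∂ν‖ ≤ C / s ^ r * M * ν.real K := by
    refine norm_integral_mul_le_of_support hK (fun x hx => ?_) (hM k hk) fun x hx => ?_
    · rw [le_div_iff₀ (pow_pos hs.1 r)]; exact hC s hs x hx
    · exact image_eq_zero_of_notMem_tsupport fun h' => hx (hφ (tsupport_iterLine_subset w k φ h'))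
  refine (norm_add_le _ _).trans ?_
  rw [add_mul, add_mul, Finset.sum_mul, Finset.sum_mul]
  refine add_le_add ((norm_sum_le _ _).trans (Finset.sum_le_sum fun k hk => ?_)) ?_
  · have hk' := hb δ ⟨hδ, le_rfl⟩ k (by rw [Finset.mem_range] at hk; omega)
    rw [norm_mul, norm_div, norm_pow, norm_mul, Complex.norm_I, one_mul, Complex.norm_real,
      Real.norm_of_nonneg hδ.le, div_eq_mul_inv, mul_assoc]
    calc _ ≤ δ ^ k * (1 * (C / δ ^ r * M * ν.real K)) := by
          refine mul_le_mul_of_nonneg_left ?_ (by positivity)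
          exact mul_le_mul (hfac k) hk' (norm_nonneg _) zero_le_one
      _ = _ := by ring
  · rw [norm_mul, Complex.norm_I, one_mul]
    refine (intervalIntegral.norm_integral_le_of_norm_le_const (C := C * ν.real K * M) fun s hs => ?_).trans
      (le_of_eq ?_)
    · rw [Set.uIoc_of_le hδ.le] at hs
      have hs' := hb s hs (r + 1) (by omega)
      rw [norm_mul, norm_div, norm_pow, norm_mul, Complex.norm_I, one_mul, Complex.norm_real,
        Real.norm_of_nonneg hs.1.le, div_eq_mul_inv, mul_assoc]
      -- The order `r` of the expansion is chosen so that the factor `s^r` of the remainder cancels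
      -- the growth `s^(-r)` of the function.
      have hsr : s ^ r ≠ 0 := (pow_pos hs.1 r).ne'
      calc _ ≤ s ^ r * (1 * (C / s ^ r * M * ν.real K)) := by
            refine mul_le_mul_of_nonneg_left ?_ (pow_pos hs.1 r).le
            exact mul_le_mul (hfac r) hs' (norm_nonneg _) zero_le_one
        _ = _ := by field_simp
    · rw [sub_zero, abs_of_pos hδ]; ring

/-- The expansion rewrites the integral at parameter zero in terms of integrals at positive
parameter, which converge by dominated convergence. In the remainder `s^r` compensates the
singularity, so the outer integral is dominated by a constant. -/
theorem exists_tendsto_integral {ι : Type*} {l : Filter ι} [l.IsCountablyGenerated] {w : E} {δ : ℝ}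
    (hδ : 0 < δ) {g g' : ι → ℝ → E → ℂ} (hg : ∀ᶠ i in l, ShiftFamily w δ (g i) (g' i))
    {G : ℝ → E → ℂ} (hlim : ∀ s ∈ Set.Ioc 0 δ, ∀ x, Tendsto (fun i => g i s x) l (𝓝 (G s x)))
    {K : Set E} (hK : IsCompact K) {r : ℕ} {C : ℝ}
    (hC : ∀ᶠ i in l, ∀ s ∈ Set.Ioc 0 δ, ∀ x ∈ K, ‖g i s x‖ * s ^ r ≤ C)
    (φ : 𝓓((⊤ : TopologicalSpace.Opens E), ℂ)) (hφ : tsupport φ ⊆ K) :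
    ∃ a, Tendsto (fun i => ∫ x, g i 0 x * φ x ∂ν) l (𝓝 a) := by
  have hz (k : ℕ) (x : E) (hx : x ∉ K) : iterLine w k φ x = 0 :=
    image_eq_zero_of_notMem_tsupport fun h' => hx (hφ (tsupport_iterLine_subset w k φ h'))
  have h1 (s : ℝ) (hs : s ∈ Set.Ioc 0 δ) (k : ℕ) : Tendsto (fun i => ∫ x, g i s x * iterLine w k φ x ∂ν) l
      (𝓝 (∫ x, G s x * iterLine w k φ x ∂ν)) := by
    refine tendsto_integral_filter_of_dominated_convergence (fun x => C / s ^ r * ‖iterLine w k φ x‖)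
      ?_ ?_ ?_ ?_
    · filter_upwards [hg] with i hi
      exact ((hi.continuous_left (Set.Ioc_subset_Icc_self hs)).mul
        (iterLine w k φ).continuous).aestronglyMeasurable
    · filter_upwards [hC] with i hi
      refine Eventually.of_forall fun x => ?_
      by_cases hx : x ∈ K
      · rw [norm_mul]
        refine mul_le_mul_of_nonneg_right ?_ (norm_nonneg _)
        rw [le_div_iff₀ (pow_pos hs.1 r)]; exact hi s hs x hx
      · rw [hz k x hx]; simp
    · exact ((iterLine w k φ).continuous.norm.const_mul _).integrable_of_hasCompactSupport
        (iterLine w k φ).hasCompactSupport.norm.mul_left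
    · exact Eventually.of_forall fun x => (hlim s hs x).mul_const _
  obtain ⟨M, hM⟩ := (iterLine w (r + 1) φ).hasCompactSupport.exists_bound_of_continuous
    (iterLine w (r + 1) φ).continuous
  have h2 : Tendsto (fun i => ∫ s in (0 : ℝ)..δ, (Complex.I * s) ^ r / (r.factorial : ℂ) *
        ∫ x, g i s x * iterLine w (r + 1) φ x ∂ν) l (𝓝 (∫ s in (0 : ℝ)..δ, (Complex.I * s) ^ r /
          (r.factorial : ℂ) * ∫ x, G s x * iterLine w (r + 1) φ x ∂ν)) := by
    refine intervalIntegral.tendsto_integral_filter_of_dominated_convergence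
      (fun _ => C * M * ν.real K) ?_ ?_ intervalIntegrable_const ?_
    · filter_upwards [hg] with i hi
      refine ContinuousOn.aestronglyMeasurable ?_ measurableSet_uIoc
      rw [Set.uIoc_of_le hδ.le]
      refine ContinuousOn.mul (Continuous.continuousOn (by fun_prop)) ?_
      exact (hi.continuousOn_integral (iterLine w (r + 1) φ).continuous
        (iterLine w (r + 1) φ).hasCompactSupport).mono Set.Ioc_subset_Icc_self
    · filter_upwards [hC] with i hi
      refine Eventually.of_forall fun s hs => ?_
      rw [Set.uIoc_of_le hδ.le] at hs
      have hb : ‖∫ x, g i s x * iterLine w (r + 1) φ x ∂ν‖ ≤ C / s ^ r * M * ν.real K :=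
        norm_integral_mul_le_of_support hK (fun x hx => by
          rw [le_div_iff₀ (pow_pos hs.1 r)]; exact hi s hs x hx) hM (hz (r + 1))
      have hfac : ‖(r.factorial : ℂ)‖⁻¹ ≤ 1 := by
        rw [Complex.norm_natCast]
        exact inv_le_one_of_one_le₀ (by exact_mod_cast r.factorial_pos)
      rw [norm_mul, norm_div, norm_pow, norm_mul, Complex.norm_I, one_mul, Complex.norm_real,
        Real.norm_of_nonneg hs.1.le, div_eq_mul_inv, mul_assoc]
      have hsr : s ^ r ≠ 0 := (pow_pos hs.1 r).ne'
      calc _ ≤ s ^ r * (1 * (C / s ^ r * M * ν.real K)) := by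
            refine mul_le_mul_of_nonneg_left ?_ (pow_pos hs.1 r).le
            exact mul_le_mul hfac hb (norm_nonneg _) zero_le_one
        _ = _ := by field_simp
    · refine Eventually.of_forall fun s hs => ?_
      rw [Set.uIoc_of_le hδ.le] at hs
      exact (h1 s hs (r + 1)).const_mul _
  refine ⟨_, ((tendsto_finsetSum (Finset.range (r + 1)) fun k _ => (h1 δ ⟨hδ, le_rfl⟩ k).const_mul
    ((Complex.I * δ) ^ k / (k.factorial : ℂ))).add (h2.const_mul Complex.I)).congr' ?_⟩
  filter_upwards [hg] with i hi
  exact (hi.integral_zero_eq hδ (φ := fun k => iterLine w k φ)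
    (fun k => (iterLine w k φ).continuous) (fun k => (iterLine w k φ).hasCompactSupport)
    (fun k x => hasLineDerivAt_iterLine w k φ x) r).symm

/-- The boundary value of a family with polynomial growth at the boundary exists as a distribution. -/
theorem exists_boundary_distribution {ι : Type*} {l : Filter ι} [l.IsCountablyGenerated] [l.NeBot] {w : E}
    {δ : ℝ} (hδ : 0 < δ) {g g' : ι → ℝ → E → ℂ} (hg : ∀ᶠ i in l, ShiftFamily w δ (g i) (g' i))
    {G : ℝ → E → ℂ} (hlim : ∀ s ∈ Set.Ioc 0 δ, ∀ x, Tendsto (fun i => g i s x) l (𝓝 (G s x)))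
    {r : ℕ} (hC : ∀ K : Set E, IsCompact K → ∃ C : ℝ, ∀ᶠ i in l, ∀ s ∈ Set.Ioc 0 δ, ∀ x ∈ K,
      ‖g i s x‖ * s ^ r ≤ C) :
    ∃ f : 𝓓((⊤ : TopologicalSpace.Opens E), ℂ) →L[ℂ] ℂ, ∀ φ,
      Tendsto (fun i => ∫ x, g i 0 x * φ x ∂ν) l (𝓝 (f φ)) := by
  have hex (φ : 𝓓((⊤ : TopologicalSpace.Opens E), ℂ)) :
      ∃ a, Tendsto (fun i => ∫ x, g i 0 x * φ x ∂ν) l (𝓝 a) := by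
    obtain ⟨C, hC⟩ := hC _ φ.hasCompactSupport.isCompact
    exact exists_tendsto_integral hδ hg hlim φ.hasCompactSupport.isCompact hC φ subset_rfl
  choose L hL using hex
  have h0 : (0 : ℝ) ∈ Set.Icc 0 δ := ⟨le_rfl, hδ.le⟩
  have hadd (φ ψ) : L (φ + ψ) = L φ + L ψ := by
    refine tendsto_nhds_unique (hL (φ + ψ)) (((hL φ).add (hL ψ)).congr' ?_)
    filter_upwards [hg] with i hi
    rw [← integral_add]
    · simp only [← mul_add]; rfl
    · exact ((hi.continuous_left h0).mul φ.continuous).integrable_of_hasCompactSupport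
        φ.hasCompactSupport.mul_left
    · exact ((hi.continuous_left h0).mul ψ.continuous).integrable_of_hasCompactSupport
        ψ.hasCompactSupport.mul_left
  have hsmul (c : ℂ) (φ) : L (c • φ) = c • L φ := by
    refine tendsto_nhds_unique (hL (c • φ)) (((hL φ).const_mul c).congr' ?_)
    filter_upwards with i
    rw [← integral_const_mul]
    refine integral_congr_ae (Eventually.of_forall fun x => ?_)
    change c * (g i 0 x * φ x) = g i 0 x * (c * φ x)
    ring
  refine ⟨TestFunction.mkCLM ℂ L hadd hsmul fun K hKs => ?_, hL⟩
  obtain ⟨C, hC⟩ := hC K K.isCompact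
  -- Continuity is checked on test functions supported in a fixed compact set `K`, where the limit
  -- inherits a bound by finitely many derivatives that does not depend on the index `i`.
  set A : ℝ := ((∑ k ∈ Finset.range (r + 1), δ ^ k / (δ ^ r)) + δ) * (C * ν.real (K : Set E))
  set J : 𝓓^{⊤}_{K}(E, ℂ) →ₗ[ℂ] ℂ :=
    { toFun := fun φ => L (TestFunction.ofSupportedIn hKs φ)
      map_add' := fun φ ψ => hadd (TestFunction.ofSupportedIn hKs φ) (TestFunction.ofSupportedIn hKs ψ)
      map_smul' := fun c φ => hsmul c (TestFunction.ofSupportedIn hKs φ) } with hJ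
  have hbound (φ : 𝓓^{⊤}_{K}(E, ℂ)) : ‖J φ‖ ≤ A * ∑ k ∈ Finset.range (r + 2),
      ‖TestFunction.toBoundedContinuousFunctionCLM ℂ (iterLine w k (TestFunction.ofSupportedIn hKs φ))‖ := by
    refine le_of_tendsto (hL _).norm ?_
    filter_upwards [hg, hC] with i hi hCi
    refine hi.norm_integral_zero_le hδ K.isCompact hCi _ φ.tsupport_subset fun k hk x => ?_
    refine ((TestFunction.toBoundedContinuousFunctionCLM ℂ
      (iterLine w k (TestFunction.ofSupportedIn hKs φ))).norm_coe_le_norm x).trans ?_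
    exact Finset.single_le_sum (f := fun k => ‖TestFunction.toBoundedContinuousFunctionCLM ℂ
      (iterLine w k (TestFunction.ofSupportedIn hKs φ))‖) (fun _ _ => norm_nonneg _) (Finset.mem_range.2 hk)
  have hcont : Continuous fun φ : 𝓓^{⊤}_{K}(E, ℂ) => A * ∑ k ∈ Finset.range (r + 2),
      ‖TestFunction.toBoundedContinuousFunctionCLM ℂ (iterLine w k (TestFunction.ofSupportedIn hKs φ))‖ := by
    refine continuous_const.mul (continuous_finsetSum _ fun k _ => Continuous.norm ?_)
    exact (TestFunction.toBoundedContinuousFunctionCLM ℂ).continuous.comp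
      ((iterLine w k).continuous.comp (TestFunction.continuous_ofSupportedIn hKs))
  change Continuous J
  refine continuous_of_continuousAt_zero J ?_
  rw [ContinuousAt, map_zero, tendsto_zero_iff_norm_tendsto_zero]
  refine squeeze_zero (fun _ => norm_nonneg _) hbound ?_
  have := hcont.tendsto 0
  refine this.trans (le_of_eq ?_)
  congr 1
  have e : TestFunction.ofSupportedIn hKs (0 : 𝓓^{⊤}_{K}(E, ℂ)) = 0 := rfl
  simp only [e, map_zero, norm_zero, Finset.sum_const_zero, mul_zero]

end BoundaryValue

/-! ### Holomorphy of the factors of `F`. -/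

theorem contDiff_one_integral_of_compact {H Y : Type*} [NormedAddCommGroup H] [NormedSpace ℂ H]
    [ProperSpace H] [TopologicalSpace Y] [MeasurableSpace Y] [OpensMeasurableSpace Y] {ν : Measure Y}
    [SecondCountableTopologyEither Y ℂ] [SecondCountableTopologyEither Y (H →L[ℂ] ℂ)]
    [IsFiniteMeasureOnCompacts ν] {f : H → Y → ℂ} {f' : H → Y → H →L[ℂ] ℂ} {k : Set Y} (hk : IsCompact k)
    (hkm : MeasurableSet k)
    (hf : Continuous (Function.uncurry f)) (hf' : Continuous (Function.uncurry f'))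
    (h0 : ∀ p, ∀ x ∉ k, f p x = 0) (h0' : ∀ p, ∀ x ∉ k, f' p x = 0)
    (hd : ∀ p x, HasFDerivAt (fun p => f p x) (f' p x) p) :
    ContDiff ℂ 1 (fun p => ∫ x, f p x ∂ν) := by
  have hc (p) : Continuous (f p) := hf.comp (by fun_prop : Continuous fun x => (p, x))
  have hc' (p) : Continuous (f' p) := hf'.comp (by fun_prop : Continuous fun x => (p, x))
  refine contDiff_one_iff_hasFDerivAt.2 ⟨fun p => ∫ x, f' p x ∂ν, ?_, fun p => ?_⟩
  · rw [← continuousOn_univ]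
    exact continuousOn_integral_of_compact_support hk hf'.continuousOn fun p x _ hx => h0' p x hx
  · have hK : IsCompact (Metric.closedBall p 1 ×ˢ k) := (isCompact_closedBall p 1).prod hk
    obtain ⟨B, hB⟩ := hK.exists_bound_of_continuousOn hf'.continuousOn
    refine hasFDerivAt_integral_of_dominated_of_fderiv_le (bound := k.indicator fun _ => B)
      (Metric.closedBall_mem_nhds p one_pos) (Eventually.of_forall fun q => (hc q).aestronglyMeasurable)
      ?_ (hc' p).aestronglyMeasurable (Eventually.of_forall fun x q hq => ?_)
      ((integrable_indicator_iff hkm).2 (integrableOn_const hk.measure_ne_top)) (Eventually.of_forall fun x q _ => hd q x)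
    · refine (integrableOn_iff_integrable_of_support_subset (s := k) fun x hx => ?_).1
        ((hc p).continuousOn.integrableOn_compact' hk hkm)
      by_contra hx'
      exact hx (h0 p x hx')
    · by_cases hx : x ∈ k
      · rw [Set.indicator_of_mem hx]; exact hB (q, x) ⟨hq, hx⟩
      · rw [Set.indicator_of_notMem hx, h0' q x hx, norm_zero]

theorem contDiff_fourierMink {g : ℝ × ℝ → ℂ} (hg : Continuous g) (hc : HasCompactSupport g) :
    ContDiff ℂ 1 (fourierMink g) := by
  set f : ℂ × ℂ → ℝ × ℝ → ℂ := fun p x => Complex.exp (Complex.I * (p.1 * x.1 - p.2 * x.2)) * g x with hf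
  set D : ℝ × ℝ → ℂ × ℂ →L[ℂ] ℂ := fun x =>
    Complex.I • ((x.1 : ℂ) • ContinuousLinearMap.fst ℂ ℂ ℂ - (x.2 : ℂ) • ContinuousLinearMap.snd ℂ ℂ ℂ) with hD
  have hcf : Continuous (Function.uncurry f) := by
    change Continuous fun q : (ℂ × ℂ) × (ℝ × ℝ) =>
      Complex.exp (Complex.I * (q.1.1 * q.2.1 - q.1.2 * q.2.2)) * g q.2
    fun_prop
  have hcD : Continuous D := by
    have h1 : Continuous fun x : ℝ × ℝ => (x.1 : ℂ) := by fun_prop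
    have h2 : Continuous fun x : ℝ × ℝ => (x.2 : ℂ) := by fun_prop
    exact ((h1.smul (continuous_const (y := ContinuousLinearMap.fst ℂ ℂ ℂ))).sub
      (h2.smul (continuous_const (y := ContinuousLinearMap.snd ℂ ℂ ℂ)))).const_smul Complex.I
  have h0 (p : ℂ × ℂ) (x : ℝ × ℝ) (hx : x ∉ tsupport g) : f p x = 0 := by
    rw [hf]; simp only [image_eq_zero_of_notMem_tsupport hx, mul_zero]
  have hd (p : ℂ × ℂ) (x : ℝ × ℝ) : HasFDerivAt (fun p => f p x) (f p x • D x) p := by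
    have h1 : HasFDerivAt (fun p : ℂ × ℂ => Complex.I * (p.1 * (x.1 : ℂ) - p.2 * (x.2 : ℂ))) (D x) p :=
      (((hasFDerivAt_fst).mul_const _).sub ((hasFDerivAt_snd).mul_const _)).const_mul _
    refine (h1.cexp.mul_const (g x)).congr_fderiv ?_
    rw [smul_smul, mul_comm]
  have key : ContDiff ℂ 1 (fun p => ∫ x, f p x) :=
    contDiff_one_integral_of_compact (f' := fun p x => f p x • D x)
      hc.isCompact (isClosed_tsupport g).measurableSet hcf (hcf.smul (hcD.comp continuous_snd)) h0
      (fun p x hx => by simp only [h0 p x hx]; exact zero_smul ℂ (D x)) hd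
  exact contDiff_const.mul key

theorem contDiff_momentum (μ : ℝ) {k : ℕ} {n : WithTop ℕ∞} : ContDiff ℂ n (momentum μ : (Fin k → ℂ) → ℂ × ℂ) := by
  refine ContDiff.prodMk ?_ ?_
  · exact ContDiff.sum fun j _ => contDiff_const.mul (Complex.contDiff_cosh.comp (contDiff_apply ℂ ℂ j))
  · exact ContDiff.sum fun j _ => contDiff_const.mul (Complex.contDiff_sinh.comp (contDiff_apply ℂ ℂ j))

theorem LaurentSymm.eval_C {n : ℕ} (a : ℂ) (x : Fin n → ℂ) : LaurentSymm.eval (MvPolynomial.C a) x = a := by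
  simp [LaurentSymm.eval]

theorem LaurentSymm.eval_add {n : ℕ} (P Q : LaurentSymm) (x : Fin n → ℂ) :
    LaurentSymm.eval (P + Q) x = P.eval x + Q.eval x := map_add _ P Q

theorem LaurentSymm.eval_mul {n : ℕ} (P Q : LaurentSymm) (x : Fin n → ℂ) :
    LaurentSymm.eval (P * Q) x = P.eval x * Q.eval x := map_mul _ P Q

theorem LaurentSymm.eval_X {n : ℕ} (k : {k : ℤ // k ≠ 0}) (x : Fin n → ℂ) :
    LaurentSymm.eval (MvPolynomial.X k) x = ∑ j, x j ^ (k : ℤ) := by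
  simp [LaurentSymm.eval]

theorem contDiff_eval_exp (P : LaurentSymm) {k : ℕ} {n : WithTop ℕ∞} :
    ContDiff ℂ n (fun ζ : Fin k → ℂ => P.eval fun i => Complex.exp (ζ i)) := by
  induction P using MvPolynomial.induction_on with
  | C a => simp only [LaurentSymm.eval_C]; exact contDiff_const
  | add P Q hP hQ => simp only [LaurentSymm.eval_add]; exact hP.add hQ
  | mul_X P l hP =>
    simp only [LaurentSymm.eval_mul, LaurentSymm.eval_X, ← Complex.exp_int_mul]
    exact hP.mul (ContDiff.sum fun j _ => (contDiff_const.mul (contDiff_apply ℂ ℂ j)).cexp)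

/-! ### The neighbourhood of the upper node and existence of the boundary value. -/

/-- The tube on which the imaginary parts differ by less than `π`. -/
def tube (N : ℕ) : Set (Fin N → ℂ) := {ζ | ∀ i j, |(ζ i - ζ j).im| < Real.pi}

theorem isOpen_tube (N : ℕ) : IsOpen (tube N) := by
  simp only [tube, Set.ofPred_forall]
  refine isOpen_iInter_of_finite fun i => isOpen_iInter_of_finite fun j => ?_
  exact isOpen_lt (by fun_prop) continuous_const

theorem cosh_ne_zero_of_abs_im_lt {z : ℂ} (hz : |z.im| < Real.pi / 2) : Complex.cosh z ≠ 0 := by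
  have h : (Complex.cosh z).re = Real.cosh z.re * Real.cos z.im := by
    conv_lhs => rw [← Complex.re_add_im z, Complex.cosh_add, Complex.cosh_mul_I, Complex.sinh_mul_I]
    rw [← Complex.ofReal_cosh, ← Complex.ofReal_sinh, ← Complex.ofReal_cos, ← Complex.ofReal_sin, ← mul_assoc,
      ← Complex.ofReal_mul, ← Complex.ofReal_mul, Complex.add_re, Complex.ofReal_re, Complex.re_ofReal_mul,
      Complex.I_re, mul_zero, add_zero]
  intro h0
  rw [h0, Complex.zero_re] at h
  exact (mul_pos (Real.cosh_pos _) (Real.cos_pos_of_mem_Ioo (abs_lt.1 hz))).ne h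

theorem contDiffOn_Modd {N : ℕ} {n : WithTop ℕ∞} : ContDiffOn ℂ n (Modd : (Fin N → ℂ) → ℂ) (tube N) := by
  refine contDiffOn_prod fun i _ => contDiffOn_prod fun j _ => ?_
  simp only [Complex.tanh_eq_sinh_div_cosh]
  have h : ContDiff ℂ n fun ζ : Fin N → ℂ => (ζ i - ζ j) / 2 :=
    ((contDiff_apply ℂ ℂ i).sub (contDiff_apply ℂ ℂ j)).div_const 2
  refine (Complex.contDiff_sinh.comp h).contDiffOn.div (Complex.contDiff_cosh.comp h).contDiffOn fun ζ hζ => ?_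
  refine cosh_ne_zero_of_abs_im_lt ?_
  have e : (ζ i - ζ j) / 2 = (ζ i - ζ j) / ((2 : ℝ) : ℂ) := by norm_num
  rw [e, Complex.div_ofReal_im, abs_div, abs_two]
  exact div_lt_div_of_pos_right (hζ i j) two_pos

/-- The complex point with real parts `x` and imaginary parts `l`. -/
noncomputable def cpoint {m n : ℕ} (l : Fin (m + n) → ℝ) (x : (Fin m → ℝ) × (Fin n → ℝ)) : Fin (m + n) → ℂ :=
  fun j => ((Fin.append x.1 x.2 j : ℝ) : ℂ) + Complex.I * (l j : ℂ)

/-- The direction of the left variables. -/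
def leftDir (m n : ℕ) : Fin (m + n) → ℝ := Fin.append (fun _ => 1) (fun _ => 0)

theorem continuous_append {m n : ℕ} (j : Fin (m + n)) :
    Continuous fun x : (Fin m → ℝ) × (Fin n → ℝ) => Fin.append x.1 x.2 j := by
  induction j using Fin.addCases with
  | left i => simp only [Fin.append_left]; fun_prop
  | right i => simp only [Fin.append_right]; fun_prop

theorem continuous_cpoint {m n : ℕ} :
    Continuous fun p : (Fin (m + n) → ℝ) × ((Fin m → ℝ) × (Fin n → ℝ)) => cpoint p.1 p.2 := by
  refine continuous_pi fun j => ?_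
  have := (continuous_append (m := m) (n := n) j).comp (continuous_snd (X := Fin (m + n) → ℝ))
  simp only [cpoint]
  exact (Complex.continuous_ofReal.comp this).add (by fun_prop)

/-- The shift parameter moves the left variables in the imaginary direction; by complex linearity of
the derivative this is `i` times the real directional derivative. -/
theorem shiftFamily_of_contDiffOn {m n : ℕ} {U : Set (Fin (m + n) → ℂ)} (hU : IsOpen U)
    {G : (Fin (m + n) → ℂ) → ℂ} (hG : ContDiffOn ℂ 1 G U) {δ : ℝ} {l : Fin (m + n) → ℝ}
    (hl : ∀ s ∈ Set.Icc 0 δ, ∀ x : (Fin m → ℝ) × (Fin n → ℝ), cpoint (l + s • leftDir m n) x ∈ U) :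
    ShiftFamily (((fun _ => 1), (fun _ => 0)) : (Fin m → ℝ) × (Fin n → ℝ)) δ
      (fun s x => G (cpoint (l + s • leftDir m n) x))
      (fun s x => fderiv ℂ G (cpoint (l + s • leftDir m n) x) (fun j => (leftDir m n j : ℂ))) := by
  have hA : Continuous fun p : ℝ × ((Fin m → ℝ) × (Fin n → ℝ)) => cpoint (l + p.1 • leftDir m n) p.2 :=
    continuous_cpoint.comp (f := fun p : ℝ × ((Fin m → ℝ) × (Fin n → ℝ)) => (l + p.1 • leftDir m n, p.2))
      (by fun_prop)
  have hf (s) (hs : s ∈ Set.Ioo 0 δ) (x) := ((hG.contDiffAt (hU.mem_nhds (hl s (Set.Ioo_subset_Icc_self hs) x))).differentiableAt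
    one_ne_zero).hasFDerivAt
  refine ⟨?_, ?_, fun s hs x => ?_, fun s hs x => ?_⟩
  · exact hG.continuousOn.comp hA.continuousOn fun p hp => hl _ hp.1 _
  · exact ((hG.continuousOn_fderiv_of_isOpen hU le_rfl).comp hA.continuousOn fun p hp =>
      hl _ (Set.Ioo_subset_Icc_self hp.1) _).clm_apply continuousOn_const
  · have h1 : HasDerivAt (fun s : ℝ => cpoint (l + s • leftDir m n) x)
        (Complex.I • fun j => (leftDir m n j : ℂ)) s := by
      refine hasDerivAt_pi.2 fun j => ?_
      have h2 : HasDerivAt (fun s : ℝ => ((l j + s * leftDir m n j : ℝ) : ℂ)) ((1 * leftDir m n j : ℝ) : ℂ) s :=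
        (((hasDerivAt_id s).mul_const _).const_add _).ofReal_comp
      have h3 := (h2.const_mul Complex.I).const_add ((Fin.append x.1 x.2 j : ℝ) : ℂ)
      rw [one_mul] at h3
      exact h3
    have := ((hf s hs x).restrictScalars ℝ).comp_hasDerivAt s h1
    rw [ContinuousLinearMap.coe_restrictScalars', map_smul, smul_eq_mul] at this
    exact this
  · have h1 : HasDerivAt (fun t : ℝ => cpoint (l + s • leftDir m n)
        (x + t • (((fun _ => 1), (fun _ => 0)) : (Fin m → ℝ) × (Fin n → ℝ)))) (fun j => (leftDir m n j : ℂ)) 0 := by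
      refine hasDerivAt_pi.2 fun j => ?_
      have h2 : HasDerivAt (fun t : ℝ => ((Fin.append x.1 x.2 j + t * leftDir m n j : ℝ) : ℂ))
          ((1 * leftDir m n j : ℝ) : ℂ) 0 :=
        (((hasDerivAt_id (0 : ℝ)).mul_const _).const_add _).ofReal_comp
      have h3 := h2.add_const (Complex.I * (((l + s • leftDir m n) j : ℝ) : ℂ))
      rw [one_mul] at h3
      refine h3.congr_of_eventuallyEq (Eventually.of_forall fun t => ?_)
      simp only [cpoint]
      congr 2
      induction j using Fin.addCases with
      | left i => simp [leftDir]
      | right i => simp [leftDir]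
    have hx : HasFDerivAt G (fderiv ℂ G (cpoint (l + s • leftDir m n) x)) (cpoint (l + s • leftDir m n)
        (x + (0 : ℝ) • (((fun _ => 1), (fun _ => 0)) : (Fin m → ℝ) × (Fin n → ℝ)))) := by
      rw [zero_smul, add_zero]; exact hf s hs x
    exact (hx.restrictScalars ℝ).comp_hasDerivAt (0 : ℝ) h1

/-- The imaginary part of the upper node. -/
noncomputable def upperNode (m n : ℕ) : Fin (m + n) → ℝ := Fin.append (fun _ => 0) (fun _ => Real.pi)

theorem upperNode_mem_closure (m n : ℕ) : upperNode m n ∈ closure (Iplus (m + n)) := by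
  -- The path has imaginary parts `ε, 2ε, …, mε` on the left and `π - nε, …, π - ε` on the right,
  -- which are strictly increasing in `(0, π)` if `ε (m + n + 1) < π`.
  set c : Fin (m + n) → ℝ := Fin.append (fun i : Fin m => ((i : ℕ) : ℝ) + 1) (fun j : Fin n => ((j : ℕ) : ℝ) - n)
    with hc
  have ht : Tendsto (fun ε : ℝ => upperNode m n + ε • c) (𝓝[>] 0) (𝓝 (upperNode m n)) := by
    have : Continuous fun ε : ℝ => upperNode m n + ε • c := by fun_prop
    have := this.tendsto 0
    rw [zero_smul, add_zero] at this
    exact this.mono_left nhdsWithin_le_nhds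
  refine mem_closure_of_tendsto ht ?_
  have hpos : (0 : ℝ) < Real.pi / (m + n + 1) := div_pos Real.pi_pos (by positivity)
  filter_upwards [Ioo_mem_nhdsGT hpos] with ε hε
  have h1 : ε * (m + n + 1) < Real.pi := (lt_div_iff₀ (by positivity)).1 hε.2
  have h0 := hε.1
  have hl (i : Fin m) : ((i : ℕ) : ℝ) + 1 ≤ m := by exact_mod_cast i.2
  have hr (i : Fin n) : ((i : ℕ) : ℝ) + 1 ≤ n := by exact_mod_cast i.2
  have hl0 (i : Fin m) : (0 : ℝ) ≤ ((i : ℕ) : ℝ) := Nat.cast_nonneg _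
  have hr0 (i : Fin n) : (0 : ℝ) ≤ ((i : ℕ) : ℝ) := Nat.cast_nonneg _
  have eL (i : Fin m) : (upperNode m n + ε • c) (Fin.castAdd n i) = ε * (((i : ℕ) : ℝ) + 1) := by
    simp [upperNode, hc]
  have eR (j : Fin n) : (upperNode m n + ε • c) (Fin.natAdd m j) = Real.pi + ε * (((j : ℕ) : ℝ) - n) := by
    simp [upperNode, hc]
  refine ⟨fun i j hij => ?_, fun j => ?_⟩
  · induction i using Fin.addCases with
    | left i =>
      induction j using Fin.addCases with
      | left j =>
        rw [eL, eL]
        have : ((i : ℕ) : ℝ) < ((j : ℕ) : ℝ) := by exact_mod_cast hij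
        exact mul_lt_mul_of_pos_left (by linarith) h0
      | right j =>
        rw [eL, eR]
        have := hl i
        have := hr0 j
        nlinarith
    | right i =>
      induction j using Fin.addCases with
      | left j =>
        exfalso
        have h1 : ((Fin.natAdd m i : Fin (m + n)) : ℕ) < (Fin.castAdd n j : Fin (m + n)) := hij
        simp only [Fin.val_natAdd, Fin.val_castAdd] at h1
        omega
      | right j =>
        rw [eR, eR]
        have : ((i : ℕ) : ℝ) < ((j : ℕ) : ℝ) := by
          have h1 : ((Fin.natAdd m i : Fin (m + n)) : ℕ) < (Fin.natAdd m j : Fin (m + n)) := hij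
          simp only [Fin.val_natAdd] at h1
          exact_mod_cast (by omega : (i : ℕ) < j)
        exact add_lt_add_right (mul_lt_mul_of_pos_left (by linarith) h0) _
  · induction j using Fin.addCases with
    | left j =>
      rw [eL]
      have := hl j
      have := hl0 j
      have : (0 : ℝ) ≤ n := Nat.cast_nonneg _
      constructor <;> nlinarith
    | right j =>
      rw [eR]
      have := hr j
      have := hr0 j
      have : (0 : ℝ) ≤ m := Nat.cast_nonneg _
      constructor <;> nlinarith

instance nhdsWithin_upperNode_neBot (m n : ℕ) : (𝓝[Iplus (m + n)] upperNode m n).NeBot :=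
  mem_closure_iff_nhdsWithin_neBot.1 (upperNode_mem_closure m n)

theorem cpoint_eq_append {m n : ℕ} (l : Fin (m + n) → ℝ) (x : (Fin m → ℝ) × (Fin n → ℝ)) :
    cpoint l x = Fin.append (cshift (fun i => l (Fin.castAdd n i)) x.1)
      (fun j => cshift (fun j => l (Fin.natAdd m j) - Real.pi) x.2 j + Complex.I * Real.pi) := by
  funext j
  induction j using Fin.addCases with
  | left i => simp [cpoint, cshift]
  | right i => simp [cpoint, cshift]; ring

/-- The points near the upper node. -/
def NearNode {m n : ℕ} (r : ℝ) (l : Fin (m + n) → ℝ) : Prop :=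
  (∀ i : Fin m, 0 ≤ l (Fin.castAdd n i) ∧ l (Fin.castAdd n i) < r) ∧
    ∀ j : Fin n, Real.pi - r < l (Fin.natAdd m j) ∧ l (Fin.natAdd m j) ≤ Real.pi

theorem eventually_nearNode (m n : ℕ) {r : ℝ} (hr : 0 < r) :
    ∀ᶠ l in 𝓝[Iplus (m + n)] upperNode m n, NearNode (m := m) (n := n) r l := by
  have h1 : ∀ᶠ l in 𝓝[Iplus (m + n)] upperNode m n, l ∈ Iplus (m + n) := self_mem_nhdsWithin
  have h2 : ∀ᶠ l in 𝓝[Iplus (m + n)] upperNode m n, dist l (upperNode m n) < r :=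
    mem_nhdsWithin_of_mem_nhds (Metric.ball_mem_nhds _ hr)
  filter_upwards [h1, h2] with l hl hd
  refine ⟨fun i => ⟨(hl.2 _).1.le, ?_⟩, fun j => ⟨?_, (hl.2 _).2.le⟩⟩
  · have := (dist_le_pi_dist l (upperNode m n) (Fin.castAdd n i)).trans_lt hd
    simp only [upperNode, Fin.append_left, Real.dist_eq, sub_zero] at this
    exact (abs_lt.1 this).2
  · have := (dist_le_pi_dist l (upperNode m n) (Fin.natAdd m j)).trans_lt hd
    simp only [upperNode, Fin.append_right, Real.dist_eq] at this
    linarith [(abs_lt.1 this).1]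

theorem nearNode_upperNode (m n : ℕ) {r : ℝ} (hr : 0 < r) : NearNode r (upperNode m n) := by
  simp [NearNode, upperNode, hr]

theorem cpoint_mem_tube_of {m n : ℕ} {l : Fin (m + n) → ℝ} (h : ∀ i j, l i - l j < Real.pi)
    (x : (Fin m → ℝ) × (Fin n → ℝ)) : cpoint l x ∈ tube (m + n) := by
  intro i j
  have : (cpoint l x i - cpoint l x j).im = l i - l j := by simp [cpoint]
  rw [this, abs_lt]
  constructor <;> linarith [h i j, h j i]

theorem NearNode.mem_tube {m n : ℕ} {l : Fin (m + n) → ℝ} (h : NearNode (Real.pi / 8) l) {s : ℝ}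
    (hs : s ∈ Set.Icc 0 (Real.pi / 8)) (h0 : (0 < s) ∨ ∀ i : Fin m, 0 < l (Fin.castAdd n i))
    (x : (Fin m → ℝ) × (Fin n → ℝ)) : cpoint (l + s • leftDir m n) x ∈ tube (m + n) := by
  have hpi := Real.pi_pos
  have hL (i : Fin m) : (l + s • leftDir m n) (Fin.castAdd n i) = l (Fin.castAdd n i) + s := by
    simp [leftDir]
  have hR (j : Fin n) : (l + s • leftDir m n) (Fin.natAdd m j) = l (Fin.natAdd m j) := by
    simp [leftDir]
  refine cpoint_mem_tube_of (fun i j => ?_) x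
  induction i using Fin.addCases with
  | left i =>
    induction j using Fin.addCases with
    | left j => rw [hL, hL]; linarith [(h.1 i).2, (h.1 j).1, hs.1, hs.2]
    | right j => rw [hL, hR]; linarith [(h.1 i).2, (h.2 j).1, hs.1, hs.2]
  | right i =>
    induction j using Fin.addCases with
    | left j =>
      rw [hL, hR]
      rcases h0 with h0 | h0
      · linarith [(h.1 j).1, (h.2 i).2, hs.1, hs.2]
      · linarith [h0 j, (h.2 i).2, hs.1, hs.2]
    | right j => rw [hR, hR]; linarith [(h.2 i).2, (h.2 j).1, hs.1, hs.2]

/-- Raising the left variables by `s` separates them from the right ones, taken relative to `π`, by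
at least `s` in the imaginary direction. Each of the `m n` singular factors is then at most `2/s +
25`, and `2 + 25 s ≤ 60`. -/
theorem NearNode.norm_Modd_le {m n : ℕ} {l : Fin (m + n) → ℝ} (h : NearNode (Real.pi / 8) l) {s : ℝ}
    (hs : s ∈ Set.Ioc 0 (Real.pi / 8)) (x : (Fin m → ℝ) × (Fin n → ℝ)) :
    ‖Modd (cpoint (l + s • leftDir m n) x)‖ * s ^ (m * n) ≤ 60 ^ (m * n) := by
  have hpi := Real.pi_pos
  rw [cpoint_eq_append, Modd_append]
  have hL (i : Fin m) : (l + s • leftDir m n) (Fin.castAdd n i) = l (Fin.castAdd n i) + s := by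
    simp [leftDir]
  have hR (j : Fin n) : (l + s • leftDir m n) (Fin.natAdd m j) = l (Fin.natAdd m j) := by
    simp [leftDir]
  have hb := norm_Dker_cshift_le (a := fun i => (l + s • leftDir m n) (Fin.castAdd n i))
    (b := fun j => (l + s • leftDir m n) (Fin.natAdd m j) - Real.pi) (s := s)
    (fun i => by
      rw [hL, abs_le]
      constructor <;> linarith [(h.1 i).1, (h.1 i).2, hs.1, hs.2])
    (fun j => by
      rw [hR, abs_le]
      constructor <;> linarith [(h.2 j).1, (h.2 j).2, hs.1, hs.2]) hs.1
    (fun i j => by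
      rw [hL, hR]
      refine le_trans ?_ (le_abs_self _)
      linarith [(h.1 i).1, (h.2 j).2]) x.1 x.2
  refine (mul_le_mul_of_nonneg_right hb (pow_pos hs.1 _).le).trans ?_
  rw [← mul_pow]
  have h3 := Real.pi_le_four
  refine pow_le_pow_left₀ (mul_nonneg (add_nonneg (mul_nonneg two_pos.le (inv_pos.2 hs.1).le) (by norm_num)) hs.1.le) ?_ _
  have : s⁻¹ * s = 1 := inv_mul_cancel₀ hs.1.ne'
  nlinarith [hs.2]

/-- The upper boundary value of a function with the singularities of `Modd` exists. -/
theorem exists_isUpperBoundaryValue_mul_Modd {m n : ℕ} {H : (Fin (m + n) → ℂ) → ℂ} (hH : ContDiff ℂ 1 H) :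
    ∃ f : Distr m n, IsUpperBoundaryValue (fun ζ => H ζ * Modd ζ) f := by
  have hpi : 0 < Real.pi / 8 := div_pos Real.pi_pos (by norm_num)
  have hG : ContDiffOn ℂ 1 (fun ζ => H ζ * Modd ζ) (tube (m + n)) := hH.contDiffOn.mul contDiffOn_Modd
  have hU := isOpen_tube (m + n)
  have hself : ∀ᶠ l in 𝓝[Iplus (m + n)] upperNode m n, l ∈ Iplus (m + n) := self_mem_nhdsWithin
  have : (volume : Measure ((Fin m → ℝ) × (Fin n → ℝ))).IsAddHaarMeasure :=
    Measure.prod.instIsAddHaarMeasure _ _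
  have key := exists_boundary_distribution (ν := (volume : Measure ((Fin m → ℝ) × (Fin n → ℝ))))
    (l := 𝓝[Iplus (m + n)] upperNode m n) hpi
    (g := fun l s x => (fun ζ => H ζ * Modd ζ) (cpoint (l + s • leftDir m n) x))
    (G := fun s x => (fun ζ => H ζ * Modd ζ) (cpoint (upperNode m n + s • leftDir m n) x))
    (w := (((fun _ => 1), (fun _ => 0)) : (Fin m → ℝ) × (Fin n → ℝ)))
    (g' := fun l s x => fderiv ℂ (fun ζ => H ζ * Modd ζ) (cpoint (l + s • leftDir m n) x)
      (fun j => (leftDir m n j : ℂ))) (r := m * n)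
  simp only [zero_smul, add_zero] at key
  refine key ?_ ?_ ?_
  · filter_upwards [hself, eventually_nearNode m n hpi] with l hl hn
    exact shiftFamily_of_contDiffOn hU hG fun s hs x => hn.mem_tube hs (Or.inr fun i => (hl.2 _).1) x
  · intro s hs x
    have hmem := (nearNode_upperNode m n hpi).mem_tube ⟨hs.1.le, hs.2⟩ (Or.inl hs.1) x
    have hc := (hG.continuousOn.continuousAt (hU.mem_nhds hmem))
    have hA : Continuous fun l : Fin (m + n) → ℝ => cpoint (l + s • leftDir m n) x :=
      continuous_cpoint.comp (f := fun l : Fin (m + n) → ℝ => (l + s • leftDir m n, x)) (by fun_prop)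
    exact (hc.tendsto.comp (hA.tendsto (upperNode m n))).mono_left nhdsWithin_le_nhds
  · intro K hK
    have hK' : IsCompact ((fun p : ((Fin (m + n) → ℝ) × ℝ) × ((Fin m → ℝ) × (Fin n → ℝ)) =>
        cpoint (p.1.1 + p.1.2 • leftDir m n) p.2) ''
        ((Metric.closedBall (upperNode m n) 1 ×ˢ Set.Icc 0 (Real.pi / 8)) ×ˢ K)) := by
      refine (((isCompact_closedBall _ _).prod isCompact_Icc).prod hK).image ?_
      exact continuous_cpoint.comp (f := fun p : ((Fin (m + n) → ℝ) × ℝ) × ((Fin m → ℝ) × (Fin n → ℝ)) =>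
        (p.1.1 + p.1.2 • leftDir m n, p.2)) (by fun_prop)
    obtain ⟨B, hB⟩ := hK'.exists_bound_of_continuousOn hH.continuous.continuousOn
    refine ⟨B * 60 ^ (m * n), ?_⟩
    filter_upwards [eventually_nearNode m n hpi, mem_nhdsWithin_of_mem_nhds
      (Metric.closedBall_mem_nhds (upperNode m n) one_pos)] with l hn hl s hs x hx
    have hB' := hB _ ⟨((l, s), x), ⟨⟨hl, hs.1.le, hs.2⟩, hx⟩, rfl⟩
    rw [norm_mul, mul_assoc]
    exact mul_le_mul hB' (hn.norm_Modd_le hs x) (mul_nonneg (norm_nonneg _) (pow_pos hs.1 _).le)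
      ((norm_nonneg _).trans hB')

theorem exists_isUpperBoundaryValue (μ : ℝ) (P : LaurentSymm) {g : ℝ × ℝ → ℂ} (hg : Continuous g)
    (hc : HasCompactSupport g) (m n : ℕ) : ∃ f : Distr m n, IsUpperBoundaryValue (F μ P g (m + n)) f := by
  have hH : ContDiff ℂ 1 fun ζ : Fin (m + n) → ℂ => (if Odd (m + n) then
      1 / (2 * Real.pi * Complex.I) ^ ((m + n) / 2) else 0) * fourierMink g (momentum μ ζ) *
      P.eval (fun i => Complex.exp (ζ i)) :=
    (contDiff_const.mul ((contDiff_fourierMink hg hc).comp (contDiff_momentum μ))).mul (contDiff_eval_exp P)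
  obtain ⟨f, hf⟩ := exists_isUpperBoundaryValue_mul_Modd hH
  refine ⟨f, ?_⟩
  convert hf using 1
  funext ζ
  by_cases h : Odd (m + n)
  · simp only [F, if_pos h]
  · simp only [F, if_neg h, zero_mul]

/-! ### Symmetric Laurent functions: coproduct and growth -/

theorem LaurentSymm.eval_one {n : ℕ} (x : Fin n → ℂ) : LaurentSymm.eval 1 x = 1 := map_one _

theorem LaurentSymm.eval_X_append {m n : ℕ} (k : {k : ℤ // k ≠ 0}) (x : Fin m → ℂ) (y : Fin n → ℂ) :
    LaurentSymm.eval (MvPolynomial.X k) (Fin.append x y) =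
      LaurentSymm.eval (MvPolynomial.X k) x + LaurentSymm.eval (MvPolynomial.X k) y := by
  simp only [LaurentSymm.eval_X, Fin.sum_univ_add, Fin.append_left, Fin.append_right]

/-- Separation of two groups of variables. -/
theorem LaurentSymm.exists_eval_append (P : LaurentSymm) :
    ∃ (ι : Type) (_ : Fintype ι) (A B : ι → LaurentSymm), ∀ {m n : ℕ} (x : Fin m → ℂ) (y : Fin n → ℂ),
      P.eval (Fin.append x y) = ∑ r, (A r).eval x * (B r).eval y := by
  induction P using MvPolynomial.induction_on with
  | C a =>
    refine ⟨Unit, inferInstance, fun _ => MvPolynomial.C a, fun _ => 1, fun x y => ?_⟩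
    simp [LaurentSymm.eval_C, LaurentSymm.eval_one]
  | add P Q hP hQ =>
    obtain ⟨ι, _, A, B, h⟩ := hP
    obtain ⟨κ, _, A', B', h'⟩ := hQ
    refine ⟨ι ⊕ κ, inferInstance, Sum.elim A A', Sum.elim B B', fun x y => ?_⟩
    rw [LaurentSymm.eval_add, h, h', Fintype.sum_sum_type]
    rfl
  | mul_X P k hP =>
    obtain ⟨ι, _, A, B, h⟩ := hP
    refine ⟨ι ⊕ ι, inferInstance, Sum.elim (fun r => A r * MvPolynomial.X k) A,
      Sum.elim B (fun r => B r * MvPolynomial.X k), fun x y => ?_⟩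
    rw [LaurentSymm.eval_mul, h, LaurentSymm.eval_X_append, Fintype.sum_sum_type, mul_add,
      Finset.sum_mul, Finset.sum_mul]
    simp only [Sum.elim_inl, Sum.elim_inr, LaurentSymm.eval_mul]
    congr 1 <;> refine Finset.sum_congr rfl fun r _ => ?_ <;> ring

theorem energy_nonneg {m : ℕ} (θ : Fin m → ℝ) : 0 ≤ energy θ :=
  Finset.sum_nonneg fun j _ => (Real.cosh_pos (θ j)).le

theorem one_le_one_add_energy {m : ℕ} (θ : Fin m → ℝ) : 1 ≤ 1 + energy θ :=
  le_add_of_nonneg_right (energy_nonneg θ)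

theorem cosh_le_energy {m : ℕ} (θ : Fin m → ℝ) (j : Fin m) : Real.cosh (θ j) ≤ energy θ :=
  Finset.single_le_sum (f := fun j => Real.cosh (θ j)) (fun j _ => (Real.cosh_pos (θ j)).le) (Finset.mem_univ j)

theorem exp_abs_le_two_cosh (x : ℝ) : Real.exp |x| ≤ 2 * Real.cosh x := by
  rw [← Real.cosh_abs x, Real.cosh_eq]
  linarith [Real.exp_pos (-|x|)]

theorem exp_abs_le_energy {m : ℕ} (θ : Fin m → ℝ) (j : Fin m) : Real.exp |θ j| ≤ 2 * (1 + energy θ) := by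
  linarith [exp_abs_le_two_cosh (θ j), cosh_le_energy θ j]

theorem norm_zpow_le_cosh {z : ℂ} {t : ℝ} (h : ‖z‖ = Real.exp t) (k : ℤ) :
    ‖z ^ k‖ ≤ (2 * Real.cosh t) ^ k.natAbs := by
  rw [norm_zpow, h, ← Real.rpow_intCast, ← Real.exp_mul, mul_comm]
  calc Real.exp (k * t) ≤ Real.exp (k.natAbs * |t|) := by
        refine Real.exp_le_exp.2 ((le_abs_self _).trans (le_of_eq ?_))
        rw [abs_mul, Nat.cast_natAbs, Int.cast_abs]
    _ = Real.exp |t| ^ k.natAbs := by rw [Real.exp_nat_mul]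
    _ ≤ _ := pow_le_pow_left₀ (Real.exp_pos _).le (exp_abs_le_two_cosh t) _

theorem norm_eval_X_le {m : ℕ} {θ : Fin m → ℝ} {x : Fin m → ℂ} (h : ∀ j, ‖x j‖ = Real.exp (θ j))
    (k : {k : ℤ // k ≠ 0}) : ‖LaurentSymm.eval (MvPolynomial.X k) x‖ ≤
      2 ^ (k : ℤ).natAbs * (1 + energy θ) ^ (k : ℤ).natAbs := by
  -- Since `k ≠ 0`, one factor `cosh θ_j` can be kept for the sum over `j`, where it produces the
  -- energy. Hence the number of variables does not enter the bound.
  obtain ⟨K, hK⟩ : ∃ K, (k : ℤ).natAbs = K + 1 := Nat.exists_eq_succ_of_ne_zero (Int.natAbs_ne_zero.2 k.2)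
  rw [LaurentSymm.eval_X]
  calc ‖∑ j, x j ^ (k : ℤ)‖ ≤ ∑ j, (2 * Real.cosh (θ j)) ^ (K + 1) :=
        (norm_sum_le _ _).trans (Finset.sum_le_sum fun j _ => hK ▸ norm_zpow_le_cosh (h j) k)
    _ ≤ ∑ j, (2 ^ (K + 1) * (1 + energy θ) ^ K) * Real.cosh (θ j) := by
        refine Finset.sum_le_sum fun j _ => ?_
        rw [mul_pow, pow_succ (Real.cosh _), ← mul_assoc]
        have h0 := (Real.cosh_pos (θ j)).le
        have h1 : Real.cosh (θ j) ≤ 1 + energy θ := by linarith [cosh_le_energy θ j]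
        gcongr
    _ = 2 ^ (K + 1) * (1 + energy θ) ^ K * energy θ := by rw [← Finset.mul_sum, energy]
    _ ≤ 2 ^ (K + 1) * (1 + energy θ) ^ K * (1 + energy θ) := by
        have := energy_nonneg θ
        gcongr
        linarith
    _ = _ := by rw [hK, pow_succ (1 + energy θ)]; ring

/-- Polynomial growth in the energy, uniformly in the number of variables. -/
theorem LaurentSymm.exists_norm_eval_le (P : LaurentSymm) : ∃ (C : ℝ) (d : ℕ), 0 ≤ C ∧
    ∀ {m : ℕ} (θ : Fin m → ℝ) (x : Fin m → ℂ), (∀ j, ‖x j‖ = Real.exp (θ j)) →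
      ‖P.eval x‖ ≤ C * (1 + energy θ) ^ d := by
  induction P using MvPolynomial.induction_on with
  | C a => exact ⟨‖a‖, 0, norm_nonneg a, fun θ x _ => by rw [LaurentSymm.eval_C, pow_zero, mul_one]⟩
  | add P Q hP hQ =>
    obtain ⟨C, d, hC, h⟩ := hP
    obtain ⟨C', d', hC', h'⟩ := hQ
    refine ⟨C + C', d + d', add_nonneg hC hC', fun θ x hx => ?_⟩
    rw [LaurentSymm.eval_add, add_mul]
    have h1 := one_le_one_add_energy θ
    refine (norm_add_le _ _).trans (add_le_add ((h θ x hx).trans ?_) ((h' θ x hx).trans ?_)) <;> gcongr <;> omega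
  | mul_X P k hP =>
    obtain ⟨C, d, hC, h⟩ := hP
    refine ⟨C * 2 ^ (k : ℤ).natAbs, d + (k : ℤ).natAbs, by positivity, fun θ x hx => ?_⟩
    rw [LaurentSymm.eval_mul, norm_mul]
    have h1 := energy_nonneg θ
    refine (mul_le_mul (h θ x hx) (norm_eval_X_le hx k) (norm_nonneg _) (by positivity)).trans (le_of_eq ?_)
    ring

theorem LaurentSymm.exists_norm_eval_le_family {ι : Type*} [Fintype ι] (P : ι → LaurentSymm) :
    ∃ (C : ℝ) (d : ℕ), 0 ≤ C ∧ ∀ (r : ι) {m : ℕ} (θ : Fin m → ℝ) (x : Fin m → ℂ),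
      (∀ j, ‖x j‖ = Real.exp (θ j)) → ‖(P r).eval x‖ ≤ C * (1 + energy θ) ^ d := by
  choose C d hC h using fun r => (P r).exists_norm_eval_le
  refine ⟨∑ r, C r, ∑ r, d r, Finset.sum_nonneg fun r _ => hC r, fun r m θ x hx => (h r θ x hx).trans ?_⟩
  have h1 := one_le_one_add_energy θ
  have h2 : C r ≤ ∑ r, C r := Finset.single_le_sum (fun r _ => hC r) (Finset.mem_univ r)
  have h3 : d r ≤ ∑ r, d r := Finset.single_le_sum (fun _ _ => Nat.zero_le _) (Finset.mem_univ r)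
  have := (hC r).trans h2
  gcongr

/-! ### Stretched exponentials -/

/-- A bound for the supremum of `(1 + t) ^ q * exp (-t ^ α)`. -/
noncomputable def stretch (α q : ℝ) : ℝ := 2 ^ q * ((1 + q) / α) ^ (q / α)

theorem stretch_pos {α q : ℝ} (hα : 0 < α) (hq : 0 ≤ q) : 0 < stretch α q := by
  unfold stretch; positivity

/-- This is `s/x ≤ e^(s/x)` raised to the power `x`. -/
theorem rpow_le_mul_exp {s x : ℝ} (hs : 0 ≤ s) (hx : 0 < x) : s ^ x ≤ x ^ x * Real.exp s := by
  have h1 : s ≤ x * Real.exp (s / x) := by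
    have := Real.add_one_le_exp (s / x)
    calc s = x * (s / x) := by field_simp
      _ ≤ _ := by gcongr; linarith
  calc s ^ x ≤ (x * Real.exp (s / x)) ^ x := Real.rpow_le_rpow hs h1 hx.le
    _ = x ^ x * Real.exp s := by
      rw [Real.mul_rpow hx.le (Real.exp_pos _).le, ← Real.exp_mul]
      congr 2; field_simp

theorem one_add_rpow_mul_exp_le {α q t : ℝ} (hα : 0 < α) (hα1 : α < 1) (hq : 0 ≤ q) (ht : 0 ≤ t) :
    (1 + t) ^ q * Real.exp (-t ^ α) ≤ stretch α q := by
  have hbase : 1 ≤ (1 + q) / α := by rw [le_div_iff₀ hα]; linarith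
  have hqα : 0 ≤ q / α := div_nonneg hq hα.le
  rcases le_total t 1 with h | h
  · calc (1 + t) ^ q * Real.exp (-t ^ α) ≤ 2 ^ q * 1 := by
          gcongr
          · linarith
          · rw [Real.exp_le_one_iff, neg_nonpos]; positivity
      _ ≤ _ := by unfold stretch; gcongr; exact Real.one_le_rpow hbase hqα
  · rcases hq.eq_or_lt with rfl | hq
    · have : Real.exp (-t ^ α) ≤ 1 := by rw [Real.exp_le_one_iff, neg_nonpos]; positivity
      simpa [stretch] using this
    have h1 : (1 + t) ^ q ≤ 2 ^ q * (t ^ α) ^ (q / α) := by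
      rw [← Real.rpow_mul ht, mul_div_cancel₀ _ hα.ne', ← Real.mul_rpow zero_le_two ht]
      exact Real.rpow_le_rpow (by linarith) (by linarith) hq.le
    -- With `s = t^α` and exponent `q/α` the exponential cancels exactly; this is the origin of the
    -- exponent in `stretch`.
    have h2 := rpow_le_mul_exp (s := t ^ α) (Real.rpow_nonneg ht _) (div_pos hq hα)
    calc (1 + t) ^ q * Real.exp (-t ^ α)
        ≤ 2 ^ q * ((q / α) ^ (q / α) * Real.exp (t ^ α)) * Real.exp (-t ^ α) := by
          gcongr; exact h1.trans (by gcongr)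
      _ = 2 ^ q * (q / α) ^ (q / α) := by
          rw [mul_assoc, mul_assoc, ← Real.exp_add, add_neg_cancel, Real.exp_zero, mul_one]
      _ ≤ _ := by
          unfold stretch; gcongr; linarith

/-- Both bases increase to the common base `(1 + q + r)/α`, after which the exponents add. Thus
powers of the energy may be distributed between derivatives of `g` and the damping factor without
loss. -/
theorem stretch_mul_stretch_le {α q r : ℝ} (hα : 0 < α) (hq : 0 ≤ q) (hr : 0 ≤ r) :
    stretch α q * stretch α r ≤ stretch α (q + r) := by
  have h1 : ((1 + q) / α) ^ (q / α) ≤ ((1 + (q + r)) / α) ^ (q / α) := by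
    gcongr; linarith
  have h2 : ((1 + r) / α) ^ (r / α) ≤ ((1 + (q + r)) / α) ^ (r / α) := by
    gcongr; linarith
  calc stretch α q * stretch α r = 2 ^ q * 2 ^ r * (((1 + q) / α) ^ (q / α) * ((1 + r) / α) ^ (r / α)) := by
        unfold stretch; ring
    _ ≤ 2 ^ q * 2 ^ r * (((1 + (q + r)) / α) ^ (q / α) * ((1 + (q + r)) / α) ^ (r / α)) := by gcongr
    _ = _ := by
      unfold stretch
      rw [← Real.rpow_add two_pos, ← Real.rpow_add (by positivity), ← add_div]

theorem stretch_mono {α q r : ℝ} (hα : 0 < α) (hα1 : α < 1) (hq : 0 ≤ q) (hqr : q ≤ r) :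
    stretch α q ≤ stretch α r := by
  have hbase : 1 ≤ (1 + r) / α := by rw [le_div_iff₀ hα]; linarith
  unfold stretch
  calc _ ≤ 2 ^ r * ((1 + r) / α) ^ (q / α) := by gcongr; exact one_le_two
    _ ≤ _ := by gcongr

/-! ### Time derivatives of test functions on Minkowski space -/

open FourierTransform in
-- Fourier inversion on the Euclidean plane. The Minkowski product accounts for the sign of the
-- first component, the two normalizations for the factors `2π`.
theorem norm_le_integral_fourierMink {φ : ℝ × ℝ → ℂ} (hφ : Continuous φ) (hc : HasCompactSupport φ)
    {b : WithLp 2 (ℝ × ℝ) → ℝ} (hb : Integrable b)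
    (h : ∀ ξ : WithLp 2 (ℝ × ℝ), ‖fourierMink φ (((-2 * Real.pi * ξ.fst : ℝ) : ℂ), ((2 * Real.pi * ξ.snd : ℝ) : ℂ))‖
      ≤ b ξ) (x : ℝ × ℝ) : ‖φ x‖ ≤ 2 * Real.pi * ∫ ξ, b ξ := by
  have hmp := WithLp.volume_preserving_toLp (U := ℝ) (V := ℝ)
  have he : MeasurableEmbedding (WithLp.toLp 2 : ℝ × ℝ → WithLp 2 (ℝ × ℝ)) :=
    (WithLp.homeomorphProd 2 ℝ ℝ).symm.measurableEmbedding
  set f : WithLp 2 (ℝ × ℝ) → ℂ := fun y => φ (WithLp.ofLp y) with hf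
  have hfc : Continuous f := hφ.comp (WithLp.prod_continuous_ofLp 2 ℝ ℝ)
  have hF (ξ : WithLp 2 (ℝ × ℝ)) : 𝓕 f ξ = 2 * Real.pi *
      fourierMink φ (((-2 * Real.pi * ξ.fst : ℝ) : ℂ), ((2 * Real.pi * ξ.snd : ℝ) : ℂ)) := by
    rw [Real.fourier_eq', ← hmp.integral_comp he, fourierMink, ← mul_assoc]
    have h2 : (2 * Real.pi : ℂ) * (1 / (2 * Real.pi)) = 1 := by
      have : (Real.pi : ℂ) ≠ 0 := by exact_mod_cast Real.pi_ne_zero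
      field_simp
    rw [h2, one_mul]
    refine integral_congr_ae (Eventually.of_forall fun y => ?_)
    simp only [hf, smul_eq_mul, WithLp.prod_inner_apply]
    congr 2
    simp
    ring
  have hFn (ξ : WithLp 2 (ℝ × ℝ)) : ‖𝓕 f ξ‖ ≤ 2 * Real.pi * b ξ := by
    rw [hF, norm_mul, norm_mul, Complex.norm_real, Real.norm_of_nonneg Real.pi_pos.le, Complex.norm_two]
    exact mul_le_mul_of_nonneg_left (h ξ) (by positivity)
  have hfi : Integrable f := by
    rw [← hmp.integrable_comp_emb he]
    exact hφ.integrable_of_hasCompactSupport hc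
  have hFc : Continuous (𝓕 f) := by
    have e : 𝓕 f = fun ξ : WithLp 2 (ℝ × ℝ) => 2 * Real.pi *
      fourierMink φ (((-2 * Real.pi * ξ.fst : ℝ) : ℂ), ((2 * Real.pi * ξ.snd : ℝ) : ℂ)) := funext hF
    rw [e]
    refine continuous_const.mul ((contDiff_fourierMink hφ hc).continuous.comp ?_)
    fun_prop
  have hFi : Integrable (𝓕 f) := (hb.const_mul (2 * Real.pi)).mono' hFc.aestronglyMeasurable
    (Eventually.of_forall hFn)
  have hinv := hfc.fourierInv_fourier_eq hfi hFi
  have hx : φ x = 𝓕⁻ (𝓕 f) (WithLp.toLp 2 x) := by rw [hinv]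
  rw [hx, Real.fourierInv_eq', ← integral_const_mul]
  refine norm_integral_le_of_norm_le (hb.const_mul _) (Eventually.of_forall fun ξ => ?_)
  rw [norm_smul, Complex.norm_exp_ofReal_mul_I, one_mul]
  exact hFn ξ

/-- Test functions on Minkowski space. -/
abbrev MinkTest : Type := 𝓓((⊤ : TopologicalSpace.Opens (ℝ × ℝ)), ℂ)

theorem fourierMink_iterLine (φ : MinkTest) (k : ℕ) (p : ℂ × ℂ) :
    fourierMink (iterLine (1, 0) k φ) p = (-Complex.I * p.1) ^ k * fourierMink φ p := by
  have : (volume : Measure (ℝ × ℝ)).IsAddHaarMeasure := Measure.prod.instIsAddHaarMeasure _ _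
  induction k with
  | zero => rw [pow_zero, one_mul]; rfl
  | succ k ih =>
    rw [pow_succ', mul_assoc, ← ih, fourierMink, fourierMink, mul_left_comm]
    congr 1
    set f : ℝ × ℝ → ℂ := fun x => Complex.exp (Complex.I * (p.1 * x.1 - p.2 * x.2)) with hf
    have hfc : Continuous f := by rw [hf]; fun_prop
    have hd (x : ℝ × ℝ) : HasLineDerivAt ℝ f (Complex.I * p.1 * f x) x (1, 0) := by
      have h1 : HasDerivAt (fun t : ℝ => Complex.I * (p.1 * ((x.1 + t : ℝ) : ℂ) - p.2 * x.2))
          (Complex.I * (p.1 * ((1 : ℝ) : ℂ))) 0 :=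
        ((((hasDerivAt_id (0 : ℝ)).const_add x.1).ofReal_comp.const_mul p.1).sub_const _).const_mul _
      have h2 := h1.cexp
      rw [add_zero] at h2
      refine (h2.congr_deriv ?_).congr_of_eventuallyEq (Eventually.of_forall fun t => ?_)
      · rw [hf]; push_cast; ring
      · simp [hf]
    have hi {u : ℝ × ℝ → ℂ} (hu : Continuous u) (k : ℕ) :
        Integrable (fun x => u x * iterLine (1, 0) k φ x) :=
      (hu.mul (iterLine (1, 0) k φ).continuous).integrable_of_hasCompactSupport
        (iterLine (1, 0) k φ).hasCompactSupport.mul_left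
    have ibp := integral_bilinear_hasLineDerivAt_right_eq_neg_left_of_integrable
      (μ := (volume : Measure (ℝ × ℝ)))
      (B := ContinuousLinearMap.mul ℝ ℂ) (v := ((1 : ℝ), (0 : ℝ))) (f := f) (f' := fun x => Complex.I * p.1 * f x)
      (g := iterLine (1, 0) k φ) (g' := iterLine (1, 0) (k + 1) φ)
      (hi (hfc.const_mul _) k) (hi hfc (k + 1)) (hi hfc k)
      (fun x _ => hd x) (fun x _ => hasLineDerivAt_iterLine _ k φ x)
    simp only [ContinuousLinearMap.mul_apply'] at ibp
    rw [ibp]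
    simp only [mul_assoc]
    rw [integral_const_mul, integral_const_mul]
    ring

/-- The `L¹` norms of the time derivatives of a test function whose Fourier transform decays like a
stretched exponential. -/
theorem exists_lintegral_iterLine_le {α : ℝ} (hα : 0 < α) (hα1 : α < 1) (φ : MinkTest) {B : ℝ}
    (hB : ∀ p : ℝ × ℝ, ‖fourierMink φ ((p.1 : ℂ), (p.2 : ℂ))‖ ≤ B * Real.exp (-‖p‖ ^ α)) :
    ∃ C : ℝ, 0 ≤ C ∧ ∀ k : ℕ, ∫⁻ x, ‖iterLine (1, 0) k φ x‖ₑ ≤ ENNReal.ofReal (C * stretch α (k + 3)) := by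
  have hB0 : 0 ≤ B := by
    have := (norm_nonneg _).trans (hB 0)
    exact nonneg_of_mul_nonneg_left this (Real.exp_pos _)
  have hfin : Module.finrank ℝ (WithLp 2 (ℝ × ℝ)) = 2 := by
    rw [LinearEquiv.finrank_eq (WithLp.linearEquiv 2 ℝ (ℝ × ℝ))]; simp
  -- The power `-3` is integrable in dimension two; it is the origin of the shift by `3` in the
  -- index of `stretch`.
  have hint : Integrable fun ξ : WithLp 2 (ℝ × ℝ) => (1 + ‖ξ‖) ^ (-3 : ℝ) :=
    integrable_one_add_norm (by rw [hfin]; norm_num)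
  set J := ∫ ξ : WithLp 2 (ℝ × ℝ), (1 + ‖ξ‖) ^ (-3 : ℝ) with hJ
  have hJ0 : 0 ≤ J := integral_nonneg fun ξ => by positivity
  have hsup (k : ℕ) (x : ℝ × ℝ) : ‖iterLine (1, 0) k φ x‖ ≤ 2 * Real.pi * (B * stretch α (k + 3) * J) := by
    rw [hJ, ← integral_const_mul]
    refine norm_le_integral_fourierMink (iterLine (1, 0) k φ).continuous (iterLine (1, 0) k φ).hasCompactSupport
      (hint.const_mul _) (fun ξ => ?_) x
    set p : ℝ × ℝ := (-2 * Real.pi * ξ.fst, 2 * Real.pi * ξ.snd) with hp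
    have h1 : ‖ξ‖ ≤ ‖p‖ := by
      have e1 : ‖p.1‖ = 2 * Real.pi * |ξ.fst| := by
        rw [hp]; simp [abs_of_pos Real.pi_pos]
      have e2 : ‖p.2‖ = 2 * Real.pi * |ξ.snd| := by
        rw [hp]; simp [abs_of_pos Real.pi_pos]
      have h3 : ‖ξ‖ ≤ |ξ.fst| + |ξ.snd| := by
        rw [WithLp.prod_norm_eq_of_L2]
        refine Real.sqrt_le_iff.2 ⟨by positivity, ?_⟩
        rw [Real.norm_eq_abs, Real.norm_eq_abs]
        nlinarith [abs_nonneg ξ.fst, abs_nonneg ξ.snd]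
      have h4 := norm_fst_le p
      have h5 := norm_snd_le p
      rw [e1] at h4
      rw [e2] at h5
      nlinarith [Real.pi_gt_three, abs_nonneg ξ.fst, abs_nonneg ξ.snd]
    have h0 : 0 ≤ ‖p‖ := norm_nonneg p
    have h2 : ‖(-Complex.I * (p.1 : ℂ)) ^ k‖ ≤ (1 + ‖p‖) ^ (k : ℝ) := by
      rw [norm_pow, norm_mul, norm_neg, Complex.norm_I, one_mul, Complex.norm_real, Real.rpow_natCast]
      exact pow_le_pow_left₀ (norm_nonneg _) ((norm_fst_le p).trans (by linarith)) k
    have h3 := one_add_rpow_mul_exp_le hα hα1 (by positivity : (0 : ℝ) ≤ (k : ℝ) + 3) h0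
    rw [fourierMink_iterLine, norm_mul]
    calc _ ≤ (1 + ‖p‖) ^ (k : ℝ) * (B * Real.exp (-‖p‖ ^ α)) :=
          mul_le_mul h2 (hB p) (norm_nonneg _) (by positivity)
      _ = B * ((1 + ‖p‖) ^ ((k : ℝ) + 3) * Real.exp (-‖p‖ ^ α)) * (1 + ‖p‖) ^ (-3 : ℝ) := by
          rw [Real.rpow_add (by positivity), Real.rpow_neg (by positivity)]
          field_simp
      _ ≤ B * stretch α (k + 3) * (1 + ‖ξ‖) ^ (-3 : ℝ) := by
          have : (1 + ‖p‖) ^ (-3 : ℝ) ≤ (1 + ‖ξ‖) ^ (-3 : ℝ) :=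
            Real.rpow_le_rpow_of_nonpos (by positivity) (by linarith) (by norm_num)
          have := (stretch_pos hα (by positivity : (0 : ℝ) ≤ (k : ℝ) + 3)).le
          gcongr
  -- All derivatives live on the support of `φ`, so the supremum bound becomes an `L¹` bound at the
  -- price of its area.
  set V := (volume : Measure (ℝ × ℝ)).real (tsupport φ) with hV
  have hVfin : (volume : Measure (ℝ × ℝ)) (tsupport φ) ≠ ⊤ := φ.hasCompactSupport.isCompact.measure_lt_top.ne
  refine ⟨2 * Real.pi * B * J * V, by positivity, fun k => ?_⟩
  have hz (x : ℝ × ℝ) (hx : x ∉ tsupport φ) : ‖iterLine (1, 0) k φ x‖ₑ = 0 := by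
    rw [image_eq_zero_of_notMem_tsupport fun h => hx (tsupport_iterLine_subset _ k φ h), enorm_zero]
  have hst := (stretch_pos hα (by positivity : (0 : ℝ) ≤ (k : ℝ) + 3)).le
  rw [← setLIntegral_eq_of_support_subset (s := tsupport φ) fun x hx => by_contra fun h => hx (hz x h)]
  calc _ ≤ ∫⁻ x in tsupport φ, ENNReal.ofReal (2 * Real.pi * (B * stretch α (k + 3) * J)) := by
        refine lintegral_mono fun x => ?_
        rw [← ofReal_norm]
        exact ENNReal.ofReal_le_ofReal (hsup k x)
    _ = ENNReal.ofReal (2 * Real.pi * (B * stretch α (k + 3) * J)) * ENNReal.ofReal V := by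
        rw [setLIntegral_const, hV, ofReal_measureReal hVfin]
    _ = _ := by
        rw [← ENNReal.ofReal_mul (by positivity)]
        congr 1; ring

/-! ### Superpositions of products -/

section Superposition

variable {δ : ℝ} {m n : ℕ} {C : ℝ≥0∞} {k : (Fin m → ℝ) → (Fin n → ℝ) → ℂ}

theorem BddKer.swap (h : BddKer δ C k) : BddKer δ C (fun η θ => k θ η) where
  meas := h.meas.comp measurable_swap
  bdd := by
    obtain ⟨B, hB⟩ := h.bdd
    exact ⟨B, fun η θ => hB θ η⟩
  bound u v hu hv hu2 hv2 := by
    have e : ∫ z : (Fin n → ℝ) × (Fin m → ℝ), u z.1 * v z.2 * k z.2 z.1 =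
        ∫ z : (Fin m → ℝ) × (Fin n → ℝ), v z.1 * u z.2 * k z.1 z.2 := by
      refine (integral_congr_ae (Eventually.of_forall fun z => ?_)).trans
        (integral_prod_swap (μ := (volume : Measure (Fin m → ℝ))) (ν := (volume : Measure (Fin n → ℝ)))
        (f := fun z => v z.1 * u z.2 * k z.1 z.2))
      simp only [Prod.fst_swap, Prod.snd_swap]
      ring
    rw [e, mul_right_comm]
    exact h.bound v u hv hu hv2 hu2

theorem integrable_superposition (h : BddKer δ C k) {γ : ℝ × ℝ → ℂ} (hγ : Continuous γ)
    (hγc : HasCompactSupport γ) {U : ℝ × ℝ → (Fin m → ℝ) → ℂ} {V : ℝ × ℝ → (Fin n → ℝ) → ℂ}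
    (hU : Continuous (Function.uncurry U)) (hV : Continuous (Function.uncurry V))
    {K₁ : Set (Fin m → ℝ)} {K₂ : Set (Fin n → ℝ)} (hK₁ : IsCompact K₁) (hK₂ : IsCompact K₂)
    (hU0 : ∀ x, ∀ θ ∉ K₁, U x θ = 0) (hV0 : ∀ x, ∀ η ∉ K₂, V x η = 0) :
    Integrable (fun p : ((Fin m → ℝ) × (Fin n → ℝ)) × (ℝ × ℝ) =>
      k p.1.1 p.1.2 * (γ p.2 * (U p.2 p.1.1 * V p.2 p.1.2))) (volume.prod volume) := by
  have hc : Continuous fun p : ((Fin m → ℝ) × (Fin n → ℝ)) × (ℝ × ℝ) =>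
      γ p.2 * (U p.2 p.1.1 * V p.2 p.1.2) :=
    (hγ.comp continuous_snd).mul
      ((hU.comp (f := fun p : ((Fin m → ℝ) × (Fin n → ℝ)) × (ℝ × ℝ) => (p.2, p.1.1)) (by fun_prop)).mul
      (hV.comp (f := fun p : ((Fin m → ℝ) × (Fin n → ℝ)) × (ℝ × ℝ) => (p.2, p.1.2)) (by fun_prop)))
  have hs : HasCompactSupport fun p : ((Fin m → ℝ) × (Fin n → ℝ)) × (ℝ × ℝ) =>
      γ p.2 * (U p.2 p.1.1 * V p.2 p.1.2) := by
    refine HasCompactSupport.intro ((hK₁.prod hK₂).prod hγc.isCompact) fun p hp => ?_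
    by_contra hne
    refine hp ⟨⟨by_contra fun h1 => hne ?_, by_contra fun h2 => hne ?_⟩, by_contra fun h3 => hne ?_⟩
    · rw [hU0 _ _ h1, zero_mul, mul_zero]
    · rw [hV0 _ _ h2, mul_zero, mul_zero]
    · rw [image_eq_zero_of_notMem_tsupport h3, zero_mul]
  obtain ⟨B, hB⟩ := h.bdd
  have : Measurable fun p : ((Fin m → ℝ) × (Fin n → ℝ)) × (ℝ × ℝ) => k p.1.1 p.1.2 := h.meas.comp measurable_fst
  exact (hc.integrable_of_hasCompactSupport hs).bdd_mul (c := B)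
    this.aestronglyMeasurable (Eventually.of_forall fun p => hB _ _)

/-- A kernel multiplied with a superposition of products. -/
theorem enorm_integral_superposition_le (h : BddKer δ C k) {γ : ℝ × ℝ → ℂ} (hγ : Continuous γ)
    (hγc : HasCompactSupport γ) {U : ℝ × ℝ → (Fin m → ℝ) → ℂ} {V : ℝ × ℝ → (Fin n → ℝ) → ℂ}
    (hU : Continuous (Function.uncurry U)) (hV : Continuous (Function.uncurry V))
    {K₁ : Set (Fin m → ℝ)} {K₂ : Set (Fin n → ℝ)} (hK₁ : IsCompact K₁) (hK₂ : IsCompact K₂)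
    (hU0 : ∀ x, ∀ θ ∉ K₁, U x θ = 0) (hV0 : ∀ x, ∀ η ∉ K₂, V x η = 0) {MU MV : ℝ≥0∞} (hMU : MU ≠ ⊤)
    (hMV : MV ≠ ⊤) (hUb : ∀ x ∈ tsupport γ, nsq δ (U x) ≤ MU ^ 2) (hVb : ∀ x ∈ tsupport γ, nsq δ (V x) ≤ MV ^ 2) :
    ‖∫ z : (Fin m → ℝ) × (Fin n → ℝ), k z.1 z.2 * ∫ x, γ x * (U x z.1 * V x z.2)‖ₑ ≤
      C * MU * MV * ∫⁻ x, ‖γ x‖ₑ := by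
  have hint := integrable_superposition h hγ hγc hU hV hK₁ hK₂ hU0 hV0
  simp only [← integral_const_mul]
  rw [integral_integral_swap hint]
  refine (enorm_integral_le_lintegral_enorm _).trans ?_
  rw [← lintegral_const_mul _ (by fun_prop)]
  refine lintegral_mono fun x => ?_
  by_cases hx : x ∈ tsupport γ
  · have e : ∫ z : (Fin m → ℝ) × (Fin n → ℝ), k z.1 z.2 * (γ x * (U x z.1 * V x z.2)) =
        γ x * ∫ z : (Fin m → ℝ) × (Fin n → ℝ), U x z.1 * V x z.2 * k z.1 z.2 := by
      rw [← integral_const_mul]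
      refine integral_congr_ae (Eventually.of_forall fun z => ?_)
      ring
    have hUx : Continuous (U x) := hU.comp (f := fun θ => (x, θ)) (by fun_prop)
    have hVx : Continuous (V x) := hV.comp (f := fun η => (x, η)) (by fun_prop)
    have hb := h.bound (U x) (V x) hUx.measurable hVx.measurable
      ((hUb x hx).trans_lt (ENNReal.pow_lt_top hMU.lt_top)).ne ((hVb x hx).trans_lt (ENNReal.pow_lt_top hMV.lt_top)).ne
    rw [e, enorm_mul, mul_comm]
    refine mul_le_mul_left (hb.trans ?_) _
    have hs {a M : ℝ≥0∞} (ha : a ≤ M ^ 2) : a ^ (1 / 2 : ℝ) ≤ M := by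
      refine (ENNReal.rpow_le_rpow ha (by norm_num)).trans (le_of_eq ?_)
      rw [← ENNReal.rpow_natCast, ← ENNReal.rpow_mul]
      norm_num
    exact mul_le_mul' (mul_le_mul' le_rfl (hs (hUb x hx))) (hs (hVb x hx))
  · simp [image_eq_zero_of_notMem_tsupport hx]

end Superposition

/-- The exponential `exp (i p·x)` with the Minkowski product. -/
noncomputable def mexp (p : ℂ × ℂ) (x : ℝ × ℝ) : ℂ := Complex.exp (Complex.I * (p.1 * x.1 - p.2 * x.2))

theorem mexp_sub (p q : ℂ × ℂ) (x : ℝ × ℝ) : mexp (p - q) x = mexp p x * mexp (-q) x := by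
  rw [mexp, mexp, mexp, ← Complex.exp_add]
  congr 1
  simp only [Prod.fst_sub, Prod.snd_sub, Prod.fst_neg, Prod.snd_neg]
  ring

theorem continuous_mexp : Continuous (Function.uncurry mexp) := by
  change Continuous fun q : (ℂ × ℂ) × (ℝ × ℝ) => Complex.exp (Complex.I * (q.1.1 * q.2.1 - q.1.2 * q.2.2))
  fun_prop

/-- Multiply by `(1 + q⁰/μ)^N`, expand it around `1 + p⁰/μ`, and absorb the powers of `(p - q)⁰`
into time derivatives of `φ`. After division the variable `q` has gained `N` inverse powers of its
energy, paid for by powers of the energy of `p` and by derivatives. -/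
theorem mul_fourierMink_eq_sum (φ : MinkTest) {μ : ℝ} (hμ : μ ≠ 0) (N : ℕ) (p q : ℂ × ℂ)
    (hq : 1 + q.1 / μ ≠ 0) :
    fourierMink φ (p - q) = ∑ j ∈ Finset.range (N + 1),
      ((N.choose j : ℂ) * (-Complex.I / μ) ^ j * (1 / (2 * Real.pi))) *
        ∫ x, iterLine (1, 0) j φ x * ((mexp p x * (1 + p.1 / μ) ^ (N - j)) * (mexp (-q) x * ((1 + q.1 / μ) ^ N)⁻¹)) := by
  have hμ' : (μ : ℂ) ≠ 0 := by exact_mod_cast hμ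
  have hb : (1 + q.1 / μ) ^ N * fourierMink φ (p - q) = ∑ j ∈ Finset.range (N + 1),
      (N.choose j : ℂ) * (-Complex.I / μ) ^ j * (1 + p.1 / μ) ^ (N - j) *
        fourierMink (iterLine (1, 0) j φ) (p - q) := by
    have e : (1 + q.1 / μ) = (-(p - q).1 / μ) + (1 + p.1 / μ) := by
      rw [Prod.fst_sub]; field_simp; ring
    rw [e, add_pow, Finset.sum_mul]
    refine Finset.sum_congr rfl fun j _ => ?_
    rw [fourierMink_iterLine]
    have h2 : (-(p - q).1 / μ : ℂ) ^ j = (-Complex.I / μ) ^ j * (-Complex.I * (p - q).1) ^ j := by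
      rw [← mul_pow]
      congr 1
      have := Complex.I_mul_I
      linear_combination (-(p - q).1 / μ) * this
    rw [h2]
    ring
  have hN : (1 + q.1 / μ) ^ N ≠ 0 := pow_ne_zero N hq
  rw [← mul_right_inj' hN, hb, Finset.mul_sum]
  refine Finset.sum_congr rfl fun j _ => ?_
  rw [fourierMink]
  have e : ∫ x, iterLine (1, 0) j φ x * ((mexp p x * (1 + p.1 / μ) ^ (N - j)) * (mexp (-q) x * ((1 + q.1 / μ) ^ N)⁻¹))
      = ((1 + p.1 / μ) ^ (N - j) * ((1 + q.1 / μ) ^ N)⁻¹) * ∫ x, mexp (p - q) x * iterLine (1, 0) j φ x := by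
    rw [← integral_const_mul]
    refine integral_congr_ae (Eventually.of_forall fun x => ?_)
    simp only [mexp_sub]
    ring
  rw [e]
  simp only [mexp]
  generalize (1 + q.1 / (μ : ℂ)) ^ N = W at hN ⊢
  field_simp

/-- The bound of a kernel multiplied with a function of the difference of the momenta, where the decay
is in the left variables only. -/
theorem BddKer.enorm_integral_fourierMink_le {δ : ℝ} {m n : ℕ} {C : ℝ≥0∞}
    {k : (Fin m → ℝ) → (Fin n → ℝ) → ℂ} (h : BddKer δ C k) {α : ℝ} (hα : 0 < α) (φ : MinkTest) {CG : ℝ}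
    (hCG : 0 ≤ CG)
    (hG : ∀ j : ℕ, ∫⁻ x, ‖iterLine (1, 0) j φ x‖ₑ ≤ ENNReal.ofReal (CG * stretch α (j + 3)))
    {μ : ℝ} (hμ : μ ≠ 0) {p₁ : (Fin m → ℝ) → ℂ × ℂ} {p₂ : (Fin n → ℝ) → ℂ × ℂ} (hp₁ : Continuous p₁)
    (hp₂ : Continuous p₂) {U : (Fin m → ℝ) → ℂ} {V : (Fin n → ℝ) → ℂ} (hU : Continuous U)
    (hV : Continuous V) (hUc : HasCompactSupport U) (hVc : HasCompactSupport V) (N : ℕ) {q MU MV : ℝ}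
    (hq : 0 ≤ q) (hMU : 0 ≤ MU) (hMV : 0 ≤ MV)
    (hw : ∀ η, 1 + (p₂ η).1 / μ ≠ 0)
    (hUb : ∀ j ≤ N, ∀ x ∈ tsupport φ, nsq δ (fun θ => mexp (p₁ θ) x * (1 + (p₁ θ).1 / μ) ^ (N - j) * U θ) ≤
      ENNReal.ofReal (MU * stretch α ((N - j : ℕ) + q)) ^ 2)
    (hVb : ∀ x ∈ tsupport φ, nsq δ (fun η => mexp (-p₂ η) x * ((1 + (p₂ η).1 / μ) ^ N)⁻¹ * V η) ≤
      ENNReal.ofReal MV ^ 2) :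
    ‖∫ z : (Fin m → ℝ) × (Fin n → ℝ), U z.1 * V z.2 * (fourierMink φ (p₁ z.1 - p₂ z.2) * k z.1 z.2)‖ₑ ≤
      C * ENNReal.ofReal (CG * MU * MV * (1 + |μ|⁻¹) ^ N * stretch α (N + 3 + q)) := by
  set c : ℕ → ℂ := fun j => (N.choose j : ℂ) * (-Complex.I / μ) ^ j * (1 / (2 * Real.pi)) with hc
  set UU : ℕ → ℝ × ℝ → (Fin m → ℝ) → ℂ := fun j x θ => mexp (p₁ θ) x * (1 + (p₁ θ).1 / μ) ^ (N - j) * U θ with hUU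
  set VV : ℝ × ℝ → (Fin n → ℝ) → ℂ := fun x η => mexp (-p₂ η) x * ((1 + (p₂ η).1 / μ) ^ N)⁻¹ * V η with hVV
  have hUUc (j : ℕ) : Continuous (Function.uncurry (UU j)) := by
    refine ((continuous_mexp.comp ((hp₁.comp continuous_snd).prodMk continuous_fst)).mul ?_).mul
      (hU.comp continuous_snd)
    exact (continuous_const.add (((continuous_fst.comp hp₁).comp continuous_snd).div_const _)).pow _
  have hVVc : Continuous (Function.uncurry VV) := by
    refine ((continuous_mexp.comp (((hp₂.comp continuous_snd).neg).prodMk continuous_fst)).mul ?_).mul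
      (hV.comp continuous_snd)
    refine Continuous.inv₀ ?_ fun z => pow_ne_zero N (hw z.2)
    exact (continuous_const.add (((continuous_fst.comp hp₂).comp continuous_snd).div_const _)).pow _
  have hU0 (j : ℕ) (x : ℝ × ℝ) (θ : Fin m → ℝ) (hθ : θ ∉ tsupport U) : UU j x θ = 0 := by
    simp only [hUU, image_eq_zero_of_notMem_tsupport hθ, mul_zero]
  have hV0 (x : ℝ × ℝ) (η : Fin n → ℝ) (hη : η ∉ tsupport V) : VV x η = 0 := by
    simp only [hVV, image_eq_zero_of_notMem_tsupport hη, mul_zero]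
  have hγc (j : ℕ) := (iterLine (1, 0) j φ).continuous
  have hγs (j : ℕ) := (iterLine (1, 0) j φ).hasCompactSupport
  have hterm (j : ℕ) (hj : j ≤ N) :
      ‖∫ z : (Fin m → ℝ) × (Fin n → ℝ), k z.1 z.2 * ∫ x, iterLine (1, 0) j φ x * (UU j x z.1 * VV x z.2)‖ₑ ≤
        C * ENNReal.ofReal (CG * MU * MV * stretch α (N + 3 + q)) := by
    refine (enorm_integral_superposition_le h (hγc j) (hγs j) (hUUc j) hVVc hUc.isCompact hVc.isCompact
      (hU0 j) hV0 ENNReal.ofReal_ne_top ENNReal.ofReal_ne_top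
      (fun x hx => hUb j hj x (tsupport_iterLine_subset _ j φ hx))
      (fun x hx => hVb x (tsupport_iterLine_subset _ j φ hx))).trans ?_
    have h1 := stretch_pos hα (by positivity : (0 : ℝ) ≤ (N - j : ℕ) + q)
    have h2 := stretch_pos hα (by positivity : (0 : ℝ) ≤ (j : ℝ) + 3)
    calc _ ≤ C * ENNReal.ofReal (MU * stretch α ((N - j : ℕ) + q)) * ENNReal.ofReal MV *
          ENNReal.ofReal (CG * stretch α (j + 3)) := by gcongr; exact hG j
      _ = C * ENNReal.ofReal (MU * stretch α ((N - j : ℕ) + q) * MV * (CG * stretch α (j + 3))) := by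
          rw [mul_assoc, mul_assoc, ← ENNReal.ofReal_mul hMV, ← ENNReal.ofReal_mul (by positivity), mul_assoc _ MV]
      _ ≤ _ := by
          refine mul_le_mul' le_rfl (ENNReal.ofReal_le_ofReal ?_)
          -- The `N - j` energy factors and the `j` derivatives add up to the same index for every
          -- `j`, so all terms of the binomial sum have the same bound.
          have h3 := stretch_mul_stretch_le hα (by positivity : (0 : ℝ) ≤ (N - j : ℕ) + q)
            (by positivity : (0 : ℝ) ≤ (j : ℝ) + 3)
          have e : ((N - j : ℕ) : ℝ) + q + (j + 3) = N + 3 + q := by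
            rw [Nat.cast_sub hj]; ring
          rw [e] at h3
          calc _ = CG * MU * MV * (stretch α ((N - j : ℕ) + q) * stretch α (j + 3)) := by ring
            _ ≤ _ := by gcongr
  have hint (j : ℕ) : Integrable fun z : (Fin m → ℝ) × (Fin n → ℝ) =>
      k z.1 z.2 * ∫ x, iterLine (1, 0) j φ x * (UU j x z.1 * VV x z.2) := by
    have := (integrable_superposition h (hγc j) (hγs j) (hUUc j) hVVc hUc.isCompact hVc.isCompact
      (hU0 j) hV0).integral_prod_left
    simpa only [integral_const_mul] using this
  have hsum (z : (Fin m → ℝ) × (Fin n → ℝ)) : U z.1 * V z.2 * (fourierMink φ (p₁ z.1 - p₂ z.2) * k z.1 z.2) =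
      ∑ j ∈ Finset.range (N + 1), c j * (k z.1 z.2 * ∫ x, iterLine (1, 0) j φ x * (UU j x z.1 * VV x z.2)) := by
    rw [mul_fourierMink_eq_sum φ hμ N _ _ (hw z.2), Finset.sum_mul, Finset.mul_sum]
    refine Finset.sum_congr rfl fun j _ => ?_
    have e : ∫ x, iterLine (1, 0) j φ x * (UU j x z.1 * VV x z.2) = (U z.1 * V z.2) *
        ∫ x, iterLine (1, 0) j φ x * ((mexp (p₁ z.1) x * (1 + (p₁ z.1).1 / μ) ^ (N - j)) *
          (mexp (-p₂ z.2) x * ((1 + (p₂ z.2).1 / μ) ^ N)⁻¹)) := by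
      rw [← integral_const_mul]
      refine integral_congr_ae (Eventually.of_forall fun x => ?_)
      simp only [hUU, hVV]
      ring
    rw [e, hc]
    ring
  simp only [hsum]
  rw [integral_finsetSum _ fun j _ => (hint j).const_mul (c j)]
  refine (enorm_sum_le _ _).trans ?_
  have hcj (j : ℕ) : ‖c j‖ₑ ≤ ENNReal.ofReal (N.choose j * |μ|⁻¹ ^ j) := by
    rw [← ofReal_norm]
    refine ENNReal.ofReal_le_ofReal ?_
    have hpi : ‖(1 / (2 * Real.pi) : ℂ)‖ ≤ 1 := by
      rw [norm_div, norm_one, norm_mul, Complex.norm_two, Complex.norm_real, Real.norm_of_nonneg Real.pi_pos.le]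
      exact div_le_one_of_le₀ (by linarith [Real.pi_gt_three]) (by positivity)
    rw [hc]
    simp only [norm_mul, norm_pow, norm_div, norm_neg, Complex.norm_I, Complex.norm_natCast, Complex.norm_real,
      Real.norm_eq_abs μ] at hpi ⊢
    rw [one_div |μ|]
    exact mul_le_of_le_one_right (by positivity) hpi
  calc _ ≤ ∑ j ∈ Finset.range (N + 1), ENNReal.ofReal (N.choose j * |μ|⁻¹ ^ j) *
        (C * ENNReal.ofReal (CG * MU * MV * stretch α (N + 3 + q))) := by
        refine Finset.sum_le_sum fun j hj => ?_
        rw [integral_const_mul, enorm_mul]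
        exact mul_le_mul' (hcj j) (hterm j (Nat.lt_succ_iff.1 (Finset.mem_range.1 hj)))
    _ = ENNReal.ofReal ((1 + |μ|⁻¹) ^ N) * (C * ENNReal.ofReal (CG * MU * MV * stretch α (N + 3 + q))) := by
        rw [← Finset.sum_mul, ← ENNReal.ofReal_sum_of_nonneg fun j _ => by positivity]
        congr 2
        -- The binomial coefficients sum to `(1 + |μ|⁻¹)^N`.
        rw [add_comm 1 |μ|⁻¹, add_pow]
        refine Finset.sum_congr rfl fun j _ => ?_
        ring
    _ = _ := by
        rw [mul_left_comm, ← ENNReal.ofReal_mul (by positivity)]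
        congr 2; ring

/-! ### The damped kernel -/

theorem wtPi_le {δ : ℝ} (hδ : 0 ≤ δ) {m : ℕ} (θ : Fin m → ℝ) :
    wtPi δ θ ≤ ENNReal.ofReal ((2 * (1 + energy θ)) ^ (δ * m)) := by
  have h0 : 0 ≤ 2 * (1 + energy θ) := by linarith [energy_nonneg θ]
  calc wtPi δ θ ≤ ∏ _j : Fin m, ENNReal.ofReal ((2 * (1 + energy θ)) ^ δ) := by
        refine Finset.prod_le_prod' fun j _ => ENNReal.ofReal_le_ofReal ?_
        rw [mul_comm, Real.exp_mul]
        exact Real.rpow_le_rpow (Real.exp_pos _).le (exp_abs_le_energy θ j) hδ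
    _ = _ := by
        rw [Fin.prod_const, ← ENNReal.ofReal_pow (Real.rpow_nonneg h0 _), ← Real.rpow_natCast, ← Real.rpow_mul h0]

/-- The product weight is at most `(2(1+E))^(δm)`, a number not less than one and thus at most its
own square; it may therefore be put next to `‖U‖` inside the square. -/
theorem nsq_le_of_norm_mul_le {δ : ℝ} (hδ : 0 ≤ δ) {m : ℕ} {U u : (Fin m → ℝ) → ℂ} {M : ℝ} (hM : 0 ≤ M)
    (h : ∀ θ, ‖U θ‖ * (2 * (1 + energy θ)) ^ (δ * m) ≤ M * ‖u θ‖) (hu : eLpNorm u 2 volume ≤ 1) :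
    nsq δ U ≤ ENNReal.ofReal M ^ 2 := by
  have hu2 : ∫⁻ θ, ‖u θ‖ₑ ^ 2 ≤ 1 := by
    rw [eLpNorm_eq_lintegral_rpow_enorm_toReal two_ne_zero ENNReal.ofNat_ne_top] at hu
    simp only [ENNReal.toReal_ofNat, ENNReal.rpow_ofNat] at hu
    rw [← ennreal_sqrt_sq (∫⁻ θ, ‖u θ‖ₑ ^ 2)]
    exact pow_le_one' hu 2
  calc nsq δ U ≤ ∫⁻ θ, ENNReal.ofReal M ^ 2 * ‖u θ‖ₑ ^ 2 := by
        refine lintegral_mono fun θ => ?_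
        have h1 : 1 ≤ 2 * (1 + energy θ) := by linarith [energy_nonneg θ]
        set W := (2 * (1 + energy θ)) ^ (δ * m) with hW
        have hW1 : 1 ≤ W := Real.one_le_rpow h1 (by positivity)
        calc ‖U θ‖ₑ ^ 2 * wtPi δ θ ≤ ENNReal.ofReal ‖U θ‖ ^ 2 * ENNReal.ofReal (W ^ 2) := by
              rw [ofReal_norm]
              refine mul_le_mul' le_rfl ((wtPi_le hδ θ).trans (ENNReal.ofReal_le_ofReal ?_))
              nlinarith
          _ = ENNReal.ofReal ((‖U θ‖ * W) ^ 2) := by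
              rw [← ENNReal.ofReal_pow (norm_nonneg _), ← ENNReal.ofReal_mul (by positivity), mul_pow]
          _ ≤ ENNReal.ofReal ((M * ‖u θ‖) ^ 2) := by
              have := h θ
              refine ENNReal.ofReal_le_ofReal (pow_le_pow_left₀ (by positivity) this 2)
          _ = _ := by
              rw [mul_pow, ENNReal.ofReal_mul (by positivity), ENNReal.ofReal_pow hM,
                ENNReal.ofReal_pow (norm_nonneg _), ofReal_norm]
    _ = ENNReal.ofReal M ^ 2 * ∫⁻ θ, ‖u θ‖ₑ ^ 2 :=
        lintegral_const_mul' _ _ (ENNReal.pow_ne_top ENNReal.ofReal_ne_top)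
    _ ≤ _ := mul_le_of_le_one_right zero_le hu2

theorem norm_cosh_le (z : ℂ) : ‖Complex.cosh z‖ ≤ Real.cosh z.re := by
  rw [Complex.cosh, Real.cosh_eq, norm_div, Complex.norm_two]
  gcongr
  refine (norm_add_le _ _).trans (le_of_eq ?_)
  rw [Complex.norm_exp, Complex.norm_exp, Complex.neg_re]

theorem momentum_fst_div {κ : ℝ} (hκ : κ ≠ 0) {m : ℕ} (ζ : Fin m → ℂ) :
    (momentum κ ζ).1 / κ = ∑ j, Complex.cosh (ζ j) := by
  have : (κ : ℂ) ≠ 0 := by exact_mod_cast hκ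
  rw [momentum, ← Finset.mul_sum, mul_div_cancel_left₀ _ this]

theorem norm_one_add_momentum_le {κ : ℝ} (hκ : κ ≠ 0) {m : ℕ} (a θ : Fin m → ℝ) :
    ‖1 + (momentum κ (cshift a θ)).1 / κ‖ ≤ 1 + energy θ := by
  rw [momentum_fst_div hκ]
  refine (norm_add_le _ _).trans ?_
  rw [norm_one]
  refine add_le_add le_rfl ((norm_sum_le _ _).trans (Finset.sum_le_sum fun j _ => ?_))
  simpa [cshift] using norm_cosh_le (cshift a θ j)

theorem cosh_cshift_re {m : ℕ} (a θ : Fin m → ℝ) (j : Fin m) :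
    (Complex.cosh (cshift a θ j)).re = Real.cosh (θ j) * Real.cos (a j) := by
  rw [cshift, mul_comm Complex.I, Complex.cosh_add, Complex.cosh_mul_I, Complex.sinh_mul_I, ← Complex.ofReal_cosh,
    ← Complex.ofReal_sinh, ← Complex.ofReal_cos, ← Complex.ofReal_sin, ← mul_assoc,
    ← Complex.ofReal_mul, ← Complex.ofReal_mul, Complex.add_re, Complex.ofReal_re, Complex.re_ofReal_mul,
    Complex.I_re, mul_zero, add_zero]

/-- The real part of `cosh (θ + ia)` is `cosh θ cos a`, so for small imaginary parts the complex
energy is comparable to the real one. -/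
theorem le_norm_one_add_momentum {κ : ℝ} (hκ : κ ≠ 0) {m : ℕ} {a : Fin m → ℝ} {c : ℝ} (hc1 : c ≤ 1)
    (h : ∀ j, c ≤ Real.cos (a j)) (θ : Fin m → ℝ) :
    c * (1 + energy θ) ≤ ‖1 + (momentum κ (cshift a θ)).1 / κ‖ := by
  refine le_trans ?_ (Complex.re_le_norm _)
  rw [momentum_fst_div hκ, Complex.add_re, Complex.one_re, Complex.re_sum, mul_add, mul_one, energy, Finset.mul_sum]
  refine add_le_add hc1 (Finset.sum_le_sum fun j _ => ?_)
  rw [cosh_cshift_re, mul_comm]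
  exact mul_le_mul_of_nonneg_left (h j) (Real.cosh_pos _).le

theorem continuous_cshift {m : ℕ} : Continuous fun p : (Fin m → ℝ) × (Fin m → ℝ) => cshift p.1 p.2 := by
  unfold cshift; fun_prop

theorem continuous_cshift_right {m : ℕ} (a : Fin m → ℝ) : Continuous fun θ => cshift a θ :=
  continuous_cshift.comp (f := fun θ => (a, θ)) (by fun_prop)

theorem continuous_momentum_cshift (κ : ℝ) {m : ℕ} (a : Fin m → ℝ) :
    Continuous fun θ => momentum κ (cshift a θ) :=
  (contDiff_momentum (n := 0) κ).continuous.comp (continuous_cshift_right a)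

theorem damp_apply (α : ℝ) {m : ℕ} (u : Test m) (θ : Fin m → ℝ) :
    damp α u θ = ((Real.exp (-omega α (energy θ)) : ℝ) : ℂ) * u θ := rfl

/-- On the damped side, the `N - j` energy factors, the degree `d` and the weight `δ m` are absorbed
by `exp (-E^α)`. On the other side, `N` inverse powers of the energy outweigh the degree `d` and the
weight `δ n`. The assumptions on `mexp` and on the momentum of the right variables express that the
imaginary parts are small; they cost factors of two. -/
theorem BddKer.enorm_integral_damp_le {δ : ℝ} (hδ : 0 ≤ δ) {m n : ℕ} {C : ℝ≥0∞}
    {k : (Fin m → ℝ) → (Fin n → ℝ) → ℂ} (h : BddKer δ C k) {α : ℝ} (hα : 0 < α) (hα1 : α < 1) (φ : MinkTest)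
    {CG : ℝ} (hCG : 0 ≤ CG)
    (hG : ∀ j : ℕ, ∫⁻ x, ‖iterLine (1, 0) j φ x‖ₑ ≤ ENNReal.ofReal (CG * stretch α (j + 3)))
    {κ : ℝ} (hκ : κ ≠ 0) (a : Fin m → ℝ) (b : Fin n → ℝ) {A : (Fin m → ℝ) → ℂ} {B : (Fin n → ℝ) → ℂ}
    (hA : Continuous A) (hB : Continuous B) {CP : ℝ} {d : ℕ} (hCP : 0 ≤ CP)
    (hAb : ∀ θ, ‖A θ‖ ≤ CP * (1 + energy θ) ^ d) (hBb : ∀ η, ‖B η‖ ≤ CP * (1 + energy η) ^ d)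
    (u : Test m) (v : Test n) (hu : eLpNorm u 2 volume ≤ 1) (hv : eLpNorm v 2 volume ≤ 1) {N : ℕ}
    (hN : d + δ * n ≤ N)
    (hxu : ∀ x ∈ tsupport φ, ∀ θ ∈ tsupport u, ‖mexp (momentum κ (cshift a θ)) x‖ ≤ 2)
    (hxv : ∀ x ∈ tsupport φ, ∀ η ∈ tsupport v, ‖mexp (-momentum κ (cshift b η)) x‖ ≤ 2)
    (hb0 : ∀ η, 1 + (momentum κ (cshift b η)).1 / κ ≠ 0)
    (hb : ∀ η, (1 + energy η) ^ N ≤ 2 * ‖1 + (momentum κ (cshift b η)).1 / κ‖ ^ N) :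
    ‖∫ z : (Fin m → ℝ) × (Fin n → ℝ), (A z.1 * damp α u z.1) * (B z.2 * v z.2) *
      (fourierMink φ (momentum κ (cshift a z.1) - momentum κ (cshift b z.2)) * k z.1 z.2)‖ₑ ≤
      C * ENNReal.ofReal (CG * (2 * CP * 2 ^ (δ * m)) * (4 * CP * 2 ^ (δ * n)) * (1 + |κ|⁻¹) ^ N *
        stretch α (N + 3 + (d + δ * m))) := by
  refine h.enorm_integral_fourierMink_le hα φ hCG hG hκ (continuous_momentum_cshift κ a)
    (continuous_momentum_cshift κ b) (U := fun θ => A θ * damp α u θ)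
    (V := fun η => B η * v η)
    (hA.mul (damp α u).continuous) (hB.mul v.continuous) (damp α u).hasCompactSupport.mul_left
    v.hasCompactSupport.mul_left N (by positivity) (by positivity) (by positivity) hb0
    (fun j hj x hx => ?_) (fun x hx => ?_)
  · have hst := stretch_pos hα (by positivity : (0 : ℝ) ≤ (N - j : ℕ) + (d + δ * m))
    refine nsq_le_of_norm_mul_le hδ (by positivity) (u := u) (fun θ => ?_) hu
    by_cases hθ : θ ∈ tsupport u
    · have he := energy_nonneg θ
      have h1 := hxu x hx θ hθ
      have h2 : ‖(1 + (momentum κ (cshift a θ)).1 / κ) ^ (N - j)‖ ≤ (1 + energy θ) ^ (N - j) := by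
        rw [norm_pow]; exact pow_le_pow_left₀ (norm_nonneg _) (norm_one_add_momentum_le hκ a θ) _
      have h3 := hAb θ
      have h4 := one_add_rpow_mul_exp_le hα hα1 (by positivity : (0 : ℝ) ≤ (N - j : ℕ) + (d + δ * m)) he
      have h5 : ‖damp α u θ‖ = Real.exp (-energy θ ^ α) * ‖u θ‖ := by
        rw [damp_apply, norm_mul, Complex.norm_real, Real.norm_of_nonneg (Real.exp_pos _).le, omega]
      rw [norm_mul, norm_mul, norm_mul, h5]
      calc _ ≤ 2 * (1 + energy θ) ^ (N - j) * (CP * (1 + energy θ) ^ d * (Real.exp (-energy θ ^ α) * ‖u θ‖)) *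
            (2 * (1 + energy θ)) ^ (δ * m) := by gcongr
        _ = 2 * CP * 2 ^ (δ * m) * ((1 + energy θ) ^ (((N - j : ℕ) : ℝ) + (d + δ * m)) *
              Real.exp (-energy θ ^ α)) * ‖u θ‖ := by
            rw [Real.rpow_add (by positivity), Real.rpow_add (by positivity), Real.rpow_natCast, Real.rpow_natCast,
              Real.mul_rpow two_pos.le (by positivity)]
            ring
        _ ≤ _ := by
            refine mul_le_mul_of_nonneg_right ?_ (norm_nonneg _)
            exact mul_le_mul_of_nonneg_left h4 (by positivity)
    · have : damp α u θ = 0 := by rw [damp_apply, image_eq_zero_of_notMem_tsupport hθ, mul_zero]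
      rw [this]
      simp only [mul_zero, norm_zero, zero_mul]
      positivity
  · refine nsq_le_of_norm_mul_le hδ (by positivity) (u := v) (fun η => ?_) hv
    by_cases hη : η ∈ tsupport v
    · have he := energy_nonneg η
      have h1 := hxv x hx η hη
      have hpos : 0 < ‖1 + (momentum κ (cshift b η)).1 / κ‖ ^ N := pow_pos (norm_pos_iff.2 (hb0 η)) N
      have h2 : ‖((1 + (momentum κ (cshift b η)).1 / κ) ^ N)⁻¹‖ ≤ 2 * ((1 + energy η) ^ N)⁻¹ := by
        rw [norm_inv, norm_pow, inv_le_iff_one_le_mul₀ hpos, mul_assoc, mul_left_comm, ← div_eq_inv_mul,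
          le_div_iff₀ (by positivity), one_mul]
        exact hb η
      have h3 := hBb η
      have h4 : (1 + energy η) ^ (d + δ * n) ≤ (1 + energy η) ^ N := by
        rw [← Real.rpow_natCast (1 + energy η) N]
        exact Real.rpow_le_rpow_of_exponent_le (by linarith) hN
      rw [norm_mul, norm_mul, norm_mul]
      calc _ ≤ 2 * (2 * ((1 + energy η) ^ N)⁻¹) * (CP * (1 + energy η) ^ d * ‖v η‖) *
            (2 * (1 + energy η)) ^ (δ * n) := by gcongr
        _ = 4 * CP * 2 ^ (δ * n) * (((1 + energy η) ^ N)⁻¹ * (1 + energy η) ^ (d + δ * n)) * ‖v η‖ := by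
            rw [Real.rpow_add (by positivity), Real.rpow_natCast, Real.mul_rpow two_pos.le (by positivity)]
            ring
        _ ≤ 4 * CP * 2 ^ (δ * n) * 1 * ‖v η‖ := by
            gcongr
            rw [← div_eq_inv_mul]
            exact div_le_one_of_le₀ h4 (by positivity)
        _ = _ := by ring
    · rw [image_eq_zero_of_notMem_tsupport hη]
      simp only [mul_zero, norm_zero, zero_mul]
      positivity

/-! ### Boundary values of the functions `F` -/

theorem cothHalf_neg (z : ℂ) : cothHalf (-z) = -cothHalf z := by
  rw [cothHalf, cothHalf, neg_div, Complex.tanh_neg, inv_neg]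

theorem exists_Dker_swap (m n : ℕ) : ∃ s : ℂ, ‖s‖ ≤ 1 ∧ ∀ (θ : Fin m → ℂ) (η : Fin n → ℂ),
    Dker θ η = s * Dker η θ := by
  refine ⟨((-1) ^ m) ^ n, by simp, fun θ η => ?_⟩
  have h : ∏ i, ∏ j, cothHalf (θ i - η j) = ((-1) ^ m) ^ n * ∏ j, ∏ i, cothHalf (η j - θ i) := by
    rw [Finset.prod_comm]
    have (j : Fin n) : ∏ i, cothHalf (θ i - η j) = (-1) ^ m * ∏ i, cothHalf (η j - θ i) := by
      have (i : Fin m) : cothHalf (θ i - η j) = -1 * cothHalf (η j - θ i) := by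
        rw [← neg_sub, cothHalf_neg, neg_one_mul]
      simp only [this, Finset.prod_mul_distrib, Fin.prod_const]
    simp only [this, Finset.prod_mul_distrib, Fin.prod_const]
  rw [Dker, Dker, h]
  ring

theorem SmallShift.swap {m n : ℕ} {a : Fin m → ℝ} {b : Fin n → ℝ} (h : SmallShift a b) : SmallShift b a where
  left := h.right
  right := h.left
  cross i j := (h.cross j i).symm
  left_le := h.right_le
  right_le := h.left_le

/-- Up to a sign `Dker` is symmetric under exchange of the two groups, so the expansion can be
carried out in the smaller one. For fixed `n` the power of `m + n + 1` is then at most `n`, hence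
harmless, in both `f_{mn}` and `f_{nm}`. -/
theorem exists_bddKer_Dker_min {δ : ℝ} (hδ : 0 < δ) : ∃ Q : ℝ≥0∞, Q ≠ ⊤ ∧ ∀ (n m : ℕ) (a : Fin m → ℝ)
    (b : Fin n → ℝ), SmallShift a b →
      BddKer δ (Q ^ (m + n) * (m + n + 1 : ℕ) ^ (min m n)) (fun θ η => Dker (cshift a θ) (cshift b η)) := by
  obtain ⟨Q, hQ, h⟩ := exists_bddKer_Dker hδ
  refine ⟨Q, hQ, fun n m a b hab => ?_⟩
  rcases le_total m n with hmn | hmn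
  · rw [min_eq_left hmn]
    obtain ⟨s, hs, he⟩ := exists_Dker_swap m n
    refine ((((h m n b a hab.swap).swap).const_mul hs).congr fun θ η => he _ _).mono (le_of_eq ?_)
    rw [add_comm n m]
  · rw [min_eq_right hmn]; exact h n m a b hab

/-- With the mass `-μ` the difference of momenta changes its sign, so the estimate with damping on
the left also covers damping on the right. -/
theorem momentum_neg_mass (κ : ℝ) {m : ℕ} (ζ : Fin m → ℂ) : momentum (-κ) ζ = -momentum κ ζ := by
  simp [momentum, Finset.sum_neg_distrib]

theorem momentum_append {m n : ℕ} (κ : ℝ) (ζ : Fin m → ℂ) (ξ : Fin n → ℂ) :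
    momentum κ (Fin.append ζ fun j => ξ j + Complex.I * Real.pi) = momentum κ ζ - momentum κ ξ := by
  have h1 (z : ℂ) : Complex.cosh (z + Complex.I * Real.pi) = -Complex.cosh z := by
    rw [mul_comm, Complex.cosh_add, Complex.cosh_mul_I, Complex.sinh_mul_I]; simp
  have h2 (z : ℂ) : Complex.sinh (z + Complex.I * Real.pi) = -Complex.sinh z := by
    rw [mul_comm, Complex.sinh_add, Complex.cosh_mul_I, Complex.sinh_mul_I]; simp
  simp only [momentum, Fin.sum_univ_add, Fin.append_left, Fin.append_right, h1, h2, mul_neg,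
    Finset.sum_neg_distrib, Prod.mk_sub_mk]
  rw [sub_eq_add_neg, sub_eq_add_neg]

theorem exp_append {m n : ℕ} (ζ : Fin m → ℂ) (ξ : Fin n → ℂ) :
    (fun i => Complex.exp (Fin.append ζ (fun j => ξ j + Complex.I * Real.pi) i)) =
      Fin.append (fun i => Complex.exp (ζ i)) fun j => -Complex.exp (ξ j) := by
  funext i
  induction i using Fin.addCases with
  | left i => simp
  | right i => rw [Fin.append_right, Fin.append_right, Complex.exp_add, mul_comm Complex.I, Complex.exp_pi_mul_I]; ring

theorem norm_exp_cshift {m : ℕ} (a θ : Fin m → ℝ) (j : Fin m) :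
    ‖Complex.exp (cshift a θ j)‖ = Real.exp (θ j) := by
  rw [Complex.norm_exp]; simp [cshift]

theorem norm_mexp_ofReal (s t : ℝ) (x : ℝ × ℝ) : ‖mexp ((s : ℂ), (t : ℂ)) x‖ = 1 := by
  have : mexp ((s : ℂ), (t : ℂ)) x = Complex.exp (((s * x.1 - t * x.2 : ℝ) : ℂ) * Complex.I) := by
    rw [mexp, mul_comm]; push_cast; rfl
  rw [this, Complex.norm_exp_ofReal_mul_I]

/-- At real points the modulus is one, and near them it is at most two by compactness. The
neighbourhood depends on the supports of the test functions, which is harmless because the boundary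
limit is taken before the supremum. -/
theorem eventually_norm_mexp_le (κ : ℝ) {m : ℕ} {K₁ : Set (ℝ × ℝ)} {K₂ : Set (Fin m → ℝ)} (hK₁ : IsCompact K₁)
    (hK₂ : IsCompact K₂) :
    ∀ᶠ a in 𝓝 (0 : Fin m → ℝ), ∀ x ∈ K₁, ∀ θ ∈ K₂, ‖mexp (momentum κ (cshift a θ)) x‖ ≤ 2 := by
  have hc : Continuous fun q : (Fin m → ℝ) × ((ℝ × ℝ) × (Fin m → ℝ)) =>
      ‖mexp (momentum κ (cshift q.1 q.2.2)) q.2.1‖ := by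
    refine (continuous_mexp.comp (f := fun q : (Fin m → ℝ) × ((ℝ × ℝ) × (Fin m → ℝ)) =>
      (momentum κ (cshift q.1 q.2.2), q.2.1)) (Continuous.prodMk ?_ (by fun_prop))).norm
    exact (contDiff_momentum (n := 0) κ).continuous.comp (continuous_cshift.comp
      (f := fun q : (Fin m → ℝ) × ((ℝ × ℝ) × (Fin m → ℝ)) => (q.1, q.2.2)) (by fun_prop))
  have h := (hK₁.prod hK₂).eventually_forall_of_forall_eventually (x₀ := (0 : Fin m → ℝ))
    (P := fun a q => ‖mexp (momentum κ (cshift a q.2)) q.1‖ ≤ 2) fun q _ => ?_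
  · filter_upwards [h] with a ha x hx θ hθ using ha (x, θ) ⟨hx, hθ⟩
  · have h1 : ‖mexp (momentum κ (cshift 0 q.2)) q.1‖ = 1 := by
      have e : momentum κ (cshift 0 q.2) = (((∑ j, κ * Real.cosh (q.2 j) : ℝ) : ℂ),
          ((∑ j, κ * Real.sinh (q.2 j) : ℝ) : ℂ)) := by
        simp [momentum, cshift]
      rw [e, norm_mexp_ofReal]
    have h2 := hc.tendsto ((0 : Fin m → ℝ), q)
    rw [h1] at h2
    exact (h2.eventually (gt_mem_nhds one_lt_two)).mono fun _ hp => hp.le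

theorem eventually_energy_le {κ : ℝ} (hκ : κ ≠ 0) (n N : ℕ) : ∀ᶠ b in 𝓝 (0 : Fin n → ℝ),
    (∀ η, 1 + (momentum κ (cshift b η)).1 / κ ≠ 0) ∧
      ∀ η, (1 + energy η) ^ N ≤ 2 * ‖1 + (momentum κ (cshift b η)).1 / κ‖ ^ N := by
  -- All cosines of the imaginary parts should exceed `c`; the condition `c^N > 1/2` makes the total
  -- loss at most a factor of two.
  obtain ⟨c, ⟨hc0, hc1⟩, hcN⟩ : ∃ c : ℝ, (0 < c ∧ c < 1) ∧ 1 / 2 < c ^ N := by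
    have h1 : ∀ᶠ c in 𝓝[<] (1 : ℝ), 1 / 2 < c ^ N := by
      have := (continuous_pow (M := ℝ) N).tendsto 1
      rw [one_pow] at this
      exact nhdsWithin_le_nhds (this.eventually (lt_mem_nhds (by norm_num)))
    exact (Filter.Eventually.and (Ioo_mem_nhdsLT (zero_lt_one' ℝ)) h1).exists
  have h2 : ∀ᶠ b in 𝓝 (0 : Fin n → ℝ), ∀ j, c ≤ Real.cos (b j) := by
    refine eventually_all.2 fun j => ?_
    have : Tendsto (fun b : Fin n → ℝ => Real.cos (b j)) (𝓝 0) (𝓝 1) := by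
      have h : Continuous fun b : Fin n → ℝ => Real.cos (b j) := by fun_prop
      simpa using h.tendsto 0
    exact (this.eventually (lt_mem_nhds hc1)).mono fun _ h => h.le
  filter_upwards [h2] with b hb
  have h3 (η : Fin n → ℝ) := le_norm_one_add_momentum hκ hc1.le hb η
  have h4 (η : Fin n → ℝ) := one_le_one_add_energy η
  refine ⟨fun η h0 => ?_, fun η => ?_⟩
  · have := h3 η
    rw [h0, norm_zero] at this
    exact absurd this (not_le.2 (mul_pos hc0 (zero_lt_one.trans_le (h4 η))))
  · have h5 := pow_le_pow_left₀ (mul_nonneg hc0.le (zero_le_one.trans (h4 η))) (h3 η) N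
    rw [mul_pow] at h5
    have h6 : 0 ≤ (1 + energy η) ^ N := pow_nonneg (zero_le_one.trans (h4 η)) N
    nlinarith

/-- The imaginary parts of the left variables. -/
def leftIm {m n : ℕ} (l : Fin (m + n) → ℝ) : Fin m → ℝ := fun i => l (Fin.castAdd n i)

/-- The imaginary parts of the right variables, relative to `π`. -/
noncomputable def rightIm {m n : ℕ} (l : Fin (m + n) → ℝ) : Fin n → ℝ := fun j => l (Fin.natAdd m j) - Real.pi

theorem tendsto_leftIm (m n : ℕ) : Tendsto leftIm (𝓝[Iplus (m + n)] upperNode m n) (𝓝 (0 : Fin m → ℝ)) := by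
  have h : Continuous (leftIm : (Fin (m + n) → ℝ) → (Fin m → ℝ)) := by unfold leftIm; fun_prop
  have := h.tendsto (upperNode m n)
  have e : leftIm (upperNode m n) = (0 : Fin m → ℝ) := by funext i; simp [leftIm, upperNode]
  rw [e] at this
  exact this.mono_left nhdsWithin_le_nhds

theorem tendsto_rightIm (m n : ℕ) : Tendsto rightIm (𝓝[Iplus (m + n)] upperNode m n) (𝓝 (0 : Fin n → ℝ)) := by
  have h : Continuous (rightIm : (Fin (m + n) → ℝ) → (Fin n → ℝ)) := by unfold rightIm; fun_prop
  have := h.tendsto (upperNode m n)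
  have e : rightIm (upperNode m n) = (0 : Fin n → ℝ) := by funext i; simp [rightIm, upperNode]
  rw [e] at this
  exact this.mono_left nhdsWithin_le_nhds

/-- Imaginary parts in `𝓘_+` increase strictly, which separates the variables within each group;
across the groups the left ones are positive and the right ones negative relative to `π`. -/
theorem eventually_smallShift (m n : ℕ) : ∀ᶠ l in 𝓝[Iplus (m + n)] upperNode m n,
    SmallShift (leftIm l : Fin m → ℝ) (rightIm l : Fin n → ℝ) := by
  have hself : ∀ᶠ l in 𝓝[Iplus (m + n)] upperNode m n, l ∈ Iplus (m + n) := self_mem_nhdsWithin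
  have hpi := Real.pi_pos
  filter_upwards [hself, eventually_nearNode m n (div_pos hpi four_pos)] with l hl hn
  refine ⟨fun i k hik => ?_, fun i k hik => ?_, fun i j => ?_, fun i => ?_, fun i => ?_⟩
  · exact fun h => hik (Fin.castAdd_injective m n (hl.1.injective h))
  · exact fun h => hik (Fin.natAdd_injective n m (hl.1.injective (sub_left_injective h)))
  · have h1 := (hl.2 (Fin.castAdd n i)).1
    have h2 := (hl.2 (Fin.natAdd m j)).2
    simp only [leftIm, rightIm]
    intro h
    linarith
  · rw [abs_le]
    simp only [leftIm]
    constructor <;> linarith [(hn.1 i).1, (hn.1 i).2]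
  · rw [abs_le]
    simp only [rightIm]
    constructor <;> linarith [(hn.2 i).1, (hn.2 i).2]

theorem norm_one_div_two_pi_I_pow_le (k : ℕ) : ‖(1 / (2 * Real.pi * Complex.I) ^ k : ℂ)‖ ≤ 1 := by
  rw [norm_div, norm_one, norm_pow, norm_mul, norm_mul, Complex.norm_I, Complex.norm_two, Complex.norm_real,
    Real.norm_of_nonneg Real.pi_pos.le, mul_one]
  exact div_le_one_of_le₀ (one_le_pow₀ (by linarith [Real.pi_gt_three])) (by positivity)

theorem continuous_eval_exp_cshift (P : LaurentSymm) {m : ℕ} (a : Fin m → ℝ) :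
    Continuous fun θ => P.eval fun i => Complex.exp (cshift a θ i) :=
  (contDiff_eval_exp (n := 0) P).continuous.comp (continuous_cshift_right a)

theorem continuous_eval_neg_exp_cshift (P : LaurentSymm) {m : ℕ} (a : Fin m → ℝ) :
    Continuous fun θ => P.eval fun i => -Complex.exp (cshift a θ i) := by
  have h := (contDiff_eval_exp (n := 0) P).continuous.comp (f := fun θ (i : Fin m) => cshift a θ i +
    Real.pi * Complex.I) (continuous_pi fun i => ((continuous_apply i).comp (continuous_cshift_right a)).add
      continuous_const)
  refine h.congr fun θ => ?_
  simp only [Function.comp_apply, Complex.exp_add, Complex.exp_pi_mul_I, mul_neg, mul_one]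

/-- Separation of the two groups of variables in the integrals which define the boundary value. -/
theorem enorm_integral_F_le (μ : ℝ) {P : LaurentSymm} (φ : MinkTest) {ι : Type*} [Fintype ι]
    {A B : ι → LaurentSymm} {m n : ℕ}
    (hP : ∀ (x : Fin m → ℂ) (y : Fin n → ℂ), P.eval (Fin.append x y) = ∑ r, (A r).eval x * (B r).eval y)
    (l : Fin (m + n) → ℝ) {δ : ℝ} {C : ℝ≥0∞}
    (hk : BddKer δ C (fun (θ : Fin m → ℝ) (η : Fin n → ℝ) => Dker (cshift (leftIm l) θ) (cshift (rightIm l) η)))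
    (u : Test m) (v : Test n) :
    ‖∫ x, F μ P φ (m + n) (cpoint l x) * tensor u v x‖ₑ ≤ ∑ r, ‖∫ z : (Fin m → ℝ) × (Fin n → ℝ),
      ((A r).eval (fun i => Complex.exp (cshift (leftIm l) z.1 i)) * u z.1) *
      ((B r).eval (fun i => -Complex.exp (cshift (rightIm l) z.2 i)) * v z.2) *
      (fourierMink φ (momentum μ (cshift (leftIm l) z.1) - momentum μ (cshift (rightIm l) z.2)) *
        Dker (cshift (leftIm l) z.1) (cshift (rightIm l) z.2))‖ₑ := by
  by_cases hodd : Odd (m + n)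
  swap
  · simp [F, hodd]
  set κ : ℂ := 1 / (2 * Real.pi * Complex.I) ^ ((m + n) / 2) with hκ
  set Φ : ι → (Fin m → ℝ) × (Fin n → ℝ) → ℂ := fun r z =>
      ((A r).eval (fun i => Complex.exp (cshift (leftIm l) z.1 i)) * u z.1) *
      ((B r).eval (fun i => -Complex.exp (cshift (rightIm l) z.2 i)) * v z.2) *
      (fourierMink φ (momentum μ (cshift (leftIm l) z.1) - momentum μ (cshift (rightIm l) z.2)) *
        Dker (cshift (leftIm l) z.1) (cshift (rightIm l) z.2)) with hΦ
  have hsum (z : (Fin m → ℝ) × (Fin n → ℝ)) : F μ P φ (m + n) (cpoint l z) * tensor u v z = κ * ∑ r, Φ r z := by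
    have e : cpoint l z = Fin.append (cshift (leftIm l) z.1) fun j => cshift (rightIm l) z.2 j +
      Complex.I * Real.pi := cpoint_eq_append l z
    have et : tensor u v z = u z.1 * v z.2 := rfl
    rw [F, if_pos hodd, e, Modd_append, momentum_append, exp_append, hP, et, ← hκ, mul_assoc κ, mul_assoc κ,
      mul_assoc κ]
    congr 1
    rw [Finset.mul_sum, Finset.sum_mul, Finset.sum_mul]
    refine Finset.sum_congr rfl fun r _ => ?_
    rw [hΦ]
    ring
  have hint (r : ι) : Integrable (Φ r) := by
    have hU := ((continuous_eval_exp_cshift (A r) (leftIm l)).mul u.continuous)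
    have hV := ((continuous_eval_neg_exp_cshift (B r) (rightIm l)).mul v.continuous)
    have hG : Continuous fun z : (Fin m → ℝ) × (Fin n → ℝ) =>
        fourierMink φ (momentum μ (cshift (leftIm l) z.1) - momentum μ (cshift (rightIm l) z.2)) :=
      (contDiff_fourierMink φ.continuous φ.hasCompactSupport).continuous.comp
        (((continuous_momentum_cshift μ (leftIm l)).comp continuous_fst).sub
          ((continuous_momentum_cshift μ (rightIm l)).comp continuous_snd))
    have hc := ((hU.comp (continuous_fst (Y := Fin n → ℝ))).mul (hV.comp (continuous_snd (X := Fin m → ℝ)))).mul hG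
    have hs : HasCompactSupport fun z : (Fin m → ℝ) × (Fin n → ℝ) =>
        ((A r).eval (fun i => Complex.exp (cshift (leftIm l) z.1 i)) * u z.1) *
        ((B r).eval (fun i => -Complex.exp (cshift (rightIm l) z.2 i)) * v z.2) *
        fourierMink φ (momentum μ (cshift (leftIm l) z.1) - momentum μ (cshift (rightIm l) z.2)) := by
      refine HasCompactSupport.intro (u.hasCompactSupport.isCompact.prod v.hasCompactSupport.isCompact) fun z hz => ?_
      by_contra hne
      refine hz ⟨by_contra fun h1 => hne ?_, by_contra fun h2 => hne ?_⟩
      · rw [image_eq_zero_of_notMem_tsupport h1]; ring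
      · rw [image_eq_zero_of_notMem_tsupport h2]; ring
    obtain ⟨b, hb⟩ := hk.bdd
    refine ((hc.integrable_of_hasCompactSupport hs).mul_bdd (c := b) hk.meas.aestronglyMeasurable
      (Eventually.of_forall fun z => hb _ _)).congr (Eventually.of_forall fun z => ?_)
    exact mul_assoc _ _ _
  simp only [hsum]
  rw [integral_const_mul, integral_finsetSum _ fun r _ => hint r, enorm_mul]
  refine (mul_le_of_le_one_left zero_le ?_).trans (enorm_sum_le _ _)
  rw [← ofReal_norm, ENNReal.ofReal_le_one]
  exact norm_one_div_two_pi_I_pow_le _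

/-- Everything except `stretch` is exponential in `m + n + 1`. The index satisfies `N + 3 + d + δm ≤
2d + 4 + 2δ(m + n)`, since rounding up in `N` costs at most one. -/
theorem damp_const_le {α : ℝ} (hα : 0 < α) (hα1 : α < 1) {CG CP δ ν : ℝ} (hCG : 0 ≤ CG)
    (hδ : 0 < δ) (hν : 0 ≤ ν) (d m n : ℕ) :
    CG * (2 * CP * 2 ^ (δ * m)) * (4 * CP * 2 ^ (δ * n)) * (1 + ν) ^ ⌈d + δ * (m + n : ℕ)⌉₊ *
        stretch α (⌈d + δ * (m + n : ℕ)⌉₊ + 3 + (d + δ * m)) ≤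
      ((8 * CG * CP ^ 2 + 1) * 2 ^ δ * (1 + ν) ^ (d + 1 + ⌈δ⌉₊)) ^ (m + n + 1) *
        stretch α (2 * d + 4 + 2 * δ * (m + n : ℕ)) := by
  have hL : (0 : ℝ) ≤ (m + n : ℕ) := Nat.cast_nonneg _
  have hm : (m : ℝ) ≤ (m + n : ℕ) := by exact_mod_cast Nat.le_add_right m n
  have hN := (Nat.ceil_lt_add_one (by positivity : 0 ≤ d + δ * (m + n : ℕ))).le
  set N := ⌈d + δ * (m + n : ℕ)⌉₊ with hNdef
  have hdm : δ * m ≤ δ * (m + n : ℕ) := mul_le_mul_of_nonneg_left hm hδ.le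
  have h1 : stretch α (N + 3 + (d + δ * m)) ≤ stretch α (2 * d + 4 + 2 * δ * (m + n : ℕ)) :=
    stretch_mono hα hα1 (by positivity) (by linarith)
  have h2 : (1 + ν) ^ N ≤ ((1 + ν) ^ (d + 1 + ⌈δ⌉₊)) ^ (m + n + 1) := by
    rw [← pow_mul]
    refine pow_le_pow_right₀ (by linarith) ?_
    have h3 : (N : ℝ) ≤ ((d + 1 + ⌈δ⌉₊) * (m + n + 1) : ℕ) := by
      have := Nat.le_ceil δ
      push_cast at hN hL ⊢
      have h4 : δ * ((m : ℝ) + n) ≤ ⌈δ⌉₊ * ((m : ℝ) + n) := by gcongr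
      nlinarith [mul_nonneg (Nat.cast_nonneg (α := ℝ) d) hL, Nat.cast_nonneg (α := ℝ) ⌈δ⌉₊]
    exact_mod_cast h3
  have h3 : (2 : ℝ) ^ (δ * m) * 2 ^ (δ * n) ≤ (2 ^ δ) ^ (m + n + 1) := by
    rw [← Real.rpow_add two_pos, ← Real.rpow_natCast, ← Real.rpow_mul two_pos.le]
    refine Real.rpow_le_rpow_of_exponent_le one_le_two ?_
    push_cast
    nlinarith
  have h4 : 8 * CG * CP ^ 2 ≤ (8 * CG * CP ^ 2 + 1) ^ (m + n + 1) := by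
    refine le_trans (by linarith) (le_self_pow₀ (a := 8 * CG * CP ^ 2 + 1) ?_ (Nat.succ_ne_zero _))
    have : 0 ≤ 8 * CG * CP ^ 2 := by positivity
    linarith
  have h5 := (stretch_pos hα (by positivity : (0 : ℝ) ≤ N + 3 + (d + δ * m))).le
  calc _ = (8 * CG * CP ^ 2) * (2 ^ (δ * m) * 2 ^ (δ * n)) * (1 + ν) ^ N * stretch α (N + 3 + (d + δ * m)) := by ring
    _ ≤ (8 * CG * CP ^ 2 + 1) ^ (m + n + 1) * (2 ^ δ) ^ (m + n + 1) * ((1 + ν) ^ (d + 1 + ⌈δ⌉₊)) ^ (m + n + 1) *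
        stretch α (2 * d + 4 + 2 * δ * (m + n : ℕ)) := by gcongr
    _ = _ := by rw [mul_pow, mul_pow]

/-- The norms of the boundary values, with explicit dependence on the numbers of variables. -/
theorem exists_omegaNorm_le {μ : ℝ} (hμ : 0 < μ) {α : ℝ} (hα : 0 < α) (hα1 : α < 1) (P : LaurentSymm)
    (φ : MinkTest) {b : ℝ} (hb : ∀ p : ℝ × ℝ, ‖fourierMink φ ((p.1 : ℂ), (p.2 : ℂ))‖ ≤ b * Real.exp (-‖p‖ ^ α))
    {δ : ℝ} (hδ : 0 < δ) : ∃ (c : ℝ) (d : ℕ), 1 ≤ c ∧ ∀ (m n : ℕ) (f : Distr m n),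
      IsUpperBoundaryValue (F μ P φ (m + n)) f →
      omegaNorm α f ≤ ENNReal.ofReal (c ^ (m + n + 1) * (m + n + 1 : ℕ) ^ (min m n) *
        stretch α (2 * d + 4 + 2 * δ * (m + n : ℕ))) := by
  obtain ⟨CG, hCG, hG⟩ := exists_lintegral_iterLine_le hα hα1 φ hb
  obtain ⟨ι, _, A, B, hP⟩ := P.exists_eval_append
  obtain ⟨CP, d, hCP, hAB⟩ := LaurentSymm.exists_norm_eval_le_family (Sum.elim A B)
  obtain ⟨Q, hQ, hK⟩ := exists_bddKer_Dker_min hδ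
  set c₁ : ℝ := (8 * CG * CP ^ 2 + 1) * 2 ^ δ * (1 + |μ|⁻¹) ^ (d + 1 + ⌈δ⌉₊) with hc₁
  have hc₁1 : 1 ≤ c₁ := by
    have h1 : 1 ≤ 8 * CG * CP ^ 2 + 1 := by
      have : 0 ≤ 8 * CG * CP ^ 2 := by positivity
      linarith
    have h2 : (1 : ℝ) ≤ 2 ^ δ := Real.one_le_rpow one_le_two hδ.le
    have h3 : 1 ≤ (1 + |μ|⁻¹) ^ (d + 1 + ⌈δ⌉₊) := one_le_pow₀ (by
      have : 0 ≤ |μ|⁻¹ := by positivity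
      linarith)
    exact one_le_mul_of_one_le_of_one_le (one_le_mul_of_one_le_of_one_le h1 h2) h3
  have hR0 : (0 : ℝ) ≤ Fintype.card ι := Nat.cast_nonneg _
  refine ⟨(Fintype.card ι + 1) * (Q.toReal + 1) * c₁, d, ?_, fun m n f hf => ?_⟩
  · exact one_le_mul_of_one_le_of_one_le (one_le_mul_of_one_le_of_one_le (by linarith)
      (by linarith [ENNReal.toReal_nonneg (a := Q)])) hc₁1
  set T : ℝ := c₁ ^ (m + n + 1) * stretch α (2 * d + 4 + 2 * δ * (m + n : ℕ)) with hT
  have hT0 : 0 ≤ T := by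
    have := (stretch_pos hα (by positivity : (0 : ℝ) ≤ 2 * d + 4 + 2 * δ * (m + n : ℕ))).le
    positivity
  -- Large enough for either group of variables to be the undamped one.
  set N := ⌈d + δ * (m + n : ℕ)⌉₊ with hN
  have hNm : d + δ * m ≤ N := by
    refine le_trans ?_ (Nat.le_ceil _)
    have : (m : ℝ) ≤ (m + n : ℕ) := by exact_mod_cast Nat.le_add_right m n
    gcongr
  have hNn : d + δ * n ≤ N := by
    refine le_trans ?_ (Nat.le_ceil _)
    have : (n : ℝ) ≤ (m + n : ℕ) := by exact_mod_cast Nat.le_add_left n m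
    gcongr
  set W : ℝ≥0∞ := Q ^ (m + n) * (m + n + 1 : ℕ) ^ (min m n) with hW
  have hA (r : ι) (a θ : Fin m → ℝ) : ‖(A r).eval (fun i => Complex.exp (cshift a θ i))‖ ≤ CP * (1 + energy θ) ^ d :=
    hAB (Sum.inl r) θ _ fun j => norm_exp_cshift a θ j
  have hB (r : ι) (b η : Fin n → ℝ) : ‖(B r).eval (fun i => -Complex.exp (cshift b η i))‖ ≤ CP * (1 + energy η) ^ d :=
    hAB (Sum.inr r) η _ fun j => by rw [norm_neg]; exact norm_exp_cshift b η j
  have hφ := φ.hasCompactSupport.isCompact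
  have hf' (ψ : Test₂ m n) : Tendsto (fun l => ∫ x, F μ P φ (m + n) (cpoint l x) * ψ x)
    (𝓝[Iplus (m + n)] upperNode m n) (𝓝 (f ψ)) := hf ψ
  have hμ0 : μ ≠ 0 := hμ.ne'
  have hleft (u : Test m) (v : Test n) (hu : eLpNorm u 2 volume ≤ 1) (hv : eLpNorm v 2 volume ≤ 1) :
      ‖f (tensor (damp α u) v)‖ₑ ≤ Fintype.card ι * (W * ENNReal.ofReal T) := by
    have ht := ((continuous_enorm.tendsto _).comp (hf' (tensor (damp α u) v)))
    refine le_of_tendsto ht ?_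
    filter_upwards [eventually_smallShift m n,
      (tendsto_leftIm m n).eventually (eventually_norm_mexp_le μ hφ u.hasCompactSupport.isCompact),
      (tendsto_rightIm m n).eventually (eventually_norm_mexp_le (-μ) hφ v.hasCompactSupport.isCompact),
      (tendsto_rightIm m n).eventually (eventually_energy_le hμ0 n N)] with l hs hxu hxv he
    simp only [momentum_neg_mass] at hxv
    have hk := hK n m _ _ hs
    refine (enorm_integral_F_le μ φ (fun x y => hP x y) l hk (damp α u) v).trans ?_
    refine (Finset.sum_le_card_nsmul _ _ (W * ENNReal.ofReal T) fun r _ => ?_).trans (le_of_eq (by simp))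
    refine (hk.enorm_integral_damp_le hδ.le hα hα1 φ hCG hG hμ0 _ _ (continuous_eval_exp_cshift (A r) _)
      (continuous_eval_neg_exp_cshift (B r) _) hCP (hA r _) (hB r _) u v hu hv hNn hxu hxv he.1 he.2).trans ?_
    exact mul_le_mul' le_rfl (ENNReal.ofReal_le_ofReal
      (damp_const_le hα hα1 hCG hδ (by positivity) d m n))
  have hright (u : Test m) (v : Test n) (hu : eLpNorm u 2 volume ≤ 1) (hv : eLpNorm v 2 volume ≤ 1) :
      ‖f (tensor u (damp α v))‖ₑ ≤ Fintype.card ι * (W * ENNReal.ofReal T) := by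
    have ht := ((continuous_enorm.tendsto _).comp (hf' (tensor u (damp α v))))
    refine le_of_tendsto ht ?_
    filter_upwards [eventually_smallShift m n,
      (tendsto_leftIm m n).eventually (eventually_norm_mexp_le μ hφ u.hasCompactSupport.isCompact),
      (tendsto_rightIm m n).eventually (eventually_norm_mexp_le (-μ) hφ v.hasCompactSupport.isCompact),
      (tendsto_leftIm m n).eventually (eventually_energy_le (neg_ne_zero.2 hμ0) m N)] with l hs hxu hxv he
    have hk := hK n m _ _ hs
    refine (enorm_integral_F_le μ φ (fun x y => hP x y) l hk u (damp α v)).trans ?_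
    refine (Finset.sum_le_card_nsmul _ _ (W * ENNReal.ofReal T) fun r _ => ?_).trans (le_of_eq (by simp))
    -- Damping on the right is the left case for the transposed kernel with mass `-μ`.
    have hb := hk.swap.enorm_integral_damp_le hδ.le hα hα1 φ hCG hG (neg_ne_zero.2 hμ0) _ _
      (continuous_eval_neg_exp_cshift (B r) (rightIm l)) (continuous_eval_exp_cshift (A r) (leftIm l))
      hCP (hB r (rightIm l)) (hA r (leftIm l)) v u hv hu hNm hxv (by
        simp only [momentum_neg_mass, neg_neg]; exact hxu) he.1 he.2
    have hconst := damp_const_le hα hα1 (CP := CP) hCG hδ (by positivity : 0 ≤ |-μ|⁻¹) d n m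
    simp only [Nat.add_comm n m, abs_neg] at hconst
    rw [abs_neg] at hb
    refine le_trans (le_of_eq ?_) (hb.trans (mul_le_mul' le_rfl (ENNReal.ofReal_le_ofReal hconst)))
    refine congrArg _ ((integral_prod_swap (μ := (volume : Measure (Fin m → ℝ)))
      (ν := (volume : Measure (Fin n → ℝ))) (fun z : (Fin m → ℝ) × (Fin n → ℝ) =>
      ((A r).eval (fun i => Complex.exp (cshift (leftIm l) z.1 i)) * u z.1) *
      ((B r).eval (fun i => -Complex.exp (cshift (rightIm l) z.2 i)) * damp α v z.2) *
      (fourierMink φ (momentum μ (cshift (leftIm l) z.1) - momentum μ (cshift (rightIm l) z.2)) *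
        Dker (cshift (leftIm l) z.1) (cshift (rightIm l) z.2)))).symm.trans ?_)
    refine integral_congr_ae (Eventually.of_forall fun z => ?_)
    simp only [Prod.fst_swap, Prod.snd_swap, momentum_neg_mass, neg_sub_neg]
    ring
  have hfin : Fintype.card ι * (W * ENNReal.ofReal T) ≤ ENNReal.ofReal (((Fintype.card ι + 1) * (Q.toReal + 1) * c₁) ^ (m + n + 1) *
      (m + n + 1 : ℕ) ^ (min m n) * stretch α (2 * d + 4 + 2 * δ * (m + n : ℕ))) := by
    have e1 : (Fintype.card ι : ℝ≥0∞) = ENNReal.ofReal (Fintype.card ι : ℝ) := by simp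
    have e2 : Q = ENNReal.ofReal Q.toReal := (ENNReal.ofReal_toReal hQ).symm
    have e3 : ((m + n + 1 : ℕ) : ℝ≥0∞) = ENNReal.ofReal ((m + n + 1 : ℕ) : ℝ) := by
      rw [ENNReal.ofReal_natCast]
    have hQ0 := ENNReal.toReal_nonneg (a := Q)
    rw [hW, e1, e2, e3, ← ENNReal.ofReal_pow hQ0, ← ENNReal.ofReal_pow (Nat.cast_nonneg _),
      ← ENNReal.ofReal_mul (by positivity), ← ENNReal.ofReal_mul (by positivity), ← ENNReal.ofReal_mul (by positivity),
      ← e2]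
    refine ENNReal.ofReal_le_ofReal ?_
    have h1 : (Fintype.card ι : ℝ) ≤ (Fintype.card ι + 1) ^ (m + n + 1) :=
      le_trans (by linarith) (le_self_pow₀ (a := (Fintype.card ι : ℝ) + 1) (by linarith) (Nat.succ_ne_zero _))
    have h2 : Q.toReal ^ (m + n) ≤ (Q.toReal + 1) ^ (m + n + 1) :=
      (pow_le_pow_left₀ hQ0 (by linarith) _).trans (pow_le_pow_right₀ (by linarith) (Nat.le_succ _))
    calc _ ≤ (Fintype.card ι + 1 : ℝ) ^ (m + n + 1) * ((Q.toReal + 1) ^ (m + n + 1) *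
          ((m + n + 1 : ℕ) : ℝ) ^ (min m n) * T) := by gcongr
      _ = _ := by
        rw [hT]
        clear_value c₁
        rw [mul_pow, mul_pow]
        generalize (Fintype.card ι + 1 : ℝ) ^ (m + n + 1) = X
        generalize (Q.toReal + 1) ^ (m + n + 1) = Y
        ring
  refine le_trans (le_trans (add_le_add (ENNReal.div_le_div_right (iSup₂_le fun u v => iSup₂_le fun hu hv => hleft u v hu hv) 2)
    (ENNReal.div_le_div_right (iSup₂_le fun u v => iSup₂_le fun hu hv => hright u v hu hv) 2)) (le_of_eq ?_)) hfin
  exact ENNReal.add_halves _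

/-! ### Asymptotics in the number of variables. -/

/-- At most exponential growth of a sequence of nonnegative reals. -/
def ExpBounded (g : ℕ → ℝ) : Prop :=
  ∃ c : ℝ, 1 ≤ c ∧ ∀ m, 0 ≤ g m ∧ g m ≤ c ^ (m + 1)

theorem ExpBounded.mul {g h : ℕ → ℝ} (hg : ExpBounded g) (hh : ExpBounded h) :
    ExpBounded (fun m => g m * h m) := by
  obtain ⟨c, hc, hg⟩ := hg
  obtain ⟨e, he, hh⟩ := hh
  refine ⟨c * e, one_le_mul_of_one_le_of_one_le hc he, fun m => ⟨mul_nonneg (hg m).1 (hh m).1, ?_⟩⟩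
  rw [mul_pow]
  exact mul_le_mul (hg m).2 (hh m).2 (hh m).1 (by positivity)

theorem expBounded_rpow {a : ℝ} (ha : 1 ≤ a) {A B : ℝ} (hA : 0 ≤ A) (hB : 0 ≤ B) :
    ExpBounded (fun m => a ^ (B + A * m)) := by
  refine ⟨a ^ (A + B), Real.one_le_rpow ha (by positivity), fun m => ⟨by positivity, ?_⟩⟩
  rw [← Real.rpow_natCast, ← Real.rpow_mul (by linarith)]
  refine Real.rpow_le_rpow_of_exponent_le ha ?_
  push_cast
  nlinarith [mul_nonneg hB (Nat.cast_nonneg (α := ℝ) m)]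

theorem expBounded_const {a : ℝ} (ha : 0 ≤ a) : ExpBounded (fun _ => a) :=
  ⟨a + 1, by linarith, fun m => ⟨ha, le_trans (by linarith)
    (le_self_pow₀ (a := a + 1) (by linarith) (Nat.succ_ne_zero m))⟩⟩

theorem expBounded_add_one_rpow {K : ℝ} (hK : 0 ≤ K) : ExpBounded (fun m => ((m : ℝ) + 1) ^ K) := by
  refine ⟨Real.exp K, Real.one_le_exp hK, fun m => ⟨by positivity, ?_⟩⟩
  calc ((m : ℝ) + 1) ^ K ≤ (Real.exp m) ^ K :=
        Real.rpow_le_rpow (by positivity) (Real.add_one_le_exp _) hK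
    _ = Real.exp (m * K) := (Real.exp_mul _ _).symm
    _ ≤ Real.exp K ^ (m + 1) := by
        rw [← Real.exp_nat_mul]
        refine Real.exp_le_exp.2 ?_
        push_cast
        nlinarith

/-- From `1 + 1/m ≤ e^(1/m)`; for `m = 0` both powers have exponent zero and equal one. -/
theorem add_one_rpow_mul_le {ε : ℝ} (hε : 0 ≤ ε) (m : ℕ) :
    ((m : ℝ) + 1) ^ (ε * m) ≤ Real.exp ε * (m : ℝ) ^ (ε * m) := by
  rcases Nat.eq_zero_or_pos m with rfl | hm
  · simpa using hε
  have hm' : (0 : ℝ) < m := by exact_mod_cast hm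
  have h1 : (m : ℝ) + 1 ≤ Real.exp (1 / m) * m := by
    have := Real.add_one_le_exp (1 / (m : ℝ))
    calc (m : ℝ) + 1 = (1 / m + 1) * m := by field_simp; ring
      _ ≤ _ := by gcongr
  calc ((m : ℝ) + 1) ^ (ε * m) ≤ (Real.exp (1 / m) * m) ^ (ε * m) :=
        Real.rpow_le_rpow (by positivity) h1 (by positivity)
    _ = Real.exp ε * (m : ℝ) ^ (ε * m) := by
        rw [Real.mul_rpow (Real.exp_pos _).le hm'.le, ← Real.exp_mul]
        congr 2
        field_simp

/-- With `δ = εα/2` the exponent in `stretch` is `K + εm` for a constant `K`, and its base is at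
most `a (m + 1)`. Apart from `(m + 1)^(εm)`, which is comparable to `m^(εm)`, all factors are
exponentially bounded in `m`. -/
theorem exists_bound_le_pow_mul {α : ℝ} (hα : 0 < α) (hα1 : α < 1) {c : ℝ} (hc : 1 ≤ c) (d n : ℕ) {ε : ℝ} (hε : 0 < ε) :
    ∃ c' : ℝ, 1 ≤ c' ∧ ∀ m : ℕ, 2 * (c ^ (m + n + 1) * (m + n + 1 : ℕ) ^ (min m n) *
        stretch α (2 * d + 4 + 2 * (ε * α / 2) * (m + n : ℕ))) ≤ c' ^ (m + 1) * (m : ℝ) ^ (ε * m) := by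
  -- Chosen so that the base `(1 + B + εαm)/α` of `stretch` is at most `a (m + 1)`.
  set a : ℝ := (2 * d + 5 + ε * α) / α * (n + 1) with ha
  have ha1 : 1 ≤ a := by
    have hd : (0 : ℝ) ≤ d := Nat.cast_nonneg _
    have hn : (0 : ℝ) ≤ n := Nat.cast_nonneg _
    refine one_le_mul_of_one_le_of_one_le ?_ (by linarith)
    rw [one_le_div hα]
    nlinarith [mul_pos hε hα]
  set B : ℝ := 2 * d + 4 + ε * α * n with hB
  set K : ℝ := (2 * d + 4) / α + ε * n with hK
  obtain ⟨c', hc', hbd⟩ := ((((((expBounded_const zero_le_two).mul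
    (expBounded_rpow hc zero_le_one (B := n + 1) (by positivity))).mul
    (expBounded_const (a := ((n : ℝ) + 1) ^ n) (by positivity))).mul
    (expBounded_add_one_rpow (K := n) (Nat.cast_nonneg _))).mul
    (expBounded_rpow one_le_two (A := ε * α) (B := B) (by positivity) (by positivity))).mul
    (expBounded_rpow ha1 (A := ε) (B := K) (by positivity) (by positivity))).mul
    ((expBounded_add_one_rpow (K := K) (by positivity)).mul (expBounded_const (Real.exp_pos ε).le))
  refine ⟨c', hc', fun m => ?_⟩
  refine le_trans ?_ (mul_le_mul_of_nonneg_right (hbd m).2 (by positivity))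
  have h1 : ((m + n + 1 : ℕ) : ℝ) ^ (min m n) ≤ (n + 1) ^ n * ((m : ℝ) + 1) ^ (n : ℝ) := by
    rw [Real.rpow_natCast, ← mul_pow]
    refine (pow_le_pow_right₀ (by exact_mod_cast Nat.le_add_left 1 _) (min_le_right m n)).trans ?_
    gcongr
    push_cast
    nlinarith [mul_nonneg (Nat.cast_nonneg (α := ℝ) m) (Nat.cast_nonneg (α := ℝ) n)]
  have h2 : c ^ (m + n + 1) = c ^ ((n : ℝ) + 1 + 1 * m) := by
    rw [← Real.rpow_natCast]
    congr 1
    push_cast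
    ring
  have hq : (2 * d + 4 + 2 * (ε * α / 2) * (m + n : ℕ) : ℝ) = B + ε * α * m := by
    rw [hB]; push_cast; ring
  have hq2 : (B + ε * α * m) / α = K + ε * m := by
    rw [hB, hK]; field_simp
  have hm1 : (0 : ℝ) < (m : ℝ) + 1 := by positivity
  have h3 : stretch α (2 * d + 4 + 2 * (ε * α / 2) * (m + n : ℕ)) ≤
      2 ^ (B + ε * α * m) * (a ^ (K + ε * m) * (((m : ℝ) + 1) ^ K * (Real.exp ε * (m : ℝ) ^ (ε * m)))) := by
    rw [hq, stretch, hq2]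
    refine mul_le_mul_of_nonneg_left ?_ (by positivity)
    have h4 : (1 + (B + ε * α * m)) / α ≤ a * (m + 1) := by
      rw [ha, hB, div_mul_eq_mul_div, div_mul_eq_mul_div, div_le_div_iff_of_pos_right hα]
      have hd : (0 : ℝ) ≤ d := Nat.cast_nonneg _
      have hn : (0 : ℝ) ≤ n := Nat.cast_nonneg _
      have hm : (0 : ℝ) ≤ m := Nat.cast_nonneg _
      have h5 := mul_pos hε hα
      have h6 : (2 * d + 5 + ε * α) * (1 + (n + m)) ≤ (2 * d + 5 + ε * α) * (n + 1) * (m + 1) := by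
        rw [mul_assoc]
        refine mul_le_mul_of_nonneg_left ?_ (by positivity)
        nlinarith [mul_nonneg hm hn]
      refine le_trans ?_ h6
      nlinarith [mul_nonneg hd (add_nonneg hn hm)]
    calc ((1 + (B + ε * α * m)) / α) ^ (K + ε * m) ≤ (a * (m + 1)) ^ (K + ε * m) :=
          Real.rpow_le_rpow (by positivity) h4 (by positivity)
      _ = a ^ (K + ε * m) * (((m : ℝ) + 1) ^ K * ((m : ℝ) + 1) ^ (ε * m)) := by
          rw [Real.mul_rpow (by linarith) hm1.le, Real.rpow_add hm1]
      _ ≤ _ := by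
          gcongr
          exact add_one_rpow_mul_le hε.le m
  have hst := (stretch_pos hα (by positivity : (0 : ℝ) ≤ 2 * d + 4 + 2 * (ε * α / 2) * (m + n : ℕ))).le
  calc _ ≤ 2 * (c ^ ((n : ℝ) + 1 + 1 * m) * ((n + 1) ^ n * ((m : ℝ) + 1) ^ (n : ℝ)) *
      (2 ^ (B + ε * α * m) * (a ^ (K + ε * m) * (((m : ℝ) + 1) ^ K * (Real.exp ε * (m : ℝ) ^ (ε * m)))))) := by
        rw [h2]
        gcongr
    _ = _ := by ring

/-! ### Reflection, lower boundary values and conclusion. -/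

/-- The test function `x ↦ φ (-x)`. -/
noncomputable def MinkTest.reflect (φ : MinkTest) : MinkTest where
  toFun x := φ (-x)
  contDiff' := φ.contDiff.comp contDiff_neg
  hasCompactSupport' := φ.hasCompactSupport.comp_homeomorph (Homeomorph.neg _)
  tsupport_subset' := Set.subset_univ _

theorem MinkTest.reflect_apply (φ : MinkTest) (x : ℝ × ℝ) : φ.reflect x = φ (-x) := rfl

theorem fourierMink_reflect (φ : MinkTest) (p : ℂ × ℂ) :
    fourierMink φ.reflect p = fourierMink φ (-p) := by
  unfold fourierMink
  congr 1
  rw [← integral_neg_eq_self (μ := (volume : Measure (ℝ × ℝ)))]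
  refine integral_congr_ae (Eventually.of_forall fun x => ?_)
  simp [MinkTest.reflect_apply]

/-- The symmetric Laurent function `x ↦ P(-x)`. -/
noncomputable def LaurentSymm.reflect (P : LaurentSymm) : LaurentSymm :=
  MvPolynomial.aeval (fun k : {k : ℤ // k ≠ 0} =>
    MvPolynomial.C ((-1 : ℂ) ^ (k : ℤ)) * MvPolynomial.X k) P

theorem LaurentSymm.eval_reflect {n : ℕ} (P : LaurentSymm) (x : Fin n → ℂ) :
    P.reflect.eval (fun i => -x i) = P.eval x := by
  induction P using MvPolynomial.induction_on with
  | C a => simp [reflect, LaurentSymm.eval_C, MvPolynomial.algebraMap_eq]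
  | add p q hp hq =>
    rw [LaurentSymm.eval_add, ← hp, ← hq, ← LaurentSymm.eval_add]
    simp [reflect]
  | mul_X p k hp =>
    have h : LaurentSymm.reflect (p * MvPolynomial.X k) =
        LaurentSymm.reflect p * (MvPolynomial.C ((-1 : ℂ) ^ (k : ℤ)) * MvPolynomial.X k) := by simp [reflect]
    rw [h, LaurentSymm.eval_mul, LaurentSymm.eval_mul, LaurentSymm.eval_mul, hp, LaurentSymm.eval_C,
      LaurentSymm.eval_X, LaurentSymm.eval_X, Finset.mul_sum]
    congr 1
    refine Finset.sum_congr rfl fun i _ => ?_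
    rw [← mul_zpow]
    simp

theorem momentum_add_I_mul_pi (μ : ℝ) {k : ℕ} (ζ : Fin k → ℂ) :
    momentum μ (fun j => ζ j + Complex.I * Real.pi) = -momentum μ ζ := by
  simp [momentum, mul_comm Complex.I, Complex.cosh_add, Complex.sinh_add, Complex.cosh_mul_I,
    Complex.sinh_mul_I]

/-- A common shift by `iπ` changes the sign of the momentum and of all `e^ζ` and leaves the
differences in `Modd` unchanged; both signs are compensated by reflecting `g` and `P`. -/
theorem F_eq_F_reflect (μ : ℝ) (P : LaurentSymm) (φ : MinkTest) {k : ℕ} (ζ : Fin k → ℂ) :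
    F μ P φ k ζ = F μ P.reflect φ.reflect k (fun j => ζ j + Complex.I * Real.pi) := by
  have h1 : (fun i => Complex.exp (ζ i + Complex.I * Real.pi)) = fun i => -Complex.exp (ζ i) := by
    funext i
    rw [Complex.exp_add, mul_comm Complex.I, Complex.exp_pi_mul_I]
    ring
  have h2 : Modd (fun j => ζ j + Complex.I * Real.pi) = Modd ζ := by simp [Modd]
  simp only [F, h1, h2, momentum_add_I_mul_pi, fourierMink_reflect, neg_neg]
  rw [LaurentSymm.eval_reflect P fun i => Complex.exp (ζ i)]

theorem IsUpperBoundaryValue.lower_of_reflect {μ : ℝ} {P : LaurentSymm} {φ : MinkTest} {m n : ℕ} {f : Distr m n}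
    (hf : IsUpperBoundaryValue (F μ P.reflect φ.reflect (m + n)) f) :
    IsLowerBoundaryValue (F μ P φ (m + n)) f := by
  intro ψ
  have ht : Tendsto (fun (l : Fin (m + n) → ℝ) j => l j + Real.pi)
      (𝓝[Iminus (m + n)] (Fin.append (fun _ : Fin m => -Real.pi) (fun _ : Fin n => 0)))
      (𝓝[Iplus (m + n)] (Fin.append (fun _ : Fin m => 0) (fun _ : Fin n => Real.pi))) := by
    refine tendsto_nhdsWithin_iff.2 ⟨?_, ?_⟩
    · have hc : Continuous fun (l : Fin (m + n) → ℝ) j => l j + Real.pi := by fun_prop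
      have h0 : (fun j => Fin.append (fun _ : Fin m => -Real.pi) (fun _ : Fin n => 0) j + Real.pi) =
          Fin.append (fun _ : Fin m => 0) (fun _ : Fin n => Real.pi) := by
        funext j
        refine Fin.addCases (fun i => ?_) (fun i => ?_) j <;> simp
      rw [← h0]
      exact (hc.tendsto _).mono_left nhdsWithin_le_nhds
    · filter_upwards [self_mem_nhdsWithin] with l hl
      refine ⟨fun i j hij => by simpa using hl.1 hij, fun j => ?_⟩
      have := hl.2 j
      constructor <;> linarith
  refine ((hf ψ).comp ht).congr fun l => ?_
  refine integral_congr_ae (Eventually.of_forall fun x => ?_)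
  simp only
  rw [F_eq_F_reflect μ P φ]
  congr 2
  funext j
  push_cast
  ring

/-- Finiteness of each norm follows with any `δ`, here `δ = 1`; the growth in `m` requires `δ =
εα/2`, adapted to `ε`. The boundary values themselves are chosen before `ε`. -/
theorem exists_boundary_family {μ : ℝ} (hμ : 0 < μ) {α : ℝ} (hα : 0 < α) (hα1 : α < 1) (P : LaurentSymm)
    (φ : MinkTest) {b : ℝ} (hb : ∀ p : ℝ × ℝ, ‖fourierMink φ ((p.1 : ℂ), (p.2 : ℂ))‖ ≤ b * Real.exp (-‖p‖ ^ α)) :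
    ∃ f : (m n : ℕ) → Distr m n, (∀ m n, IsUpperBoundaryValue (F μ P φ (m + n)) (f m n)) ∧
      (∀ m n, omegaNorm α (f m n) < ⊤) ∧
      ∀ ε : ℝ, 0 < ε → ∀ n : ℕ, ∃ c : ℝ, 0 < c ∧ ∀ m : ℕ,
        omegaNorm α (f m n) + omegaNorm α (f n m) ≤ ENNReal.ofReal (c ^ (m + 1) * (m : ℝ) ^ (ε * m)) := by
  choose f hf using exists_isUpperBoundaryValue μ P φ.continuous φ.hasCompactSupport
  refine ⟨f, hf, fun m n => ?_, fun ε hε n => ?_⟩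
  · obtain ⟨c, d, -, h⟩ := exists_omegaNorm_le hμ hα hα1 P φ hb one_pos
    exact (h m n _ (hf m n)).trans_lt ENNReal.ofReal_lt_top
  · obtain ⟨c, d, hc, h⟩ := exists_omegaNorm_le hμ hα hα1 P φ hb (δ := ε * α / 2) (by positivity)
    obtain ⟨c', hc', h'⟩ := exists_bound_le_pow_mul hα hα1 hc d n hε
    refine ⟨c', by linarith, fun m => ?_⟩
    have h1 := h m n _ (hf m n)
    have h2 := h n m _ (hf n m)
    rw [Nat.add_comm n m, min_comm n m] at h2
    refine (add_le_add h1 h2).trans (le_trans (le_of_eq ?_) (ENNReal.ofReal_le_ofReal (h' m)))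
    rw [← two_mul, ENNReal.ofReal_mul zero_le_two]
    simp

theorem HasAlphaDecay.norm_fourierMink_le {α : ℝ} {g : ℝ × ℝ → ℂ} (hg : HasAlphaDecay α g) :
    ∃ b : ℝ, ∀ p : ℝ × ℝ, ‖fourierMink g ((p.1 : ℂ), (p.2 : ℂ))‖ ≤ b * Real.exp (-‖p‖ ^ α) := by
  -- Decay of the Fourier transform itself at rate one suffices: derivatives of `g` in position
  -- space correspond to powers of the momentum.
  obtain ⟨b, hb⟩ := hg 0 0 1 one_pos
  refine ⟨b, fun p => ?_⟩
  have := hb p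
  simp only [iteratedDeriv_zero, one_mul] at this
  rw [Real.exp_neg, ← div_eq_mul_inv, le_div_iff₀ (Real.exp_pos _), mul_comm]
  exact this

end OddIsing

open OddIsing in
theorem proposition5p5 (μ : ℝ) (hμ : 0 < μ) (α : ℝ) (hα₀ : 0 < α) (hα₁ : α < 1)
    (P : LaurentSymm) (hP : P ∈ LambdaI)
    (O : TopologicalSpace.Opens (ℝ × ℝ)) (hO : Bornology.IsBounded (O : Set (ℝ × ℝ)))
    (g : 𝓓(O, ℂ)) (hg : HasAlphaDecay α g) :
    (∃ f : (m n : ℕ) → Distr m n,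
      (∀ m n, IsUpperBoundaryValue (F μ P g (m + n)) (f m n)) ∧
      ∀ ε : ℝ, 0 < ε → ∀ n : ℕ, ∃ c : ℝ, 0 < c ∧ ∀ m : ℕ,
        omegaNorm α (f m n) + omegaNorm α (f n m) ≤
          ENNReal.ofReal (c ^ (m + 1) * (m : ℝ) ^ (ε * m))) ∧
    (∃ f' : (m n : ℕ) → Distr m n,
      (∀ m n, IsLowerBoundaryValue (F μ P g (m + n)) (f' m n)) ∧
      ∀ ε : ℝ, 0 < ε → ∀ n : ℕ, ∃ c : ℝ, 0 < c ∧ ∀ m : ℕ,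
        omegaNorm α (f' m n) + omegaNorm α (f' n m) ≤
          ENNReal.ofReal (c ^ (m + 1) * (m : ℝ) ^ (ε * m))) ∧
    BoundsAtNodes α (F μ P g) := by
  obtain ⟨b, hb⟩ := hg.norm_fourierMink_le
  -- The same function, regarded as a test function on the whole plane.
  set φ : MinkTest := ⟨g, g.contDiff, g.hasCompactSupport, Set.subset_univ _⟩ with hφ
  have hφg : (g : ℝ × ℝ → ℂ) = φ := rfl
  rw [hφg] at hb ⊢
  have hb' (p : ℝ × ℝ) : ‖fourierMink φ.reflect ((p.1 : ℂ), (p.2 : ℂ))‖ ≤ b * Real.exp (-‖p‖ ^ α) := by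
    rw [fourierMink_reflect]
    simpa using hb (-p)
  obtain ⟨f, hf, hfin, hbd⟩ := exists_boundary_family hμ hα₀ hα₁ P φ hb
  obtain ⟨f', hf', hfin', hbd'⟩ := exists_boundary_family hμ hα₀ hα₁ P.reflect φ.reflect hb'
  exact ⟨⟨f, hf, hbd⟩, ⟨f', fun m n => (hf' m n).lower_of_reflect, hbd'⟩,
    fun m n => ⟨⟨f m n, hf m n, hfin m n⟩, ⟨f' m n, (hf' m n).lower_of_reflect, hfin' m n⟩⟩⟩
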